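/- **Setting.** Let $\mathcal X,\mathcal Y$ be finite alphabets, let $P_{Y_iX_i}$, $i\in[1:m]$, be distributions on $\mathcal Y\times\mathcal X$ with marginals $P_{Y_i},P_{X_i}$, and let $\nu_1,\dots,\nu_m>0$ with $\sum_i\nu_i=1$. Let $\mathcal P_{\mathcal X}=\{P_{X_1},\dots,P_{X_m}\}$ be the set of distinct $\mathcal X$-marginals, and for $s\in\mathcal P_{\mathcal X}$ let $\mathfrak F_s=\{i: P_{X_i}=s\}$. Let $(Q_{Y_j^n})_n$, $j\in[1:k]$, and $(Q_{X_t^n})_n$, $t\in[1:r]$, be processes on $\mathcal Y$ and $\mathcal X$ that are in one of the following two categories. 1. All are memoryless, $Q_{Y_j^n}=Q_{Y_j}^{\otimes n}$ and $Q_{X_t^n}=Q_{X_t}^{\otimes n}$. Put $A_Y^{(ij)}=D(P_{Y_i}\|Q_{Y_j})$ and $A_X^{(st)}=D(s\|Q_{X_t})$. 2. All are Markov processes of finite order with stationary transition probabilities, and $P_{Y_i}^{\otimes n}\ll Q_{Y_j^n}$, $s^{\otimes n}\ll Q_{X_t^n}$ for all $i,j,s,t,n$. Put $A_Y^{(ij)}=\lim_n[D(P_{Y_i}^{\otimes(n+1)}\|Q_{Y_j^{n+1}})-D(P_{Y_i}^{\otimes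 n}\|Q_{Y_j^n})]$ and $A_X^{(st)}=\lim_n[D(s^{\otimes(n+1)}\|Q_{X_t^{n+1}})-D(s^{\otimes n}\|Q_{X_t^n})]$. In both cases assume $d_i^\star:=\min_jA_Y^{(ij)}<\infty$ for all $i$ and $d_s^\star:=\min_tA_X^{(st)}<\infty$ for all $s\in\mathcal P_{\mathcal X}$, and let $j_i^\star,t_s^\star$ be the first minimizers. Fix $\gamma_q\in(0,1)$ and numbers $\Gamma_q(n)\ge1$ with $\frac1n\log\Gamma_q(n)\to0$. Let $\mathfrak Q_n$ be the set of measures $\sum_{j,t}\tau_{jt}\,Q_{Y_j^n}\times Q_{X_t^n}$ with $0\le\tau_{jt}\le\Gamma_q(n)$ for all $j,t$ and $\tau_{j_i^\star t_s^\star}\ge\gamma_q$ for all $s\in\mathcal P_{\mathcal X}$, $i\in\mathfrak F_s$. **Testing problem.** A testing scheme consists of $\phi_n:\mathcal X^n\to\mathcal M_n$ with $\mathcal M_n$ finite, $|\phi_n|:=|\mathcal M_n|$, and a possibly randomized decision $\psi_n$ based on $(y^n,\phi_n(x^n))$. Let $\alpha_n$ be the probability of rejecting the null hypothesis under $P_{Y^nX^n}=\sum_i\nu_iP_{Y_iX_i}^{\otimes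 n}$, and let $\beta_n$ be the supremum over $Q\in\mathfrak Q_n$ of the $Q$-measure of accepting it. $E\in\mathbb R$ is $\epsilon$-achievable at rate $R_c$ if some sequence of schemes satisfies $\limsup_n\alpha_n\le\epsilon$, $\liminf_n\frac1n\log\frac1{\beta_n}\ge E$ (with $\log\frac10=+\infty$) and $\limsup_n\frac1n\log|\phi_n|\le R_c$; $E^\star_{\mathrm{mix},\epsilon}(R_c)$ is the supremum of all such $E$. **Quantities.** For a kernel $P_{U|X}$ with finite output alphabet let $I(X_i;U)$ and $I(Y_i;U)$ be computed under $U-X_i-Y_i$, and for $i\in\mathfrak F_s$ put $$\xi_i(R_c)=\max_{P_{U|X}:\,I(X_i;U)\le R_c}I(Y_i;U)+d_i^\star+d_s^\star .$$ Let $\mathcal W_s^{(i)}(R_c)$ be the set of kernels that attain $\xi_i(R_c)$ and have $I(X_i;U)=R_c$. Let $\mathcal O_s(R_c)=\bigcap_{i\in\mathfrak F_s}\mathcal W_s^{(i)}(R_c)$ if this is non-empty, and $\mathcal O_s(R_c)=\bigcup_{i\in\mathfrak F_s}\mathcal W_s^{(i)}(R_c)$ otherwise. **Separability assumption (at $R_c$).**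 For every $s\in\mathcal P_{\mathcal X}$ there is one ordering $i_1,\dots,i_{|\mathfrak F_s|}$ of $\mathfrak F_s$ such that $I(Y_{i_1};U)+d_{i_1}^\star\le I(Y_{i_2};U)+d_{i_2}^\star\le\cdots$ holds for all kernels in $\mathcal O_s(R_c)$. **Theorem.** Let $R_c\ge0$ and let the separability assumption hold at $R_c$. Let $\pi$ be a permutation of $[1:m]$ such that $\bar\xi_i(R_c):=\xi_{\pi^{-1}(i)}(R_c)$ is non-decreasing in $i$, and put $\bar\nu_i:=\nu_{\pi^{-1}(i)}$. Then for every $i\in[1:m]$ and every $\epsilon$ with $\sum_{j=1}^{i-1}\bar\nu_j\le\epsilon<\sum_{j=1}^{i}\bar\nu_j$, $$E^\star_{\mathrm{mix},\epsilon}(R_c)=\bar\xi_i(R_c).$$ -/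

import Mathlib

open Filter Topology
open scoped BigOperators ENNReal

noncomputable section

namespace MixHT

/-! Distributions on a finite alphabet `A` are functions `A → ℝ` in `stdSimplex ℝ A`;
logarithms are natural. -/

/-- Absolute continuity `P ≪ Q` on a finite alphabet. -/
def AbsCont {A : Type*} (P Q : A → ℝ) : Prop := ∀ a, Q a = 0 → P a = 0

open Classical in
/-- The divergence `D(P‖Q)`, equal to `+∞` unless `P ≪ Q`. -/
def klD {A : Type*} [Fintype A] (P Q : A → ℝ) : EReal :=
  if AbsCont P Q then ((∑ a, P a * Real.log (P a / Q a) : ℝ) : EReal) else ⊤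

/-- The product distribution `P^{⊗ n}` on `A^n`. -/
def iidLaw {A : Type*} (P : A → ℝ) (n : ℕ) : (Fin n → A) → ℝ := fun x => ∏ l, P (x l)

/-- Mutual information (in nats) of a joint distribution on `A × B`. -/
def mutualInfo {A B : Type*} [Fintype A] [Fintype B] (J : A → B → ℝ) : ℝ :=
  ∑ a, ∑ b, J a b * Real.log (J a b / ((∑ b', J a b') * ∑ a', J a' b))

/-- A sequence of functions on `A^n`, `n = 0, 1, 2, …`: the finite-dimensional laws of a process. -/
abbrev SeqLaw (A : Type*) := (n : ℕ) → (Fin n → A) → ℝ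

/-- The process is i.i.d. -/
def IsMemoryless {A : Type*} [Fintype A] (Q : SeqLaw A) : Prop :=
  ∃ q ∈ stdSimplex ℝ A, ∀ n, Q n = iidLaw q n

/-- The process is a Markov process of some finite order `w` with stationary transition
probabilities `K` (and arbitrary initial law). -/
def IsFiniteOrderMarkov {A : Type*} [Fintype A] (Q : SeqLaw A) : Prop :=
  (∀ n, Q n ∈ stdSimplex ℝ (Fin n → A)) ∧
  (∀ n (x : Fin n → A), Q n x = ∑ a, Q (n + 1) (Fin.snoc (α := fun _ => A) x a)) ∧
  ∃ (w : ℕ) (K : (Fin w → A) → A → ℝ),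
    (∀ c, K c ∈ stdSimplex ℝ A) ∧
    ∀ (l : ℕ) (x : Fin (l + w) → A) (a : A),
      Q (l + w + 1) (Fin.snoc (α := fun _ => A) x a)
        = Q (l + w) x * K (fun j => x (Fin.natAdd l j)) a

/-- The two categories of alternatives. -/
inductive Category
  | memoryless
  | markov

/-- The divergence (rate) of the i.i.d. source `P` with respect to the process `Q`: the one-letter
divergence in the memoryless category, the limit of the divergence increments in the Markov
category. -/
def divRate {A : Type*} [Fintype A] (c : Category) (P : A → ℝ) (Q : SeqLaw A) : EReal :=
  match c with
  | .memoryless => klD P (fun a => Q 1 (fun _ => a))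
  | .markov => limUnder atTop fun n : ℕ =>
      klD (iidLaw P (n + 1)) (Q (n + 1)) - klD (iidLaw P n) (Q n)

/-- The family `Q` belongs to the category `c` relative to the sources `P`, with
finite minimal divergence (rate) for each source. -/
def InCategory {A : Type*} [Fintype A] {m k : ℕ} (c : Category)
    (P : Fin m → A → ℝ) (Q : Fin k → SeqLaw A) : Prop :=
  (match c with
    | .memoryless => ∀ j, IsMemoryless (Q j)
    | .markov => (∀ j, IsFiniteOrderMarkov (Q j)) ∧
        ∀ i j n, AbsCont (iidLaw (P i) n) (Q j n)) ∧
  ∀ i, (⨅ j, divRate c (P i) (Q j)) < ⊤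

/-- `j` is the first minimizer of `f`. -/
def IsFirstArgmin {k : ℕ} (f : Fin k → EReal) (j : Fin k) : Prop :=
  (∀ j', f j ≤ f j') ∧ ∀ j' < j, f j < f j'

/-- A kernel `P_{U|X}` with a finite (otherwise arbitrary) output alphabet. -/
structure TestChannel (X : Type*) where
  size : ℕ
  prob : X → Fin size → ℝ
  mem : ∀ x, prob x ∈ stdSimplex ℝ (Fin size)

/-- A testing scheme for blocklength `n`: a compression map into `size` messages and a (possibly
randomized) decision map; `accept y u` is the probability of deciding for the null hypothesis. -/
structure Scheme (X Y : Type*) (n : ℕ) where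
  size : ℕ
  enc : (Fin n → X) → Fin size
  accept : (Fin n → Y) → Fin size → ℝ
  mem : ∀ y u, accept y u ∈ Set.Icc (0 : ℝ) 1

/-- The data: joint laws `P i` of `(Y_i, X_i)`, the processes `Q_{Y_j}` and `Q_{X_t}`, and the
category to which these belong. -/
structure Setup (X Y : Type*) (m k r : ℕ) where
  P : Fin m → Y × X → ℝ
  QY : Fin k → SeqLaw Y
  QX : Fin r → SeqLaw X
  cat : Category

namespace Setup

variable {X Y : Type*} [Fintype X] [Fintype Y] {m k r : ℕ} (S : Setup X Y m k r)

/-- The marginal law of `X_i`. -/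
def PX (i : Fin m) : X → ℝ := fun x => ∑ y, S.P i (y, x)

/-- The marginal law of `Y_i`. -/
def PY (i : Fin m) : Y → ℝ := fun y => ∑ x, S.P i (y, x)

/-- The standing assumptions on the sources and the alternatives. -/
def Valid : Prop :=
  (∀ i, S.P i ∈ stdSimplex ℝ (Y × X)) ∧
    InCategory S.cat S.PX S.QX ∧ InCategory S.cat S.PY S.QY

/-- `d_i^⋆ = min_j` of the divergence (rate) of `P_{Y_i}` with respect to `Q_{Y_j}`. -/
def dY (i : Fin m) : ℝ := (⨅ j, divRate S.cat (S.PY i) (S.QY j)).toReal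

/-- `d_s^⋆ = min_t` of the divergence (rate) of the `X`-marginal `s` with respect to `Q_{X_t}`. -/
def dX (s : X → ℝ) : ℝ := (⨅ t, divRate S.cat s (S.QX t)).toReal

/-- `𝔉_s`: the indices whose `X`-marginal is `s`. -/
def cls (s : X → ℝ) : Set (Fin m) := {i | S.PX i = s}

/-- `I(X;U)` when `X ∼ s` and `U` is the output of `K`. -/
def infoXU (s : X → ℝ) (K : TestChannel X) : ℝ := mutualInfo fun x u => s x * K.prob x u

/-- `I(Y_i;U)` for the Markov chain `Y_i - X_i - U`, `U` being the output of `K`. -/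
def infoYU (i : Fin m) (K : TestChannel X) : ℝ :=
  mutualInfo fun y u => ∑ x, S.P i (y, x) * K.prob x u

/-- `ξ_i(R)`. -/
def xi (R : ℝ) (i : Fin m) : ℝ :=
  sSup {v | ∃ K : TestChannel X, infoXU (S.PX i) K ≤ R ∧ v = S.infoYU i K}
    + (S.dY i + S.dX (S.PX i))

/-- `𝒲_s^{(i)}(R)` for `i ∈ 𝔉_s`: the kernels with `I(X;U) = R` that are optimal for `ξ_i(R)`. -/
def optKernels (R : ℝ) (s : X → ℝ) (i : Fin m) : Set (TestChannel X) :=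
  {K | infoXU s K = R ∧ S.infoYU i K + (S.dY i + S.dX s) = S.xi R i}

open Classical in
/-- `𝒪_s(R)`. -/
def commonKernels (R : ℝ) (s : X → ℝ) : Set (TestChannel X) :=
  if (⋂ i ∈ S.cls s, S.optKernels R s i).Nonempty then ⋂ i ∈ S.cls s, S.optKernels R s i
  else ⋃ i ∈ S.cls s, S.optKernels R s i

/-- The enumeration `σ` of `𝔉_s` arranges the numbers `I(Y_i;U) + d_i^⋆` in increasing order. -/
def Arranges {s : X → ℝ} (σ : Fin (Nat.card (S.cls s)) ≃ S.cls s) (K : TestChannel X) : Prop :=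
  Monotone fun a => S.infoYU (σ a) K + S.dY (σ a)

/-- Separability: in every class the order is the same for all kernels in `𝒪_s(R)`. -/
def Separable (R : ℝ) : Prop :=
  ∀ s ∈ Set.range S.PX, ∃ σ : Fin (Nat.card (S.cls s)) ≃ S.cls s,
    ∀ K ∈ S.commonKernels R s, S.Arranges σ K

/-- The mixture `∑ ν_i P_{Y_i X_i}^{⊗ n}`. -/
def mixture (ν : Fin m → ℝ) (n : ℕ) (y : Fin n → Y) (x : Fin n → X) : ℝ :=
  ∑ i, ν i * iidLaw (S.P i) n (fun l => (y l, x l))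

/-- The admissible weights `τ` (for lower bound `γ` and upper bound `Γ`). -/
def weights (γ Γ : ℝ) : Set (Fin k → Fin r → ℝ) :=
  {τ | (∀ j t, τ j t ∈ Set.Icc 0 Γ) ∧
    ∀ i j t, IsFirstArgmin (fun j' => divRate S.cat (S.PY i) (S.QY j')) j →
      IsFirstArgmin (fun t' => divRate S.cat (S.PX i) (S.QX t')) t → γ ≤ τ j t}

/-- The class `𝔔_n` of measures under the alternative. -/
def alternatives (γ Γ : ℝ) (n : ℕ) : Set ((Fin n → Y) → (Fin n → X) → ℝ) :=
  {Q | ∃ τ ∈ S.weights γ Γ, Q = fun y x => ∑ j, ∑ t, τ j t * (S.QY j n y * S.QX t n x)}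

/-- Type I error `α_n`. -/
def typeI (ν : Fin m → ℝ) {n : ℕ} (T : Scheme X Y n) : ℝ :=
  ∑ y, ∑ x, S.mixture ν n y x * (1 - T.accept y (T.enc x))

/-- Type II error `β_n`, the supremum over `𝔔_n`. -/
def typeII (γ Γ : ℝ) {n : ℕ} (T : Scheme X Y n) : ℝ≥0∞ :=
  ⨆ Q ∈ S.alternatives γ Γ n, ENNReal.ofReal (∑ y, ∑ x, Q y x * T.accept y (T.enc x))

/-- `E` is an `ε`-achievable exponent at rate `R`. -/
def Achievable (ν : Fin m → ℝ) (γ : ℝ) (Γ : ℕ → ℝ) (ε R E : ℝ) : Prop :=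
  ∃ T : (n : ℕ) → Scheme X Y n,
    limsup (fun n => (S.typeI ν (T n) : EReal)) atTop ≤ (ε : EReal) ∧
    (E : EReal) ≤ liminf (fun n : ℕ =>
      ENNReal.log ((S.typeII γ (Γ n) (T n))⁻¹) / (n : EReal)) atTop ∧
    limsup (fun n : ℕ => ((Real.log (T n).size / n : ℝ) : EReal)) atTop ≤ (R : EReal)

/-- `E^⋆_{mix,ε}(R)`, the supremum of the `ε`-achievable exponents. -/
def maxExponent (ν : Fin m → ℝ) (γ : ℝ) (Γ : ℕ → ℝ) (ε R : ℝ) : EReal :=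
  ⨆ E ∈ {E : ℝ | S.Achievable ν γ Γ ε R E}, (E : EReal)

end Setup

end MixHT

end

noncomputable section

namespace MixHT

/-! ### The Gibbs inequality and entropy -/

/-! The mixtures in the alternative play no role at the exponential scale. Weights are at most Γ(n)
= e^{o(n)}, and the constant weight Γ(n) is admissible because γ ≤ 1 ≤ Γ(n). Hence β_n agrees, up to
subexponential factors, with the largest measure of acceptance under the products Q_{Y_j^n} ×
Q_{X_t^n}. The log-likelihood ratio of an i.i.d. source against such a process concentrates around n
times the divergence rate: changing one letter affects boundedly many transitions, so the variance
is O(n). In the memoryless case with infinite divergence the ratio exceeds every e^{nD} with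
probability tending to one. Thus Q_Y × Q_X can be exchanged for P_Y^n × P_X^n, which accounts for
the summands d_i^⋆ + d_s^⋆, and testing against independence remains.

Achievability (`achievable_of_sum_le`). Fix a level v and give up the sources with ξ_i < v; their
weight is the type I error. Sources of one class share the law of X, hence also the law of the
codewords, and separability supplies one kernel that reaches level v for every remaining source of
the class (`exists_class_kernel`). A random codebook for this kernel covers almost all x^n, and y^n
is accepted if it fits the received word for some source (`exists_class_code`). The class itself is
read off x^n by comparing likelihoods, at the cost of a constant factor in the number of messages.

Converse (`exists_le_xi_of_achievable`). If ε is below the total weight of a set F of sources, some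
source in F is accepted infinitely often with probability at least some η > 0. Conditioning its law
on acceptance changes log-probabilities by a constant only, so chain rules turn the conditioned law
into a point of a compact convex set of entropies that obeys the single-letter constraints up to
terms vanishing with n (`exists_converse_point`). At a limit point, equality in the Gibbs inequality
identifies the law of (Y, X), and equality in strong subadditivity gives the Markov chain Y − X − U;
the limit is therefore a kernel and E ≤ ξ_i (`exists_channel_of_approx`). Since any fixed η > 0
suffices, ε matters only through which sources can be given up. -/

lemma sub_le_mul_log_sub_log {a b : ℝ} (ha : 0 ≤ a) (hb : 0 ≤ b) (hab : b = 0 → a = 0) :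
    a - b ≤ a * (Real.log a - Real.log b) := by
  rcases ha.eq_or_lt with rfl | ha'
  · simpa using hb
  have hb' : 0 < b := lt_of_le_of_ne hb fun h => ha'.ne' (hab h.symm)
  have h := Real.log_le_sub_one_of_pos (div_pos hb' ha')
  rw [Real.log_div hb'.ne' ha'.ne'] at h
  have h2 := mul_le_mul_of_nonneg_left h ha
  rw [mul_sub a (b / a), mul_div_cancel₀ _ ha'.ne'] at h2
  linarith

lemma eq_of_mul_log_sub_log_le {a b : ℝ} (ha : 0 ≤ a) (hb : 0 ≤ b) (hab : b = 0 → a = 0)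
    (h : a * (Real.log a - Real.log b) ≤ a - b) : a = b := by
  rcases ha.eq_or_lt with rfl | ha'
  · simp at h; linarith
  have hb' : 0 < b := lt_of_le_of_ne hb fun h => ha'.ne' (hab h.symm)
  by_contra hne
  have hne' : b / a ≠ 1 := fun h => hne ((div_eq_one_iff_eq ha'.ne').1 h).symm
  have h1 := Real.log_lt_sub_one_of_pos (div_pos hb' ha') hne'
  rw [Real.log_div hb'.ne' ha'.ne'] at h1
  have h2 := mul_lt_mul_of_pos_left h1 ha'
  rw [mul_sub a (b / a), mul_div_cancel₀ _ ha'.ne'] at h2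
  linarith

section Gibbs

variable {A : Type*} [Fintype A] {p q : A → ℝ}

lemma gibbs (hp : ∀ a, 0 ≤ p a) (hq : ∀ a, 0 ≤ q a) (hpq : AbsCont p q)
    (hsum : ∑ a, q a ≤ ∑ a, p a) : 0 ≤ ∑ a, p a * (Real.log (p a) - Real.log (q a)) := by
  have := Finset.sum_le_sum fun a (_ : a ∈ Finset.univ) =>
    sub_le_mul_log_sub_log (hp a) (hq a) (hpq a)
  rw [Finset.sum_sub_distrib] at this
  linarith

/-- Every p (log p − log q) − (p − q) is nonnegative, so a nonpositive total forces each of them to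
vanish, and log t < t − 1 for t ≠ 1 then gives equality of the weights. -/
lemma eq_of_gibbs (hp : ∀ a, 0 ≤ p a) (hq : ∀ a, 0 ≤ q a) (hpq : AbsCont p q)
    (hsum : ∑ a, q a ≤ ∑ a, p a)
    (h : ∑ a, p a * (Real.log (p a) - Real.log (q a)) ≤ 0) : p = q := by
  have h0 : ∀ a ∈ Finset.univ, 0 ≤ p a * (Real.log (p a) - Real.log (q a)) - (p a - q a) :=
    fun a _ => sub_nonneg.2 (sub_le_mul_log_sub_log (hp a) (hq a) (hpq a))
  have h1 : ∑ a, (p a * (Real.log (p a) - Real.log (q a)) - (p a - q a)) = 0 := by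
    refine le_antisymm ?_ (Finset.sum_nonneg h0)
    rw [Finset.sum_sub_distrib, Finset.sum_sub_distrib]
    linarith
  funext a
  have := (Finset.sum_eq_zero_iff_of_nonneg h0).1 h1 a (Finset.mem_univ a)
  exact eq_of_mul_log_sub_log_le (hp a) (hq a) (hpq a) (by linarith)

end Gibbs

/-- The entropy (in nats) of a distribution on a finite alphabet. -/
def ent {A : Type*} [Fintype A] (p : A → ℝ) : ℝ := ∑ a, Real.negMulLog (p a)

lemma ent_eq {A : Type*} [Fintype A] (p : A → ℝ) : ent p = -∑ a, p a * Real.log (p a) := by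
  simp [ent, Real.negMulLog]

lemma continuous_ent {A : Type*} [Fintype A] : Continuous (ent : (A → ℝ) → ℝ) := by
  unfold ent; fun_prop

lemma ent_comp_equiv {A B : Type*} [Fintype A] [Fintype B] (e : A ≃ B) (p : B → ℝ) :
    ent (fun a => p (e a)) = ent p := by
  unfold ent
  exact e.sum_comp fun b => Real.negMulLog (p b)

/-- Entropy is at most cross entropy. -/
lemma ent_le_cross {A : Type*} [Fintype A] {p q : A → ℝ} (hp : ∀ a, 0 ≤ p a) (hq : ∀ a, 0 ≤ q a)
    (hpq : AbsCont p q) (hsum : ∑ a, q a ≤ ∑ a, p a) : ent p ≤ -∑ a, p a * Real.log (q a) := by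
  have := gibbs hp hq hpq hsum
  simp only [mul_sub, Finset.sum_sub_distrib] at this
  rw [ent_eq]; linarith

lemma ent_le_log_card {A : Type*} [Fintype A] {p : A → ℝ} (hp : p ∈ stdSimplex ℝ A) :
    ent p ≤ Real.log (Fintype.card A) := by
  rcases isEmpty_or_nonempty A with h | h
  · simp [ent]
  have hc : (0 : ℝ) < Fintype.card A := by exact_mod_cast Fintype.card_pos
  refine (ent_le_cross (q := fun _ => (Fintype.card A : ℝ)⁻¹) hp.1 (fun _ => by positivity)
    (fun a h => absurd h (by positivity)) ?_).trans ?_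
  · rw [hp.2]; simp
  · rw [← Finset.sum_mul, hp.2]; simp

/-! ### Conditional mutual information and strong subadditivity. -/

section CondIndep

variable {A B C : Type*} [Fintype A] [Fintype B]

/-- The conditionally independent law with the same `AC`- and `BC`-marginals as `J`. -/
def condProd (J : A × B × C → ℝ) (t : A × B × C) : ℝ :=
  (∑ b, J (t.1, b, t.2.2)) * (∑ a, J (a, t.2.1, t.2.2)) / ∑ a, ∑ b, J (a, b, t.2.2)

variable {J : A × B × C → ℝ}

lemma condProd_pos (hJ : ∀ t, 0 ≤ J t) {t : A × B × C} (ht : 0 < J t) :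
    0 < (∑ b, J (t.1, b, t.2.2)) ∧ 0 < (∑ a, J (a, t.2.1, t.2.2)) ∧
      0 < ∑ a, ∑ b, J (a, b, t.2.2) := by
  have h1 : 0 < ∑ b, J (t.1, b, t.2.2) :=
    Finset.sum_pos' (fun b _ => hJ _) ⟨t.2.1, Finset.mem_univ _, ht⟩
  refine ⟨h1, Finset.sum_pos' (fun b _ => hJ _) ⟨t.1, Finset.mem_univ _, ht⟩, ?_⟩
  exact Finset.sum_pos' (fun b _ => Finset.sum_nonneg fun _ _ => hJ _)
    ⟨t.1, Finset.mem_univ _, h1⟩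

lemma absCont_condProd (hJ : ∀ t, 0 ≤ J t) : AbsCont J (condProd J) := by
  intro t ht
  by_contra h
  obtain ⟨ha, hb, hc⟩ := condProd_pos hJ (lt_of_le_of_ne (hJ t) (Ne.symm h))
  exact (div_pos (mul_pos ha hb) hc).ne' ht

lemma condProd_nonneg (hJ : ∀ t, 0 ≤ J t) (t : A × B × C) : 0 ≤ condProd J t :=
  div_nonneg (mul_nonneg (Finset.sum_nonneg fun _ _ => hJ _) (Finset.sum_nonneg fun _ _ => hJ _))
    (Finset.sum_nonneg fun _ _ => Finset.sum_nonneg fun _ _ => hJ _)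

variable [Fintype C]

lemma sum_condProd (J : A × B × C → ℝ) : ∑ t, condProd J t = ∑ t, J t := by
  have h1 : ∀ F : A × B × C → ℝ, ∑ t, F t = ∑ c, ∑ a, ∑ b, F (a, b, c) := by
    intro F
    rw [Fintype.sum_prod_type, Finset.sum_comm]
    simp_rw [Fintype.sum_prod_type]
    rw [Finset.sum_comm]
    rw [Finset.sum_comm]
    simp_rw [Finset.sum_comm (s := (Finset.univ : Finset C))]
    rw [Finset.sum_comm]
  rw [h1, h1]
  refine Finset.sum_congr rfl fun c _ => ?_
  simp only [condProd]
  simp_rw [← Finset.sum_div, ← Finset.mul_sum]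
  rw [← Finset.sum_mul]
  rw [Finset.sum_comm (f := fun b a => J (a, b, c))]
  by_cases h : ∑ a, ∑ b, J (a, b, c) = 0
  · simp [h]
  · field_simp

/-- The divergence of J from its conditionally independent version is I(A;B|C). Strong subadditivity
and its equality case are the Gibbs inequality and its equality case for this pair. -/
lemma sum_mul_log_condProd (hJ : ∀ t, 0 ≤ J t) :
    ∑ t, J t * (Real.log (J t) - Real.log (condProd J t)) =
    ent (fun t : A × C => ∑ b, J (t.1, b, t.2)) + ent (fun t : B × C => ∑ a, J (a, t.1, t.2))
      - ent J - ent (fun c => ∑ a, ∑ b, J (a, b, c)) := by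
  have h1 : ∀ t, J t * (Real.log (J t) - Real.log (condProd J t)) = J t * Real.log (J t)
      - J t * Real.log (∑ b, J (t.1, b, t.2.2)) - J t * Real.log (∑ a, J (a, t.2.1, t.2.2))
      + J t * Real.log (∑ a, ∑ b, J (a, b, t.2.2)) := by
    intro t
    rcases (hJ t).eq_or_lt with h | h
    · simp [← h]
    · obtain ⟨ha, hb, hc⟩ := condProd_pos hJ h
      rw [condProd, Real.log_div (mul_pos ha hb).ne' hc.ne', Real.log_mul ha.ne' hb.ne']
      ring
  simp_rw [h1, Finset.sum_add_distrib, Finset.sum_sub_distrib, ent_eq]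
  have e1 : ∑ t, J t * Real.log (∑ b, J (t.1, b, t.2.2)) =
      ∑ t : A × C, (∑ b, J (t.1, b, t.2)) * Real.log (∑ b, J (t.1, b, t.2)) := by
    simp_rw [Fintype.sum_prod_type, Finset.sum_mul]
    exact Finset.sum_congr rfl fun a _ => Finset.sum_comm
  have e2 : ∑ t, J t * Real.log (∑ a, J (a, t.2.1, t.2.2)) =
      ∑ t : B × C, (∑ a, J (a, t.1, t.2)) * Real.log (∑ a, J (a, t.1, t.2)) := by
    simp_rw [Finset.sum_mul]
    rw [Fintype.sum_prod_type, Finset.sum_comm]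
  have e3 : ∑ t, J t * Real.log (∑ a, ∑ b, J (a, b, t.2.2)) =
      ∑ c, (∑ a, ∑ b, J (a, b, c)) * Real.log (∑ a, ∑ b, J (a, b, c)) := by
    simp_rw [Finset.sum_mul]
    rw [Fintype.sum_prod_type, Finset.sum_comm]
    rw [Finset.sum_comm (s := (Finset.univ : Finset C))]
    rw [Finset.sum_comm]
    refine Finset.sum_congr rfl fun a _ => ?_
    rw [Fintype.sum_prod_type, Finset.sum_comm]
  rw [e1, e2, e3]; ring

/-- Strong subadditivity of entropy. -/
lemma ent_strong_subadditive (hJ : ∀ t, 0 ≤ J t) :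
    ent J + ent (fun c => ∑ a, ∑ b, J (a, b, c)) ≤
      ent (fun t : A × C => ∑ b, J (t.1, b, t.2)) +
        ent (fun t : B × C => ∑ a, J (a, t.1, t.2)) := by
  have := gibbs hJ (condProd_nonneg hJ) (absCont_condProd hJ) (sum_condProd J).le
  rw [sum_mul_log_condProd hJ] at this
  linarith

/-- The equality case of strong subadditivity: conditional independence. -/
lemma eq_condProd_of_ent (hJ : ∀ t, 0 ≤ J t)
    (h : ent (fun t : A × C => ∑ b, J (t.1, b, t.2)) + ent (fun t : B × C => ∑ a, J (a, t.1, t.2))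
      ≤ ent J + ent (fun c => ∑ a, ∑ b, J (a, b, c))) : J = condProd J := by
  refine eq_of_gibbs hJ (condProd_nonneg hJ) (absCont_condProd hJ) (sum_condProd J).le ?_
  rw [sum_mul_log_condProd hJ]
  linarith

end CondIndep

/-! ### Compactness of convex hulls -/

/-- In finite dimension the convex hull of a compact set is compact. -/
lemma isCompact_convexHull {E : Type*} [NormedAddCommGroup E] [NormedSpace ℝ E]
    [FiniteDimensional ℝ E] {s : Set E} (hs : IsCompact s) : IsCompact (convexHull ℝ s) := by
  rcases s.eq_empty_or_nonempty with rfl | ⟨z₀, hz₀⟩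
  · simp
  -- By Carathéodory's theorem dim + 1 points suffice, so the hull is the continuous image of a
  -- compact product of a simplex with N copies of s.
  let N := Module.finrank ℝ E + 1
  have hK : IsCompact ((stdSimplex ℝ (Fin N)) ×ˢ (Set.univ.pi fun _ : Fin N => s)) :=
    (isCompact_stdSimplex ℝ (Fin N)).prod (isCompact_univ_pi fun _ => hs)
  have hc : Continuous fun t : (Fin N → ℝ) × (Fin N → E) => ∑ i, t.1 i • t.2 i := by fun_prop
  convert hK.image hc using 1
  refine Set.Subset.antisymm ?_ ?_
  · intro x hx
    obtain ⟨ι, _, z, w, hz, hind, hw, hw1, rfl⟩ := eq_pos_convex_span_of_mem_convexHull hx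
    have hcard : Fintype.card ι ≤ Fintype.card (Fin N) := by
      rw [Fintype.card_fin]
      exact hind.card_le_finrank_succ.trans (Nat.succ_le_succ (Submodule.finrank_le _))
    obtain ⟨e⟩ := Function.Embedding.nonempty_of_card_le hcard
    -- Combinations of fewer than N points are padded with weight zero at the dummy point z₀.
    refine ⟨(Function.extend e w 0, Function.extend e z fun _ => z₀), ⟨⟨?_, ?_⟩, ?_⟩, ?_⟩
    · intro j
      by_cases hj : ∃ i, e i = j
      · obtain ⟨i, rfl⟩ := hj
        simpa [e.injective.extend_apply] using (hw i).le
      · simp [Function.extend_apply' _ _ _ hj]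
    · rw [← hw1]
      refine (Fintype.sum_of_injective e e.injective _ _ ?_ ?_).symm
      · intro j hj
        exact Function.extend_apply' _ _ _ (by simpa using hj)
      · intro i
        simp [e.injective.extend_apply]
    · intro j _
      by_cases hj : ∃ i, e i = j
      · obtain ⟨i, rfl⟩ := hj
        simpa [e.injective.extend_apply] using hz ⟨i, rfl⟩
      · simpa [Function.extend_apply' _ _ _ hj] using hz₀
    · refine (Fintype.sum_of_injective e e.injective _ _ ?_ ?_).symm
      · intro j hj
        simp [Function.extend_apply' w _ _ (show ¬ ∃ i, e i = j by simpa using hj)]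
      · intro i
        simp [e.injective.extend_apply]
  · rintro _ ⟨⟨w, z⟩, ⟨hw, hz⟩, rfl⟩
    exact mem_convexHull_of_exists_fintype w z hw.1 hw.2 (fun i => hz i trivial) rfl

/-! ### The entropy region of a pair of alphabets -/

section Region

variable {X Y : Type*} [Fintype X] [Fintype Y]

/-- The second marginal of a law on `Y × X`. -/
def margX (p : Y × X → ℝ) : X → ℝ := fun x => ∑ y, p (y, x)

/-- The first marginal of a law on `Y × X`. -/
def margY (p : Y × X → ℝ) : Y → ℝ := fun y => ∑ x, p (y, x)

lemma margX_mem {p : Y × X → ℝ} (hp : p ∈ stdSimplex ℝ (Y × X)) : margX p ∈ stdSimplex ℝ X :=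
  ⟨fun _ => Finset.sum_nonneg fun _ _ => hp.1 _, by
    rw [← hp.2, Fintype.sum_prod_type, Finset.sum_comm]; rfl⟩

lemma margY_mem {p : Y × X → ℝ} (hp : p ∈ stdSimplex ℝ (Y × X)) : margY p ∈ stdSimplex ℝ Y :=
  ⟨fun _ => Finset.sum_nonneg fun _ _ => hp.1 _, by
    rw [← hp.2, Fintype.sum_prod_type]; rfl⟩

/-- A joint law with its marginal and joint entropies. -/
def entPoint (p : Y × X → ℝ) : (Y × X → ℝ) × ℝ × ℝ × ℝ := (p, ent (margX p), ent (margY p), ent p)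

variable (X Y) in
/-- The convex hull of the points `(p, H(X), H(Y), H(X,Y))`. -/
def entRegion : Set ((Y × X → ℝ) × ℝ × ℝ × ℝ) := convexHull ℝ (entPoint '' stdSimplex ℝ (Y × X))

lemma isCompact_entRegion : IsCompact (entRegion X Y) := by
  refine isCompact_convexHull ((isCompact_stdSimplex ℝ (Y × X)).image ?_)
  have hX : Continuous (margX : (Y × X → ℝ) → X → ℝ) := by unfold margX; fun_prop
  have hY : Continuous (margY : (Y × X → ℝ) → Y → ℝ) := by unfold margY; fun_prop
  unfold entPoint
  exact continuous_id.prodMk ((continuous_ent.comp hX).prodMk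
    ((continuous_ent.comp hY).prodMk continuous_ent))

/-- The marginal on `Y × X` of a joint law of `(V, Y, X)` and the conditional entropies
`H(X|V)`, `H(Y|V)`, `H(Y,X|V)`. -/
def jointPoint {V : Type*} [Fintype V] (J : V × Y × X → ℝ) : (Y × X → ℝ) × ℝ × ℝ × ℝ :=
  (fun t => ∑ v, J (v, t),
    ent (fun t : V × X => ∑ y, J (t.1, y, t.2)) - ent (fun v => ∑ t, J (v, t)),
    ent (fun t : V × Y => ∑ x, J (t.1, t.2, x)) - ent (fun v => ∑ t, J (v, t)),
    ent J - ent (fun v => ∑ t, J (v, t)))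

/-- The chain rule H(V,B) = H(V) + H(B|V). It makes conditional entropies affine in the mixing law
w, which is why a convex hull describes them. -/
lemma ent_kernel {V B : Type*} [Fintype V] [Fintype B] (w : V → ℝ) {p : V → B → ℝ}
    (hp : ∀ v, ∑ b, p v b = 1) :
    ent (fun t : V × B => w t.1 * p t.1 t.2) = ent w + ∑ v, w v * ent (p v) := by
  unfold ent
  rw [Fintype.sum_prod_type, ← Finset.sum_add_distrib]
  refine Finset.sum_congr rfl fun v _ => ?_
  simp_rw [Real.negMulLog_mul, Finset.sum_add_distrib, ← Finset.sum_mul, ← Finset.mul_sum, hp,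
    one_mul]

lemma jointPoint_kernel {V : Type*} [Fintype V] (w : V → ℝ) {p : V → Y × X → ℝ}
    (hp : ∀ v, p v ∈ stdSimplex ℝ (Y × X)) :
    jointPoint (fun t : V × Y × X => w t.1 * p t.1 t.2) = ∑ v, w v • entPoint (p v) := by
  have hV : (fun v => ∑ t, w v * p v t) = w := by
    funext v; rw [← Finset.mul_sum, (hp v).2, mul_one]
  have hX := ent_kernel w fun v => (margX_mem (hp v)).2
  have hY := ent_kernel w fun v => (margY_mem (hp v)).2
  have hXY := ent_kernel w fun v => (hp v).2
  simp only [margX, margY, Finset.mul_sum] at hX hY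
  simp only [jointPoint, hV, hX, hY, hXY, add_sub_cancel_left]
  refine Prod.ext ?_ (Prod.ext ?_ (Prod.ext ?_ ?_))
  · funext t; simp [entPoint, Prod.fst_sum]
  · simp [entPoint, Prod.fst_sum, Prod.snd_sum]
  · simp [entPoint, Prod.fst_sum, Prod.snd_sum]
  · simp [entPoint, Prod.snd_sum]

lemma jointPoint_mem {V : Type*} [Fintype V] {J : V × Y × X → ℝ}
    (hJ : J ∈ stdSimplex ℝ (V × Y × X)) : jointPoint J ∈ entRegion X Y := by
  classical
  let w : V → ℝ := fun v => ∑ t, J (v, t)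
  have hw0 : ∀ v, 0 ≤ w v := fun v => Finset.sum_nonneg fun _ _ => hJ.1 _
  have hw1 : ∑ v, w v = 1 := by rw [← hJ.2, Fintype.sum_prod_type]
  -- Conditional law of (Y, X) given V = v. On null values of v any law would do; the marginal of J
  -- is at hand.
  let p : V → Y × X → ℝ := fun v =>
    if w v = 0 then fun t => ∑ v, J (v, t) else fun t => J (v, t) / w v
  have hp : ∀ v, p v ∈ stdSimplex ℝ (Y × X) := by
    intro v
    by_cases h : w v = 0
    · simp only [p, h, if_true]
      refine ⟨fun t => Finset.sum_nonneg fun _ _ => hJ.1 _, ?_⟩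
      rw [Finset.sum_comm]; exact hw1
    · simp only [p, h, if_false]
      exact ⟨fun t => div_nonneg (hJ.1 _) (hw0 v), by rw [← Finset.sum_div]; exact div_self h⟩
  have hJp : J = fun t : V × Y × X => w t.1 * p t.1 t.2 := by
    funext t
    by_cases h : w t.1 = 0
    · have := (Finset.sum_eq_zero_iff_of_nonneg fun t' _ => hJ.1 (t.1, t')).1 h t.2
        (Finset.mem_univ _)
      rw [h, zero_mul]; exact this
    · simp only [p, h, if_false]
      rw [mul_div_cancel₀ _ h]
  rw [hJp, jointPoint_kernel w hp]
  exact mem_convexHull_of_exists_fintype w (fun v => entPoint (p v)) hw0 hw1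
    (fun v => ⟨p v, hp v, rfl⟩) rfl

lemma exists_jointPoint_eq {z : (Y × X → ℝ) × ℝ × ℝ × ℝ} (hz : z ∈ entRegion X Y) :
    ∃ (V : Type) (_ : Fintype V) (J : V × Y × X → ℝ), J ∈ stdSimplex ℝ (V × Y × X) ∧
      jointPoint J = z := by
  obtain ⟨V, _, w, e, hw0, hw1, he, rfl⟩ := mem_convexHull_iff_exists_fintype.1 hz
  choose p hp hpe using he
  refine ⟨V, inferInstance, fun t => w t.1 * p t.1 t.2,
    ⟨fun t => mul_nonneg (hw0 _) ((hp _).1 _), ?_⟩, ?_⟩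
  · rw [Fintype.sum_prod_type]
    simp_rw [← Finset.mul_sum, (hp _).2, mul_one, hw1]
  · rw [jointPoint_kernel w hp]; simp_rw [hpe]

/-- `H(Y|X,V) ≤ H(Y|X)`. -/
lemma entRegion_condEnt_le {z : (Y × X → ℝ) × ℝ × ℝ × ℝ} (hz : z ∈ entRegion X Y) :
    z.2.2.2 - z.2.1 ≤ ent z.1 - ent (margX z.1) := by
  obtain ⟨V, _, J, hJ, rfl⟩ := exists_jointPoint_eq hz
  have h := ent_strong_subadditive hJ.1
  have e : (fun x => ∑ v, ∑ y, J (v, y, x)) = margX fun t => ∑ v, J (v, t) := by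
    funext x; exact Finset.sum_comm
  rw [e] at h
  simp only [jointPoint]
  have e2 : ent (fun t : Y × X => ∑ v, J (v, t.1, t.2)) = ent (fun t : Y × X => ∑ v, J (v, t)) :=
    rfl
  linarith

/-- `H(Y|X,V) ≤ H(Y|V)`. -/
lemma entRegion_condEnt_le_condEnt {z : (Y × X → ℝ) × ℝ × ℝ × ℝ} (hz : z ∈ entRegion X Y) :
    z.2.2.2 - z.2.1 ≤ z.2.2.1 := by
  obtain ⟨V, _, J, hJ, rfl⟩ := exists_jointPoint_eq hz
  have h := ent_strong_subadditive (J := fun t : Y × X × V => J (t.2.2, t.1, t.2.1))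
    fun t => hJ.1 _
  have e1 : ent (fun t : Y × X × V => J (t.2.2, t.1, t.2.1)) = ent J :=
    ent_comp_equiv (((Equiv.prodAssoc Y X V).symm.trans (Equiv.prodComm (Y × X) V))) J
  have e2 := ent_comp_equiv (Equiv.prodComm Y V) (fun t : V × Y => ∑ x, J (t.1, t.2, x))
  have e3 := ent_comp_equiv (Equiv.prodComm X V) (fun t : V × X => ∑ y, J (t.1, y, t.2))
  have e4 : (fun v => ∑ y, ∑ x, J (v, y, x)) = fun v => ∑ t, J (v, t) := by
    funext v; exact (Fintype.sum_prod_type (fun t : Y × X => J (v, t))).symm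
  simp only [Equiv.prodComm_apply, Prod.fst_swap, Prod.snd_swap] at e2 e3
  simp only [e1, e2, e3, e4] at h
  simp only [jointPoint]
  linarith

end Region

/-! ### Test channels and the entropy region -/

section Channel

variable {X Y : Type*} [Fintype X] [Fintype Y]

/-- Mutual information in terms of entropies. -/
lemma mutualInfo_eq_ent {A B : Type*} [Fintype A] [Fintype B] {J : A → B → ℝ}
    (hJ : ∀ a b, 0 ≤ J a b) : mutualInfo J = ent (fun a => ∑ b, J a b) + ent (fun b => ∑ a, J a b)
      - ent (fun t : B × A => J t.2 t.1) := by
  have h1 : ∀ a b, J a b * Real.log (J a b / ((∑ b', J a b') * ∑ a', J a' b)) =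
      J a b * Real.log (J a b) - J a b * Real.log (∑ b', J a b')
        - J a b * Real.log (∑ a', J a' b) := by
    intro a b
    rcases (hJ a b).eq_or_lt with h | h
    · simp [← h]
    · have ha : 0 < ∑ b', J a b' := Finset.sum_pos' (fun _ _ => hJ _ _) ⟨b, Finset.mem_univ _, h⟩
      have hb : 0 < ∑ a', J a' b := Finset.sum_pos' (fun _ _ => hJ _ _) ⟨a, Finset.mem_univ _, h⟩
      rw [Real.log_div h.ne' (mul_pos ha hb).ne', Real.log_mul ha.ne' hb.ne']
      ring
  unfold mutualInfo
  simp_rw [h1, Finset.sum_sub_distrib, ent_eq, ← Finset.sum_mul]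
  rw [Finset.sum_comm (f := fun a b => J a b * Real.log (∑ a', J a' b))]
  simp_rw [← Finset.sum_mul]
  rw [Fintype.sum_prod_type, Finset.sum_comm (f := fun b a => J a b * Real.log (J a b))]
  ring

/-- `I(Y;U)` for the Markov chain `Y - X - U` with `(Y, X) ∼ P`. -/
def chanYU (P : Y × X → ℝ) (K : TestChannel X) : ℝ :=
  mutualInfo fun y u => ∑ x, P (y, x) * K.prob x u

/-- The joint law of `(U, Y, X)`. -/
def chanJoint (P : Y × X → ℝ) (K : TestChannel X) : Fin K.size × Y × X → ℝ :=
  fun t => P t.2 * K.prob t.2.2 t.1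

variable {P : Y × X → ℝ}

lemma chanJoint_mem (hP : P ∈ stdSimplex ℝ (Y × X)) (K : TestChannel X) :
    chanJoint P K ∈ stdSimplex ℝ (Fin K.size × Y × X) := by
  refine ⟨fun t => mul_nonneg (hP.1 _) ((K.mem _).1 _), ?_⟩
  rw [Fintype.sum_prod_type, Finset.sum_comm]
  simp only [chanJoint, ← Finset.mul_sum, (K.mem _).2, mul_one]
  exact hP.2

lemma infoXU_eq (hP : P ∈ stdSimplex ℝ (Y × X)) (K : TestChannel X) :
    Setup.infoXU (margX P) K = ent (margX P) - (jointPoint (chanJoint P K)).2.1 := by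
  rw [Setup.infoXU, mutualInfo_eq_ent fun x u => mul_nonneg ((margX_mem hP).1 x) ((K.mem x).1 u)]
  have e1 : (fun x => ∑ u, margX P x * K.prob x u) = margX P := by
    funext x; rw [← Finset.mul_sum, (K.mem x).2, mul_one]
  have e2 : (fun u => ∑ x, margX P x * K.prob x u) = fun u => ∑ t, chanJoint P K (u, t) := by
    funext u
    simp_rw [margX, Finset.sum_mul, chanJoint, Fintype.sum_prod_type]
    exact Finset.sum_comm
  have e3 : (fun t : Fin K.size × X => margX P t.2 * K.prob t.2 t.1) =
      fun t => ∑ y, chanJoint P K (t.1, y, t.2) := by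
    funext t; simp [margX, chanJoint, Finset.sum_mul]
  rw [e1, e2, e3]
  simp only [jointPoint]; ring

lemma chanYU_eq (hP : P ∈ stdSimplex ℝ (Y × X)) (K : TestChannel X) :
    chanYU P K = ent (margY P) - (jointPoint (chanJoint P K)).2.2.1 := by
  rw [chanYU, mutualInfo_eq_ent fun y u =>
    Finset.sum_nonneg fun x _ => mul_nonneg (hP.1 _) ((K.mem x).1 u)]
  have e1 : (fun y => ∑ u, ∑ x, P (y, x) * K.prob x u) = margY P := by
    funext y; rw [Finset.sum_comm]
    simp_rw [← Finset.mul_sum, (K.mem _).2, mul_one]; rfl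
  have e2 : (fun u => ∑ y, ∑ x, P (y, x) * K.prob x u) =
      fun u => ∑ t, chanJoint P K (u, t) := by
    funext u
    simp_rw [chanJoint, Fintype.sum_prod_type]
  rw [e1, e2]
  simp only [jointPoint, chanJoint]; ring

lemma jointPoint_chanJoint_fst (P : Y × X → ℝ) (K : TestChannel X) :
    (jointPoint (chanJoint P K)).1 = P := by
  funext t
  simp only [jointPoint, chanJoint, ← Finset.mul_sum, (K.mem _).2, mul_one]

/-- Since U is produced from X alone, the joint law equals its own conditionally independent
version, so I(U;Y|X) = 0. In entropies this reads H(Y|X,U) = H(Y|X). -/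
lemma chanJoint_markov (hP : P ∈ stdSimplex ℝ (Y × X)) (K : TestChannel X) :
    (jointPoint (chanJoint P K)).2.2.2 - (jointPoint (chanJoint P K)).2.1 =
      ent P - ent (margX P) := by
  have hJ := chanJoint_mem hP K
  have e1 : (fun t : Y × X => ∑ u, chanJoint P K (u, t.1, t.2)) = P :=
    jointPoint_chanJoint_fst P K
  have e2 : (fun x => ∑ u, ∑ y, chanJoint P K (u, y, x)) = margX P := by
    funext x; rw [Finset.sum_comm]
    exact Finset.sum_congr rfl fun y _ => congrFun e1 (y, x)
  have hc : condProd (chanJoint P K) = chanJoint P K := by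
    funext ⟨u, y, x⟩
    have h1 := congrFun e1 (y, x)
    have h2 := congrFun e2 x
    simp only [condProd, h2]
    simp only at h1
    rw [h1]
    simp only [chanJoint]
    rw [← Finset.sum_mul]
    by_cases h : margX P x = 0
    · have : P (y, x) = 0 := (Finset.sum_eq_zero_iff_of_nonneg fun y _ => hP.1 (y, x)).1 h y
        (Finset.mem_univ _)
      simp [this]
    · change margX P x * _ * _ / _ = _
      field_simp
  have h := sum_mul_log_condProd hJ.1
  rw [hc, e1, e2] at h
  simp only [sub_self, mul_zero, Finset.sum_const_zero] at h
  simp only [jointPoint]; linarith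

/-- A point of the entropy region at which `Y - X - V` is a Markov chain comes from a test
channel. -/
lemma exists_channel_of_markov (hP : P ∈ stdSimplex ℝ (Y × X)) {z : (Y × X → ℝ) × ℝ × ℝ × ℝ}
    (hz : z ∈ entRegion X Y) (hzP : z.1 = P)
    (hm : ent P - ent (margX P) ≤ z.2.2.2 - z.2.1) :
    ∃ K : TestChannel X, Setup.infoXU (margX P) K = ent (margX P) - z.2.1 ∧
      chanYU P K = ent (margY P) - z.2.2.1 := by
  classical
  obtain ⟨V, _, J, hJ, rfl⟩ := exists_jointPoint_eq hz
  have e1 : (fun t : Y × X => ∑ u, J (u, t.1, t.2)) = P := hzP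
  have e2 : (fun x => ∑ u, ∑ y, J (u, y, x)) = margX P := by
    funext x; rw [Finset.sum_comm]
    exact Finset.sum_congr rfl fun y _ => congrFun e1 (y, x)
  -- The hypothesis is the reverse of strong subadditivity, so its equality case applies.
  have hc : J = condProd J := by
    refine eq_condProd_of_ent hJ.1 ?_
    rw [e1, e2]
    simp only [jointPoint] at hm
    linarith
  let e := Fintype.equivFin V
  have hV : ∑ v, ∑ t, J (v, t) = 1 := by rw [← hJ.2, Fintype.sum_prod_type]
  -- The conditional law of V given X, with the law of V as default at letters of probability zero.
  -- There both sides of `hK` vanish.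
  let K : TestChannel X :=
    { size := Fintype.card V
      prob := fun x u => if margX P x = 0 then ∑ t, J (e.symm u, t)
        else (∑ y, J (e.symm u, y, x)) / margX P x
      mem := by
        intro x
        by_cases h : margX P x = 0
        · simp only [h, if_true]
          refine ⟨fun u => Finset.sum_nonneg fun _ _ => hJ.1 _, ?_⟩
          rw [← hV]; exact e.symm.sum_comp fun v => ∑ t, J (v, t)
        · simp only [h, if_false]
          refine ⟨fun u => div_nonneg (Finset.sum_nonneg fun _ _ => hJ.1 _)
            ((margX_mem hP).1 x), ?_⟩
          rw [← Finset.sum_div, e.symm.sum_comp fun v => ∑ y, J (v, y, x)]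
          rw [show ∑ v, ∑ y, J (v, y, x) = margX P x from congrFun e2 x, div_self h] }
  have hK : ∀ t, chanJoint P K t = J (e.symm t.1, t.2) := by
    rintro ⟨u, y, x⟩
    have h1 := congrFun e1 (y, x)
    have h2 := congrFun e2 x
    simp only at h1 h2
    by_cases h : margX P x = 0
    · have h3 : P (y, x) = 0 := (Finset.sum_eq_zero_iff_of_nonneg fun y _ => hP.1 (y, x)).1 h y
        (Finset.mem_univ _)
      have h4 : J (e.symm u, y, x) = 0 :=
        (Finset.sum_eq_zero_iff_of_nonneg fun v _ => hJ.1 (v, y, x)).1 (h1.trans h3) (e.symm u)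
          (Finset.mem_univ _)
      simp [chanJoint, h3, h4]
    · have h5 := congrFun hc (e.symm u, y, x)
      simp only [condProd, h1, h2] at h5
      simp only [chanJoint, K, h, if_false]
      rw [h5]; ring
  have hj : jointPoint (chanJoint P K) = jointPoint J := by
    have hKf : chanJoint P K = fun t => J ((e.symm.prodCongr (Equiv.refl (Y × X))) t) :=
      funext hK
    have a1 : ent (fun v => ∑ t, chanJoint P K (v, t)) = ent (fun v => ∑ t, J (v, t)) := by
      simp only [hK]; exact ent_comp_equiv e.symm fun v => ∑ t, J (v, t)
    have a2 : ent (fun t : Fin K.size × X => ∑ y, chanJoint P K (t.1, y, t.2)) =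
        ent (fun t : V × X => ∑ y, J (t.1, y, t.2)) := by
      simp only [hK]
      exact ent_comp_equiv (e.symm.prodCongr (Equiv.refl X)) fun t : V × X => ∑ y, J (t.1, y, t.2)
    have a3 : ent (fun t : Fin K.size × Y => ∑ x, chanJoint P K (t.1, t.2, x)) =
        ent (fun t : V × Y => ∑ x, J (t.1, t.2, x)) := by
      simp only [hK]
      exact ent_comp_equiv (e.symm.prodCongr (Equiv.refl Y)) fun t : V × Y => ∑ x, J (t.1, t.2, x)
    have a4 : ent (chanJoint P K) = ent J := by
      rw [hKf]; exact ent_comp_equiv _ J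
    have a5 : (jointPoint (chanJoint P K)).1 = (jointPoint J).1 := by
      rw [jointPoint_chanJoint_fst, hzP]
    refine Prod.ext a5 ?_
    simp only [jointPoint, a1, a2, a3, a4]
  exact ⟨K, by rw [infoXU_eq hP, hj], by rw [chanYU_eq hP, hj]⟩

lemma chanPoint_mem (hP : P ∈ stdSimplex ℝ (Y × X)) (K : TestChannel X) :
    jointPoint (chanJoint P K) ∈ entRegion X Y := jointPoint_mem (chanJoint_mem hP K)

/-- Data processing: `I(Y;U) ≤ I(Y;X)`. -/
lemma chanYU_le (hP : P ∈ stdSimplex ℝ (Y × X)) (K : TestChannel X) :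
    chanYU P K ≤ ent (margY P) - (ent P - ent (margX P)) := by
  rw [chanYU_eq hP, ← chanJoint_markov hP K]
  linarith [entRegion_condEnt_le_condEnt (chanPoint_mem hP K)]

variable (X) in
/-- The noiseless test channel. -/
def idChannel : TestChannel X where
  size := Fintype.card X
  prob x u := if Fintype.equivFin X x = u then 1 else 0
  mem x := ⟨fun u => by dsimp only; split_ifs <;> simp, by simp⟩

/-- With U = X one has H(X|U) = 0 and H(Y|U) = H(Y|X), the extreme case of data processing. -/
lemma idChannel_info (hP : P ∈ stdSimplex ℝ (Y × X)) :
    Setup.infoXU (margX P) (idChannel X) = ent (margX P) ∧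
      chanYU P (idChannel X) = ent (margY P) - (ent P - ent (margX P)) := by
  let e : X ≃ Fin (idChannel X).size := Fintype.equivFin X
  have hJ : ∀ t, chanJoint P (idChannel X) t = if e t.2.2 = t.1 then P t.2 else 0 := by
    intro t
    change P t.2 * (if e t.2.2 = t.1 then 1 else 0) = _
    simp only [mul_ite, mul_one, mul_zero]
  have hs : ∀ u : Fin (idChannel X).size, ∀ f : X → ℝ,
      ∑ x, (if e x = u then f x else 0) = f (e.symm u) := by
    intro u f
    rw [Finset.sum_eq_single (e.symm u)]
    · simp
    · intro x _ hx
      rw [if_neg fun h => hx (by rw [← h, e.symm_apply_apply])]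
    · intro h; exact absurd (Finset.mem_univ _) h
  have a1 : ent (fun u => ∑ t, chanJoint P (idChannel X) (u, t)) = ent (margX P) := by
    rw [← ent_comp_equiv e.symm (margX P)]
    congr 1; funext u
    simp only [hJ]
    rw [Fintype.sum_prod_type]
    exact Finset.sum_congr rfl fun y _ => hs u fun x => P (y, x)
  have a3 : ent (fun t : Fin (idChannel X).size × Y =>
      ∑ x, chanJoint P (idChannel X) (t.1, t.2, x)) = ent P := by
    rw [← ent_comp_equiv ((Equiv.prodComm _ _).trans ((Equiv.refl Y).prodCongr e.symm)) P]
    congr 1; funext t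
    simp only [hJ]
    exact hs t.1 fun x => P (t.2, x)
  have a2 : ent (fun t : Fin (idChannel X).size × X =>
      ∑ y, chanJoint P (idChannel X) (t.1, y, t.2)) = ent (margX P) := by
    unfold ent
    rw [Fintype.sum_prod_type, Finset.sum_comm]
    refine Finset.sum_congr rfl fun x _ => ?_
    rw [Finset.sum_eq_single (e x)]
    · simp only [hJ, if_true]; rfl
    · intro u _ hu
      simp only [hJ, if_neg (Ne.symm hu)]; simp
    · simp
  constructor
  · rw [infoXU_eq hP]; simp only [jointPoint]; rw [a2, a1]; ring
  · rw [chanYU_eq hP]; simp only [jointPoint]; rw [a3, a1]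

/-- For `0 ≤ R ≤ H(X)` some optimal test channel has rate exactly `R`. -/
lemma exists_optimal_channel (hP : P ∈ stdSimplex ℝ (Y × X)) {R : ℝ} (hR : 0 ≤ R)
    (hRX : R ≤ ent (margX P)) : ∃ K : TestChannel X, Setup.infoXU (margX P) K = R ∧
      ∀ K', Setup.infoXU (margX P) K' ≤ R → chanYU P K' ≤ chanYU P K := by
  -- These are the points that come from test channels of rate at most R. The set is compact
  -- although channel alphabets are unbounded, and maximal I(Y;U) means minimal H(Y|U).
  let F : Set ((Y × X → ℝ) × ℝ × ℝ × ℝ) := entRegion X Y ∩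
    {z | z.1 = P ∧ z.2.2.2 - z.2.1 = ent P - ent (margX P) ∧ ent (margX P) - z.2.1 ≤ R}
  have hF : IsCompact F := by
    refine isCompact_entRegion.inter_right ?_
    have h1 : IsClosed {z : (Y × X → ℝ) × ℝ × ℝ × ℝ | z.1 = P} :=
      isClosed_eq (by fun_prop) (by fun_prop)
    have h2 : IsClosed {z : (Y × X → ℝ) × ℝ × ℝ × ℝ | z.2.2.2 - z.2.1 = ent P - ent (margX P)} :=
      isClosed_eq (by fun_prop) (by fun_prop)
    have h3 : IsClosed {z : (Y × X → ℝ) × ℝ × ℝ × ℝ | ent (margX P) - z.2.1 ≤ R} :=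
      isClosed_le (by fun_prop) (by fun_prop)
    exact h1.inter (h2.inter h3)
  have hchan : ∀ K, Setup.infoXU (margX P) K ≤ R → jointPoint (chanJoint P K) ∈ F := fun K hK =>
    ⟨chanPoint_mem hP K, jointPoint_chanJoint_fst P K, chanJoint_markov hP K,
      by rw [← infoXU_eq hP]; exact hK⟩
  have hne : F.Nonempty := by
    refine ⟨entPoint P, subset_convexHull ℝ _ ⟨P, hP, rfl⟩, rfl, rfl, ?_⟩
    simpa [entPoint] using hR
  obtain ⟨z, ⟨hz, hzP, hzm, hzR⟩, hmin⟩ := hF.exists_isMinOn hne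
    (f := fun z => z.2.2.1) (by fun_prop)
  let z' := jointPoint (chanJoint P (idChannel X))
  obtain ⟨hidX, hidY⟩ := idChannel_info hP
  have hz'X : z'.2.1 = 0 := by
    have := infoXU_eq hP (idChannel X)
    rw [hidX] at this; simp only [z']; linarith
  have hz'Y : z'.2.2.1 = ent P - ent (margX P) := by
    have := chanYU_eq hP (idChannel X)
    rw [hidY] at this; simp only [z']; linarith
  have hzY : z'.2.2.1 ≤ z.2.2.1 := by
    rw [hz'Y, ← hzm]; exact entRegion_condEnt_le_condEnt hz
  -- Time sharing with the noiseless channel, where H(X|U) = 0, lowers H(X|U) until it is exactly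
  -- H(X) − R. It cannot raise H(Y|U), by `hzY`.
  obtain ⟨θ, hθ0, hθ1, hθ⟩ : ∃ θ : ℝ, 0 ≤ θ ∧ θ ≤ 1 ∧ (1 - θ) * z.2.1 = ent (margX P) - R := by
    rcases (sub_nonneg.2 hRX).eq_or_lt with h | h
    · exact ⟨1, zero_le_one, le_rfl, by simp [← h]⟩
    · have hpos : 0 < z.2.1 := by linarith
      refine ⟨1 - (ent (margX P) - R) / z.2.1, ?_, ?_, ?_⟩
      · rw [sub_nonneg, div_le_one hpos]; linarith
      · have := div_nonneg h.le hpos.le; linarith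
      · field_simp; ring
  have hmem : (1 - θ) • z + θ • z' ∈ entRegion X Y :=
    convex_convexHull ℝ _ hz (chanPoint_mem hP _) (by linarith) hθ0 (by ring)
  have hm' : z'.2.2.2 - z'.2.1 = ent P - ent (margX P) := chanJoint_markov hP _
  obtain ⟨K, hK1, hK2⟩ := exists_channel_of_markov hP hmem
    (by
      have : z'.1 = P := jointPoint_chanJoint_fst P _
      rw [Prod.fst_add, Prod.smul_fst, Prod.smul_fst, hzP, this, ← add_smul]; simp)
    (by
      simp only [Prod.snd_add, Prod.smul_snd, Prod.fst_add, Prod.smul_fst, smul_eq_mul]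
      refine le_of_eq ?_
      calc ent P - ent (margX P) = (1 - θ) * (z.2.2.2 - z.2.1) + θ * (z'.2.2.2 - z'.2.1) := by
            rw [hzm, hm']; ring
        _ = _ := by ring)
  refine ⟨K, ?_, fun K' hK' => ?_⟩
  · rw [hK1]
    simp only [Prod.snd_add, Prod.smul_snd, Prod.fst_add, Prod.smul_fst, smul_eq_mul, hz'X]
    linarith
  · rw [hK2, chanYU_eq hP]
    have h1 : z.2.2.1 ≤ (jointPoint (chanJoint P K')).2.2.1 := hmin (hchan K' hK')
    simp only [Prod.snd_add, Prod.smul_snd, Prod.fst_add, Prod.smul_fst, smul_eq_mul]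
    nlinarith

end Channel

/-! ### Masses of events -/

/-- The mass which the weights `p` give to the set `s`. -/
def mass {Ω : Type*} [Fintype Ω] (p : Ω → ℝ) (s : Set Ω) : ℝ := ∑ ω, s.indicator p ω

section Mass

variable {Ω : Type*} [Fintype Ω] {p : Ω → ℝ} {s t : Set Ω}

lemma mass_nonneg (hp : ∀ ω, 0 ≤ p ω) : 0 ≤ mass p s :=
  Finset.sum_nonneg fun ω _ => Set.indicator_nonneg (fun ω _ => hp ω) ω

lemma mass_mono_of_ne_zero (hp : ∀ ω, 0 ≤ p ω) (h : ∀ ω, p ω ≠ 0 → ω ∈ s → ω ∈ t) :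
    mass p s ≤ mass p t := by
  classical
  refine Finset.sum_le_sum fun ω _ => ?_
  simp only [Set.indicator_apply]
  by_cases h0 : p ω = 0
  · simp [h0]
  · by_cases hs : ω ∈ s
    · simp [hs, h ω h0 hs]
    · simp only [hs, if_false]
      split_ifs
      exacts [hp ω, le_rfl]

lemma mass_mono (hp : ∀ ω, 0 ≤ p ω) (h : s ⊆ t) : mass p s ≤ mass p t :=
  mass_mono_of_ne_zero hp fun _ _ hs => h hs

lemma mass_union_le (hp : ∀ ω, 0 ≤ p ω) : mass p (s ∪ t) ≤ mass p s + mass p t := by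
  classical
  rw [mass, mass, mass, ← Finset.sum_add_distrib]
  refine Finset.sum_le_sum fun ω _ => ?_
  simp only [Set.indicator_apply, Set.mem_union]
  by_cases hs : ω ∈ s <;> by_cases ht : ω ∈ t <;> simp [hs, ht, hp ω]

lemma mass_iUnion_le {ι : Type*} [Fintype ι] (hp : ∀ ω, 0 ≤ p ω) (s : ι → Set Ω) :
    mass p (⋃ i, s i) ≤ ∑ i, mass p (s i) := by
  classical
  simp only [mass]
  rw [Finset.sum_comm]
  refine Finset.sum_le_sum fun ω _ => ?_
  by_cases h : ω ∈ ⋃ i, s i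
  · obtain ⟨i, hi⟩ := Set.mem_iUnion.1 h
    rw [Set.indicator_of_mem h]
    refine le_trans ?_ (Finset.single_le_sum
      (fun i _ => Set.indicator_nonneg (fun ω _ => hp ω) ω) (Finset.mem_univ i))
    rw [Set.indicator_of_mem hi]
  · rw [Set.indicator_of_notMem h]
    exact Finset.sum_nonneg fun i _ => Set.indicator_nonneg (fun ω _ => hp ω) ω

end Mass

/-! ### Product laws -/

section Iid

variable {A : Type*} {P : A → ℝ}

lemma iidLaw_snoc (P : A → ℝ) {n : ℕ} (x : Fin n → A) (a : A) :
    iidLaw P (n + 1) (Fin.snoc (α := fun _ => A) x a) = iidLaw P n x * P a := by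
  simp [iidLaw, Fin.prod_univ_castSucc]

lemma iidLaw_nonneg (hP : ∀ a, 0 ≤ P a) {n : ℕ} (x : Fin n → A) : 0 ≤ iidLaw P n x :=
  Finset.prod_nonneg fun _ _ => hP _

lemma iidLaw_ne_zero {n : ℕ} {x : Fin n → A} : iidLaw P n x ≠ 0 ↔ ∀ l, P (x l) ≠ 0 := by
  simp [iidLaw, Finset.prod_ne_zero_iff]

variable [Fintype A]

lemma sum_snoc {n : ℕ} (F : (Fin (n + 1) → A) → ℝ) :
    ∑ x, F x = ∑ x : Fin n → A, ∑ a, F (Fin.snoc (α := fun _ => A) x a) := by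
  rw [← (Fin.snocEquiv fun _ => A).sum_comp, Fintype.sum_prod_type, Finset.sum_comm]
  rfl

lemma sum_iidLaw (hP : ∑ a, P a = 1) (n : ℕ) : ∑ x, iidLaw P n x = 1 := by
  classical
  have := (Finset.prod_univ_sum (fun _ : Fin n => (Finset.univ : Finset A)) fun _ a => P a)
  rw [Fintype.piFinset_univ] at this
  simp only [iidLaw]
  rw [← this]; simp [hP]

lemma iidLaw_mem (hP : P ∈ stdSimplex ℝ A) (n : ℕ) : iidLaw P n ∈ stdSimplex ℝ (Fin n → A) :=
  ⟨fun x => iidLaw_nonneg hP.1 x, sum_iidLaw hP.2 n⟩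

/-- The last letters of an i.i.d. sequence are i.i.d. -/
lemma sum_iidLaw_window (hP : ∑ a, P a = 1) (l w : ℕ) (h : (Fin w → A) → ℝ) :
    ∑ x : Fin (l + w) → A, iidLaw P (l + w) x * h (fun j => x (Fin.natAdd l j)) =
      ∑ c, iidLaw P w c * h c := by
  rw [← (Fin.appendEquiv l w).sum_comp, Fintype.sum_prod_type]
  simp only [Fin.appendEquiv, Equiv.coe_fn_mk, Fin.append_right]
  have : ∀ (u : Fin l → A) (c : Fin w → A),
      iidLaw P (l + w) (Fin.append u c) = iidLaw P l u * iidLaw P w c := by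
    intro u c
    simp [iidLaw, Fin.prod_univ_add]
  simp_rw [this, mul_assoc, ← Finset.mul_sum, ← Finset.sum_mul, sum_iidLaw hP l, one_mul]

/-! ### Concentration for functions with bounded differences -/

/-- The variance of a function with differences bounded by `B` is at most `n B²`. -/
lemma variance_le_of_bounded_differences (hP : P ∈ stdSimplex ℝ A) {B : ℝ} :
    ∀ (n : ℕ) (F : (Fin n → A) → ℝ),
    (∀ x p b, iidLaw P n x ≠ 0 → P b ≠ 0 → |F (Function.update x p b) - F x| ≤ B) →
      ∑ x, iidLaw P n x * (F x - ∑ x', iidLaw P n x' * F x') ^ 2 ≤ n * B ^ 2 := by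
  intro n
  induction n with
  | zero => intro F _; simp [iidLaw, Subsingleton.elim _ (default : Fin 0 → A)]
  | succ n ih =>
    intro F hF
    -- G is the conditional expectation given the first n letters. The total variance is the mean
    -- conditional variance, at most B², plus the variance of G, which inherits the bound on
    -- differences.
    set G : (Fin n → A) → ℝ := fun x => ∑ a, P a * F (Fin.snoc (α := fun _ => A) x a) with hG
    have hE : ∑ x, iidLaw P (n + 1) x * F x = ∑ x, iidLaw P n x * G x := by
      rw [sum_snoc]
      simp_rw [iidLaw_snoc, hG, Finset.mul_sum, mul_assoc]
    rw [hE, sum_snoc]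
    set μ := ∑ x, iidLaw P n x * G x
    have hGB : ∀ x p b, iidLaw P n x ≠ 0 → P b ≠ 0 → |G (Function.update x p b) - G x| ≤ B := by
      intro x p b hx hb
      have h1 : G (Function.update x p b) - G x = ∑ a, P a *
          (F (Function.update (Fin.snoc (α := fun _ => A) x a) p.castSucc b) -
            F (Fin.snoc (α := fun _ => A) x a)) := by
        simp_rw [hG, mul_sub, Finset.sum_sub_distrib]
        congr 1
        refine Finset.sum_congr rfl fun a _ => ?_
        rw [Fin.snoc_update]
      rw [h1]
      calc _ ≤ ∑ a, |P a * (F (Function.update (Fin.snoc (α := fun _ => A) x a) p.castSucc b) -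
            F (Fin.snoc (α := fun _ => A) x a))| := Finset.abs_sum_le_sum_abs _ _
        _ ≤ ∑ a, P a * B := by
          refine Finset.sum_le_sum fun a _ => ?_
          rw [abs_mul, abs_of_nonneg (hP.1 a)]
          by_cases ha : P a = 0
          · simp [ha]
          · refine mul_le_mul_of_nonneg_left (hF _ _ _ ?_ hb) (hP.1 a)
            rw [iidLaw_snoc]; exact mul_ne_zero hx ha
        _ = B := by rw [← Finset.sum_mul, hP.2, one_mul]
    have hstep : ∀ x, iidLaw P n x ≠ 0 →
        ∑ a, P a * (F (Fin.snoc (α := fun _ => A) x a) - G x) ^ 2 ≤ B ^ 2 := by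
      intro x hx
      calc _ ≤ ∑ a, P a * B ^ 2 := by
            refine Finset.sum_le_sum fun a _ => ?_
            by_cases ha : P a = 0
            · simp [ha]
            refine mul_le_mul_of_nonneg_left (sq_le_sq' ?_ ?_ ) (hP.1 a)
            all_goals
              have h1 : |F (Fin.snoc (α := fun _ => A) x a) - G x| ≤ B := by
                have h2 : F (Fin.snoc (α := fun _ => A) x a) - G x = ∑ b, P b *
                    (F (Fin.snoc (α := fun _ => A) x a) - F (Fin.snoc (α := fun _ => A) x b)) := by
                  simp_rw [hG, mul_sub, Finset.sum_sub_distrib, ← Finset.sum_mul, hP.2, one_mul]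
                rw [h2]
                calc _ ≤ ∑ b, |P b * (F (Fin.snoc (α := fun _ => A) x a) -
                      F (Fin.snoc (α := fun _ => A) x b))| := Finset.abs_sum_le_sum_abs _ _
                  _ ≤ ∑ b, P b * B := by
                    refine Finset.sum_le_sum fun b _ => ?_
                    rw [abs_mul, abs_of_nonneg (hP.1 b)]
                    by_cases hb : P b = 0
                    · simp [hb]
                    · refine mul_le_mul_of_nonneg_left ?_ (hP.1 b)
                      have := hF (Fin.snoc (α := fun _ => A) x a) (Fin.last n) b
                        (by rw [iidLaw_snoc]; exact mul_ne_zero hx ha) hb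
                      rwa [Fin.update_snoc_last, abs_sub_comm] at this
                  _ = B := by rw [← Finset.sum_mul, hP.2, one_mul]
              have := abs_le.1 h1
              linarith
        _ = B ^ 2 := by rw [← Finset.sum_mul, hP.2, one_mul]
    have hx : ∀ x, ∑ a, iidLaw P (n + 1) (Fin.snoc (α := fun _ => A) x a) *
        (F (Fin.snoc (α := fun _ => A) x a) - μ) ^ 2 ≤
          iidLaw P n x * B ^ 2 + iidLaw P n x * (G x - μ) ^ 2 := by
      intro x
      by_cases h0 : iidLaw P n x = 0
      · simp [iidLaw_snoc, h0]
      have e : ∑ a, P a * (F (Fin.snoc (α := fun _ => A) x a) - μ) ^ 2 =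
          ∑ a, P a * (F (Fin.snoc (α := fun _ => A) x a) - G x) ^ 2 + (G x - μ) ^ 2 := by
        have e1 : ∀ a, P a * (F (Fin.snoc (α := fun _ => A) x a) - μ) ^ 2 =
            P a * (F (Fin.snoc (α := fun _ => A) x a) - G x) ^ 2 +
            2 * (G x - μ) * (P a * F (Fin.snoc (α := fun _ => A) x a) - P a * G x) +
            P a * (G x - μ) ^ 2 := fun a => by ring
        simp_rw [e1, Finset.sum_add_distrib, ← Finset.mul_sum, Finset.sum_sub_distrib,
          ← Finset.sum_mul, hP.2]
        simp [hG]
      simp_rw [iidLaw_snoc, mul_assoc]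
      rw [← Finset.mul_sum, e, mul_add]
      have := mul_le_mul_of_nonneg_left (hstep x h0) (iidLaw_nonneg hP.1 x)
      linarith
    calc _ ≤ ∑ x, (iidLaw P n x * B ^ 2 + iidLaw P n x * (G x - μ) ^ 2) :=
          Finset.sum_le_sum fun x _ => hx x
      _ = B ^ 2 + ∑ x, iidLaw P n x * (G x - μ) ^ 2 := by
          rw [Finset.sum_add_distrib, ← Finset.sum_mul, sum_iidLaw hP.2, one_mul]
      _ ≤ B ^ 2 + n * B ^ 2 := by linarith [ih G hGB]
      _ = _ := by push_cast; ring

/-- A weak law of large numbers for functions with bounded differences. -/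
lemma tendsto_mass_deviation (hP : P ∈ stdSimplex ℝ A) {B C μ : ℝ}
    (F : (n : ℕ) → (Fin n → A) → ℝ)
    (hF : ∀ n x p b, iidLaw P n x ≠ 0 → P b ≠ 0 → |F n (Function.update x p b) - F n x| ≤ B)
    (hC : ∀ n, |∑ x, iidLaw P n x * F n x - n * μ| ≤ C) {δ : ℝ} (hδ : 0 < δ) :
    Tendsto (fun n : ℕ => mass (iidLaw P n) {x | n * δ < |F n x - n * μ|}) atTop (𝓝 0) := by
  have hlim : Tendsto (fun n : ℕ => (4 * B ^ 2 / δ ^ 2) / (n : ℝ)) atTop (𝓝 0) :=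
    tendsto_const_div_atTop_nhds_zero_nat _
  refine squeeze_zero' (Eventually.of_forall fun n => mass_nonneg fun x => iidLaw_nonneg hP.1 x)
    ?_ hlim
  -- From here on the bias C is at most nδ/2, so a deviation of nδ from nμ is one of nδ/2 from the
  -- mean; Chebyshev's inequality then gives 4B²/(δ²n).
  filter_upwards [eventually_gt_atTop 0, eventually_ge_atTop ⌈2 * C / δ⌉₊] with n hn0 hn
  have hn' : 2 * C ≤ n * δ := by
    have : 2 * C / δ ≤ n := (Nat.le_ceil _).trans (by exact_mod_cast hn)
    rwa [div_le_iff₀ hδ] at this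
  have hnpos : (0 : ℝ) < n := by exact_mod_cast hn0
  set m := ∑ x, iidLaw P n x * F n x with hm
  have hvar := variance_le_of_bounded_differences hP n (F n) (hF n)
  rw [← hm] at hvar
  have hmass : mass (iidLaw P n) {x | n * δ < |F n x - n * μ|} * (n * δ / 2) ^ 2 ≤
      ∑ x, iidLaw P n x * (F n x - m) ^ 2 := by
    rw [mass, Finset.sum_mul]
    refine Finset.sum_le_sum fun x _ => ?_
    by_cases hx : x ∈ {x | n * δ < |F n x - n * μ|}
    · rw [Set.indicator_of_mem hx]
      refine mul_le_mul_of_nonneg_left ?_ (iidLaw_nonneg hP.1 x)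
      rw [← sq_abs (F n x - m)]
      refine pow_le_pow_left₀ (by positivity) ?_ 2
      have h1 : |F n x - n * μ| ≤ |F n x - m| + |m - n * μ| := by
        have := abs_add_le (F n x - m) (m - n * μ)
        simpa using this
      have h2 : n * δ < |F n x - n * μ| := hx
      linarith [hC n]
    · rw [Set.indicator_of_notMem hx, zero_mul]
      exact mul_nonneg (iidLaw_nonneg hP.1 x) (sq_nonneg _)
  rw [div_div, le_div_iff₀ (by positivity)]
  have h3 := hmass.trans hvar
  have h4 : mass (iidLaw P n) {x | n * δ < |F n x - n * μ|} * (δ ^ 2 * n) * n ≤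
      4 * B ^ 2 * n := by nlinarith
  exact le_of_mul_le_mul_right h4 hnpos

end Iid

/-! ### Likelihood ratios with respect to Markov and memoryless processes -/

section LLR

variable {A : Type*} {P : A → ℝ} {Q : SeqLaw A} {w : ℕ} {K : (Fin w → A) → A → ℝ}

/-- The log-likelihood ratio of the i.i.d. source `P` and the process `Q`. -/
def llr (P : A → ℝ) (Q : SeqLaw A) (n : ℕ) (x : Fin n → A) : ℝ :=
  Real.log (iidLaw P n x) - Real.log (Q n x)

/-- The transition recursion of a Markov process. -/
def MarkovStep (Q : SeqLaw A) (K : (Fin w → A) → A → ℝ) : Prop :=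
  ∀ (l : ℕ) (x : Fin (l + w) → A) (a : A), Q (l + w + 1) (Fin.snoc (α := fun _ => A) x a)
    = Q (l + w) x * K (fun j => x (Fin.natAdd l j)) a

lemma llr_snoc (hK : MarkovStep Q K) (hac : ∀ n, AbsCont (iidLaw P n) (Q n)) {l : ℕ}
    {x : Fin (l + w) → A} {a : A} (hx : iidLaw P (l + w) x ≠ 0) (ha : P a ≠ 0) :
    llr P Q (l + w + 1) (Fin.snoc (α := fun _ => A) x a) = llr P Q (l + w) x +
      (Real.log (P a) - Real.log (K (fun j => x (Fin.natAdd l j)) a)) := by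
  have h1 : iidLaw P (l + w + 1) (Fin.snoc (α := fun _ => A) x a) ≠ 0 := by
    rw [iidLaw_snoc]; exact mul_ne_zero hx ha
  have h2 : Q (l + w + 1) (Fin.snoc (α := fun _ => A) x a) ≠ 0 := fun h => h1 (hac _ _ h)
  rw [hK] at h2
  rw [llr, llr, iidLaw_snoc, hK, Real.log_mul hx ha,
    Real.log_mul (left_ne_zero_of_mul h2) (right_ne_zero_of_mul h2)]
  ring

lemma iidLaw_update_ne_zero {n : ℕ} {x : Fin n → A} {p : Fin n} {b : A} (hx : iidLaw P n x ≠ 0)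
    (hb : P b ≠ 0) : iidLaw P n (Function.update x p b) ≠ 0 := by
  rw [iidLaw_ne_zero] at hx ⊢
  intro l
  by_cases h : l = p
  · subst h; simpa using hb
  · simpa [Function.update_of_ne h] using hx l

lemma absCont_iidLaw {q : A → ℝ} (h : AbsCont P q) (n : ℕ) :
    AbsCont (iidLaw P n) (iidLaw q n) := by
  intro x hx
  by_contra h'
  rw [← ne_eq, iidLaw_ne_zero] at h'
  exact iidLaw_ne_zero.2 (fun l hl => h' l (h _ hl)) hx

/-- A memoryless law is Markov of order zero, so the concentration results below serve both
categories. -/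
lemma markovStep_iidLaw (q : A → ℝ) : MarkovStep (iidLaw q) (fun (_ : Fin 0 → A) a => q a) :=
  fun _ x a => iidLaw_snoc q x a

variable [Fintype A]

/-- The divergence rate of the i.i.d. source `P` with respect to a Markov process of order `w` with
transition kernel `K`. -/
def markovRate (P : A → ℝ) (K : (Fin w → A) → A → ℝ) : ℝ :=
  ∑ c, iidLaw P w c * ∑ a, P a * (Real.log (P a) - Real.log (K c a))

lemma expect_llr_succ (hP : P ∈ stdSimplex ℝ A) (hK : MarkovStep Q K)
    (hac : ∀ n, AbsCont (iidLaw P n) (Q n)) (l : ℕ) :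
    ∑ x, iidLaw P (l + w + 1) x * llr P Q (l + w + 1) x =
      ∑ x, iidLaw P (l + w) x * llr P Q (l + w) x + markovRate P K := by
  rw [markovRate, ← sum_iidLaw_window hP.2 l w, ← Finset.sum_add_distrib, sum_snoc]
  refine Finset.sum_congr rfl fun x _ => ?_
  by_cases hx : iidLaw P (l + w) x = 0
  · simp [iidLaw_snoc, hx]
  rw [← mul_add]
  simp_rw [iidLaw_snoc, mul_assoc, ← Finset.mul_sum]
  congr 1
  have : ∀ a, P a * llr P Q (l + w + 1) (Fin.snoc (α := fun _ => A) x a) =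
      P a * llr P Q (l + w) x +
        P a * (Real.log (P a) - Real.log (K (fun j => x (Fin.natAdd l j)) a)) := by
    intro a
    by_cases ha : P a = 0
    · simp [ha]
    · rw [llr_snoc hK hac hx ha, mul_add]
  simp_rw [this, Finset.sum_add_distrib, ← Finset.sum_mul, hP.2, one_mul]

lemma exists_bound_finite {ι : Type*} [Finite ι] (f : ι → ℝ) : ∃ C, 0 ≤ C ∧ ∀ i, |f i| ≤ C := by
  have := Fintype.ofFinite ι
  exact ⟨∑ i, |f i|, Finset.sum_nonneg fun _ _ => abs_nonneg _, fun i =>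
    Finset.single_le_sum (f := fun i => |f i|) (fun _ _ => abs_nonneg _) (Finset.mem_univ i)⟩

/-- A letter enters only its own transition and the w following ones. Transition terms are uniformly
bounded because there are finitely many contexts and letters, and the initial block of length w has
finitely many values. -/
lemma llr_bounded_differences (hK : MarkovStep Q K)
    (hac : ∀ n, AbsCont (iidLaw P n) (Q n)) :
    ∃ B : ℝ, ∀ n x p b, iidLaw P n x ≠ 0 → P b ≠ 0 →
      |llr P Q n (Function.update x p b) - llr P Q n x| ≤ B := by
  obtain ⟨B₀, hB₀, hB₀'⟩ := exists_bound_finite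
    fun t : (n : Fin (w + 1)) × (Fin n → A) => llr P Q t.1 t.2
  have hB0 : ∀ n ≤ w, ∀ x : Fin n → A, |llr P Q n x| ≤ B₀ := fun n hn x =>
    hB₀' ⟨⟨n, Nat.lt_succ_of_le hn⟩, x⟩
  obtain ⟨G, hG0, hG'⟩ := exists_bound_finite
    fun t : (Fin w → A) × A => Real.log (P t.2) - Real.log (K t.1 t.2)
  have hG : ∀ c a, |Real.log (P a) - Real.log (K c a)| ≤ G := fun c a => hG' (c, a)
  -- The minimum bounds the number of transitions whose context or letter involves position p; each
  -- may change by 2 G, and the initial block by 2 B₀.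
  have key : ∀ (l : ℕ) (x : Fin (l + w) → A) (p : Fin (l + w)) (b : A),
      iidLaw P (l + w) x ≠ 0 → P b ≠ 0 →
      |llr P Q (l + w) (Function.update x p b) - llr P Q (l + w) x| ≤
        2 * B₀ + 2 * G * (min (l + w - p) (w + 1) : ℕ) := by
    intro l
    induction l with
    | zero =>
      intro x p b _ _
      have h1 := hB0 (0 + w) (by simp) x
      have h2 := hB0 (0 + w) (by simp) (Function.update x p b)
      have h3 := abs_sub (llr P Q (0 + w) (Function.update x p b)) (llr P Q (0 + w) x)
      have : (0 : ℝ) ≤ 2 * G * (min (0 + w - p) (w + 1) : ℕ) := by positivity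
      linarith
    | succ l ih =>
      rw [show l + 1 + w = l + w + 1 by ring]
      intro x p b hx hb
      obtain ⟨y, a, rfl⟩ : ∃ y a, x = Fin.snoc (α := fun _ => A) y a :=
        ⟨Fin.init x, x (Fin.last _), (Fin.snoc_init_self x).symm⟩
      rw [iidLaw_snoc] at hx
      have hy := left_ne_zero_of_mul hx
      have ha := right_ne_zero_of_mul hx
      induction p using Fin.lastCases with
      | last =>
        rw [Fin.update_snoc_last, llr_snoc hK hac hy ha, llr_snoc hK hac hy hb]
        have h1 := hG (fun j => y (Fin.natAdd l j)) a
        have h2 := hG (fun j => y (Fin.natAdd l j)) b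
        have h3 : min (l + w + 1 - (Fin.last (l + w) : ℕ)) (w + 1) = 1 := by
          simp
        rw [h3, Nat.cast_one]
        rw [abs_le] at *
        constructor <;> linarith [h1.1, h1.2, h2.1, h2.2]
      | cast p =>
        have hy' := iidLaw_update_ne_zero (p := p) hy hb
        rw [← Fin.snoc_update, llr_snoc hK hac hy ha, llr_snoc hK hac hy' ha]
        have h0 := ih y p b hy hb
        -- For p < l the context of the appended letter does not contain p, and the count has
        -- already reached w + 1. Otherwise one more affected transition is counted.
        by_cases hp : (p : ℕ) < l
        · have hwin : (fun j : Fin w => Function.update y p b (Fin.natAdd l j)) =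
              fun j => y (Fin.natAdd l j) := by
            funext j
            refine Function.update_of_ne (fun h => ?_) _ _
            have := congrArg Fin.val h
            simp only [Fin.val_natAdd] at this
            omega
          rw [hwin, add_sub_add_right_eq_sub]
          have hm : min (l + w + 1 - (p.castSucc : ℕ)) (w + 1) = min (l + w - p) (w + 1) := by
            simp only [Fin.val_castSucc]; omega
          rw [hm]; exact h0
        · have hm : min (l + w + 1 - (p.castSucc : ℕ)) (w + 1) = min (l + w - p) (w + 1) + 1 := by
            have := p.2
            simp only [Fin.val_castSucc]; omega
          rw [hm]
          have h1 := hG (fun j => y (Fin.natAdd l j)) a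
          have h2 := hG (fun j => Function.update y p b (Fin.natAdd l j)) a
          push_cast at h0 ⊢
          rw [abs_le] at *
          constructor <;> linarith [h1.1, h1.2, h2.1, h2.2]
  refine ⟨2 * B₀ + 2 * G * (w + 1 : ℕ), fun n x p b hx hb => ?_⟩
  rcases le_total n w with hn | hn
  · have h1 := hB0 n hn x
    have h2 := hB0 n hn (Function.update x p b)
    have h3 := abs_sub (llr P Q n (Function.update x p b)) (llr P Q n x)
    have : (0 : ℝ) ≤ 2 * G * (w + 1 : ℕ) := by positivity
    linarith
  · obtain ⟨l, rfl⟩ := Nat.exists_eq_add_of_le' hn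
    refine (key l x p b hx hb).trans ?_
    have : ((min (l + w - p) (w + 1) : ℕ) : ℝ) ≤ (w + 1 : ℕ) := by exact_mod_cast min_le_right _ _
    have := mul_le_mul_of_nonneg_left this (show 0 ≤ 2 * G by positivity)
    linarith

/-- From length w on, the mean grows by exactly `markovRate P K` per letter, so its deviation from
linearity is constant there. -/
lemma expect_llr_bound (hP : P ∈ stdSimplex ℝ A) (hK : MarkovStep Q K)
    (hac : ∀ n, AbsCont (iidLaw P n) (Q n)) :
    ∃ C : ℝ, ∀ n : ℕ, |∑ x, iidLaw P n x * llr P Q n x - n * markovRate P K| ≤ C := by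
  obtain ⟨C, _, hC⟩ := exists_bound_finite fun n : Fin (w + 1) =>
    ∑ x, iidLaw P n x * llr P Q n x - (n : ℕ) * markovRate P K
  have key : ∀ l : ℕ, ∑ x, iidLaw P (l + w) x * llr P Q (l + w) x - (l + w : ℕ) * markovRate P K =
      ∑ x, iidLaw P w x * llr P Q w x - (w : ℕ) * markovRate P K := by
    intro l
    induction l with
    | zero => rw [show 0 + w = w by simp]
    | succ l ih =>
      rw [show l + 1 + w = l + w + 1 by ring, expect_llr_succ hP hK hac, ← ih]
      push_cast; ring
  refine ⟨C, fun n => ?_⟩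
  rcases le_total n w with hn | hn
  · exact hC ⟨n, Nat.lt_succ_of_le hn⟩
  · obtain ⟨l, rfl⟩ := Nat.exists_eq_add_of_le' hn
    rw [key]; exact hC ⟨w, Nat.lt_succ_self w⟩

lemma tendsto_mass_llr (hP : P ∈ stdSimplex ℝ A) (hK : MarkovStep Q K)
    (hac : ∀ n, AbsCont (iidLaw P n) (Q n)) {δ : ℝ} (hδ : 0 < δ) :
    Tendsto (fun n : ℕ => mass (iidLaw P n) {x | n * δ < |llr P Q n x - n * markovRate P K|})
      atTop (𝓝 0) := by
  obtain ⟨B, hB⟩ := llr_bounded_differences hK hac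
  obtain ⟨C, hC⟩ := expect_llr_bound hP hK hac
  exact tendsto_mass_deviation hP (llr P Q) hB hC hδ

lemma klD_eq_of_absCont {B : Type*} [Fintype B] {p q : B → ℝ} (h : AbsCont p q) :
    klD p q = ((∑ b, p b * (Real.log (p b) - Real.log (q b)) : ℝ) : EReal) := by
  rw [klD, if_pos h]
  congr 1
  refine Finset.sum_congr rfl fun b _ => ?_
  by_cases hb : p b = 0
  · simp [hb]
  · rw [Real.log_div hb fun h' => hb (h b h')]

/-- The divergence increments are constant from n = w on, so the limit in the definition exists
trivially. -/
lemma divRate_markov (hP : P ∈ stdSimplex ℝ A) (hK : MarkovStep Q K)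
    (hac : ∀ n, AbsCont (iidLaw P n) (Q n)) :
    divRate .markov P Q = (markovRate P K : EReal) := by
  refine Tendsto.limUnder_eq (tendsto_const_nhds.congr' ?_)
  filter_upwards [eventually_ge_atTop w] with n hn
  obtain ⟨l, rfl⟩ := Nat.exists_eq_add_of_le' hn
  rw [klD_eq_of_absCont (hac _), klD_eq_of_absCont (hac _), ← EReal.coe_sub]
  congr 1
  have := expect_llr_succ hP hK hac l
  simp only [llr] at this
  rw [this]; ring

/-- The likelihood ratio of `P` and `Q` is at least `exp (n D)` with probability tending to one. -/
def LRLower (P : A → ℝ) (Q : SeqLaw A) (D : ℝ) : Prop :=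
  Tendsto (fun n : ℕ => mass (iidLaw P n) {x | ¬ Real.exp (n * D) * Q n x ≤ iidLaw P n x})
    atTop (𝓝 0)

/-- The likelihood ratio of `P` and `Q` is at most `exp (n D)` with probability tending to one. -/
def LRUpper (P : A → ℝ) (Q : SeqLaw A) (D : ℝ) : Prop :=
  Tendsto (fun n : ℕ => mass (iidLaw P n) {x | ¬ iidLaw P n x ≤ Real.exp (n * D) * Q n x})
    atTop (𝓝 0)

lemma lrLower_of_markovStep (hP : P ∈ stdSimplex ℝ A) (hQ : ∀ n x, 0 ≤ Q n x)
    (hK : MarkovStep Q K) (hac : ∀ n, AbsCont (iidLaw P n) (Q n)) {D : ℝ}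
    (hD : D < markovRate P K) : LRLower P Q D := by
  refine squeeze_zero (fun n => mass_nonneg fun x => iidLaw_nonneg hP.1 x) (fun n => ?_)
    (tendsto_mass_llr hP hK hac (sub_pos.2 hD))
  refine mass_mono_of_ne_zero (fun x => iidLaw_nonneg hP.1 x) fun x hx h => ?_
  have hx' : 0 < iidLaw P n x := lt_of_le_of_ne (iidLaw_nonneg hP.1 x) (Ne.symm hx)
  have hq : 0 < Q n x := lt_of_le_of_ne (hQ n x) fun h => hx (hac n x h.symm)
  simp only [Set.mem_ofPred_eq, not_le] at h ⊢
  have h2 := Real.log_lt_log hx' h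
  rw [Real.log_mul (Real.exp_pos _).ne' hq.ne', Real.log_exp] at h2
  rw [abs_sub_comm]
  refine lt_of_lt_of_le ?_ (le_abs_self _)
  rw [llr]; linarith

lemma lrUpper_of_markovStep (hP : P ∈ stdSimplex ℝ A) (hQ : ∀ n x, 0 ≤ Q n x)
    (hK : MarkovStep Q K) (hac : ∀ n, AbsCont (iidLaw P n) (Q n)) {D : ℝ}
    (hD : markovRate P K < D) : LRUpper P Q D := by
  refine squeeze_zero (fun n => mass_nonneg fun x => iidLaw_nonneg hP.1 x) (fun n => ?_)
    (tendsto_mass_llr hP hK hac (sub_pos.2 hD))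
  refine mass_mono_of_ne_zero (fun x => iidLaw_nonneg hP.1 x) fun x hx h => ?_
  have hx' : 0 < iidLaw P n x := lt_of_le_of_ne (iidLaw_nonneg hP.1 x) (Ne.symm hx)
  have hq : 0 < Q n x := lt_of_le_of_ne (hQ n x) fun h => hx (hac n x h.symm)
  simp only [Set.mem_ofPred_eq, not_le] at h ⊢
  have h2 := Real.log_lt_log (mul_pos (Real.exp_pos _) hq) h
  rw [Real.log_mul (Real.exp_pos _).ne' hq.ne', Real.log_exp] at h2
  refine lt_of_lt_of_le ?_ (le_abs_self _)
  rw [llr]; linarith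

lemma markovRate_iid (P q : A → ℝ) : markovRate P (fun (_ : Fin 0 → A) a => q a) =
    ∑ a, P a * (Real.log (P a) - Real.log (q a)) := by
  simp [markovRate, iidLaw]

/-- Likelihood ratios of memoryless laws: lower bound. -/
lemma lrLower_iid (hP : P ∈ stdSimplex ℝ A) {q : A → ℝ} (hq : ∀ a, 0 ≤ q a) {D : ℝ}
    (hD : (D : EReal) < klD P q) : LRLower P (iidLaw q) D := by
  by_cases hac : AbsCont P q
  · rw [klD_eq_of_absCont hac, EReal.coe_lt_coe_iff, ← markovRate_iid] at hD
    exact lrLower_of_markovStep hP (fun n x => iidLaw_nonneg hq x) (markovStep_iidLaw q)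
      (absCont_iidLaw hac) hD
  -- Infinite divergence: some letter a has q a = 0 < P a. Once a occurs, the second law vanishes
  -- and the bound is trivial; the sequences that avoid a have mass (1 − P a)^n.
  · simp only [AbsCont, not_forall] at hac
    obtain ⟨a, hqa, hPa⟩ := hac
    have hPa' : 0 < P a := lt_of_le_of_ne (hP.1 a) (Ne.symm hPa)
    have hle : P a ≤ 1 := hP.2 ▸ Finset.single_le_sum (fun b _ => hP.1 b) (Finset.mem_univ a)
    refine squeeze_zero (fun n => mass_nonneg fun x => iidLaw_nonneg hP.1 x) (fun n => ?_)
      (tendsto_pow_atTop_nhds_zero_of_lt_one (r := 1 - P a) (by linarith) (by linarith))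
    classical
    have h1 : (1 - P a) ^ n = ∑ x : Fin n → A, ∏ l, if x l = a then 0 else P (x l) := by
      have := (Finset.prod_univ_sum (fun _ : Fin n => (Finset.univ : Finset A))
        fun _ b => if b = a then 0 else P b)
      rw [Fintype.piFinset_univ] at this
      rw [← this, Finset.prod_const, Finset.card_univ, Fintype.card_fin]
      congr 1
      rw [← hP.2, ← Finset.add_sum_erase _ _ (Finset.mem_univ a), add_sub_cancel_left,
        ← Finset.add_sum_erase _ (fun b => if b = a then 0 else P b) (Finset.mem_univ a)]
      simp only [if_true, zero_add]
      exact Finset.sum_congr rfl fun b hb => by rw [if_neg (Finset.ne_of_mem_erase hb)]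
    rw [h1]
    refine Finset.sum_le_sum fun x _ => ?_
    have h0 : 0 ≤ ∏ l, if x l = a then 0 else P (x l) :=
      Finset.prod_nonneg fun l _ => by split_ifs; exacts [le_rfl, hP.1 _]
    by_cases hx : ∃ l, x l = a
    · obtain ⟨l, hl⟩ := hx
      rw [Set.indicator_of_notMem]
      · exact h0
      · have : iidLaw q n x = 0 := Finset.prod_eq_zero (Finset.mem_univ l) (by rw [hl, hqa])
        simp [this, iidLaw_nonneg hP.1 x]
    · simp only [not_exists] at hx
      have : (∏ l, if x l = a then 0 else P (x l)) = iidLaw P n x :=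
        Finset.prod_congr rfl fun l _ => by rw [if_neg (hx l)]
      rw [this]
      exact Set.indicator_le_self' (fun x _ => iidLaw_nonneg hP.1 x) x

/-- Likelihood ratios of memoryless laws: upper bound. -/
lemma lrUpper_iid (hP : P ∈ stdSimplex ℝ A) {q : A → ℝ} (hq : ∀ a, 0 ≤ q a) {D : ℝ}
    (hD : klD P q < D) : LRUpper P (iidLaw q) D := by
  have hac : AbsCont P q := by
    by_contra h
    rw [klD, if_neg h] at hD
    exact not_top_lt hD
  rw [klD_eq_of_absCont hac, EReal.coe_lt_coe_iff, ← markovRate_iid] at hD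
  exact lrUpper_of_markovStep hP (fun n x => iidLaw_nonneg hq x) (markovStep_iidLaw q)
    (absCont_iidLaw hac) hD

/-- The process `Q` belongs to the category `c`, relative to the source `P`. -/
def CatRel (c : Category) (P : A → ℝ) (Q : SeqLaw A) : Prop :=
  match c with
  | .memoryless => IsMemoryless Q
  | .markov => IsFiniteOrderMarkov Q ∧ ∀ n, AbsCont (iidLaw P n) (Q n)

lemma CatRel.nonneg {c : Category} (h : CatRel c P Q) (n : ℕ) (x : Fin n → A) : 0 ≤ Q n x := by
  cases c with
  | memoryless =>
    obtain ⟨q, hq, h⟩ := h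
    rw [h n]; exact iidLaw_nonneg hq.1 x
  | markov => exact (h.1.1 n).1 x

lemma divRate_memoryless {q : A → ℝ} (h : ∀ n, Q n = iidLaw q n) :
    divRate .memoryless P Q = klD P q := by
  simp only [divRate, h 1]
  congr 1; funext a; simp [iidLaw]

lemma CatRel.lrLower {c : Category} (h : CatRel c P Q) (hP : P ∈ stdSimplex ℝ A) {D : ℝ}
    (hD : (D : EReal) < divRate c P Q) : LRLower P Q D := by
  have hQ := h.nonneg
  cases c with
  | memoryless =>
    obtain ⟨q, hq, h⟩ := h
    rw [divRate_memoryless h] at hD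
    obtain rfl : Q = iidLaw q := funext h
    exact lrLower_iid hP hq.1 hD
  | markov =>
    obtain ⟨⟨_, _, w, K, _, hK⟩, hac⟩ := h
    rw [divRate_markov hP hK hac, EReal.coe_lt_coe_iff] at hD
    exact lrLower_of_markovStep hP hQ hK hac hD

lemma CatRel.lrUpper {c : Category} (h : CatRel c P Q) (hP : P ∈ stdSimplex ℝ A) {D : ℝ}
    (hD : divRate c P Q < (D : EReal)) : LRUpper P Q D := by
  have hQ := h.nonneg
  cases c with
  | memoryless =>
    obtain ⟨q, hq, h⟩ := h
    rw [divRate_memoryless h] at hD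
    obtain rfl : Q = iidLaw q := funext h
    exact lrUpper_iid hP hq.1 hD
  | markov =>
    obtain ⟨⟨_, _, w, K, _, hK⟩, hac⟩ := h
    rw [divRate_markov hP hK hac, EReal.coe_lt_coe_iff] at hD
    exact lrUpper_of_markovStep hP hQ hK hac hD

lemma CatRel.divRate_ne_bot {c : Category} (h : CatRel c P Q) (hP : P ∈ stdSimplex ℝ A) :
    divRate c P Q ≠ ⊥ := by
  cases c with
  | memoryless =>
    obtain ⟨q, hq, h⟩ := h
    rw [divRate_memoryless h, klD]
    split_ifs
    · exact EReal.coe_ne_bot _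
    · exact top_ne_bot
  | markov =>
    obtain ⟨⟨_, _, w, K, _, hK⟩, hac⟩ := h
    rw [divRate_markov hP hK hac]
    exact EReal.coe_ne_bot _

/-- The minimal divergence rate is finite and attained. -/
lemma InCategory.exists_min {m k : ℕ} {c : Category} {P : Fin m → A → ℝ} {Q : Fin k → SeqLaw A}
    (h : InCategory c P Q) (hP : ∀ i, P i ∈ stdSimplex ℝ A) (i : Fin m) :
    (∀ j, CatRel c (P i) (Q j)) ∧
      (∀ j, (((⨅ j, divRate c (P i) (Q j)).toReal : ℝ) : EReal) ≤ divRate c (P i) (Q j)) ∧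
      ∃ j, divRate c (P i) (Q j) = (((⨅ j, divRate c (P i) (Q j)).toReal : ℝ) : EReal) := by
  have hcat : ∀ j, CatRel c (P i) (Q j) := by
    intro j
    cases c with
    | memoryless => exact h.1 j
    | markov => exact ⟨h.1.1 j, h.1.2 i j⟩
  have hlt := h.2 i
  -- An infimum over no processes would be ⊤, which the finiteness assumption excludes.
  have hne : Nonempty (Fin k) := by
    by_contra hk
    rw [not_nonempty_iff] at hk
    simp at hlt
  obtain ⟨j, hj⟩ := exists_eq_ciInf_of_finite (f := fun j => divRate c (P i) (Q j))
  have hbot : (⨅ j, divRate c (P i) (Q j)) ≠ ⊥ := by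
    rw [← hj]; exact (hcat j).divRate_ne_bot (hP i)
  have hco := EReal.coe_toReal hlt.ne hbot
  refine ⟨hcat, fun j => ?_, j, ?_⟩
  · rw [hco]; exact iInf_le _ j
  · rw [hco]; exact hj

end LLR

/-! ### One-shot random coding -/

section OneShot

variable {X Y U : Type*} [Fintype X] [Fintype Y] [Fintype U]

lemma sum_prod_eq_prod_sum {B : Type*} [Fintype B] {n : ℕ} (f : Fin n → B → ℝ) :
    ∑ y : Fin n → B, ∏ l, f l (y l) = ∏ l, ∑ b, f l b := by
  classical
  have := (Finset.prod_univ_sum (fun _ : Fin n => (Finset.univ : Finset B)) f)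
  rw [Fintype.piFinset_univ] at this
  exact this.symm

lemma exists_le_sum_mul {Ω : Type*} [Fintype Ω] {p : Ω → ℝ} (hp : p ∈ stdSimplex ℝ Ω)
    (f : Ω → ℝ) : ∃ ω, f ω ≤ ∑ ω, p ω * f ω := by
  have hne : Nonempty Ω := by
    by_contra h
    rw [not_nonempty_iff] at h
    simpa using hp.2
  obtain ⟨ω, hω⟩ := Finite.exists_min f
  refine ⟨ω, ?_⟩
  calc f ω = ∑ ω', p ω' * f ω := by rw [← Finset.sum_mul, hp.2, one_mul]
    _ ≤ _ := Finset.sum_le_sum fun ω' _ => mul_le_mul_of_nonneg_left (hω ω') (hp.1 ω')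

/-- The covering estimate. First 1 − qk ≤ e^{−qk}; then convexity of exp bounds e^{−Mqk} by its
chord in k over [0, 1]. -/
lemma pow_le_one_sub_add_exp {v q k : ℝ} (hv : 0 ≤ v) (hvq : v ≤ 1 - q * k)
    (hk0 : 0 ≤ k) (hk1 : k ≤ 1) (M : ℕ) : v ^ M ≤ 1 - k + Real.exp (-(M * q)) := by
  have h1 : v ≤ Real.exp (-(q * k)) := hvq.trans (by linarith [Real.add_one_le_exp (-(q * k))])
  have h2 : v ^ M ≤ Real.exp (-(M * q) * k) := by
    refine (pow_le_pow_left₀ hv h1 M).trans (le_of_eq ?_)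
    rw [← Real.exp_nat_mul]; ring_nf
  have h3 := convexOn_exp.2 (Set.mem_univ 0) (Set.mem_univ (-(M * q))) (sub_nonneg.2 hk1) hk0
    (by ring)
  simp only [smul_eq_mul, mul_zero, zero_add, Real.exp_zero, mul_one] at h3
  have h4 : k * Real.exp (-(M * q)) ≤ Real.exp (-(M * q)) :=
    mul_le_of_le_one_left (Real.exp_pos _).le hk1
  rw [mul_comm k] at h3
  linarith

/-- Random covering: some codebook of `M` words covers, in the sense of `G`, all but a small part
of the source. -/
lemma exists_codebook {s : X → ℝ} (hs : s ∈ stdSimplex ℝ X) {W : X → U → ℝ}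
    (hW : ∀ x, W x ∈ stdSimplex ℝ U) (G : Set (X × U)) (τ : ℝ)
    (hG : ∀ x u, (x, u) ∈ G → W x u ≤ Real.exp τ * ∑ x', s x' * W x' u) (M : ℕ) :
    ∃ c : Fin M → U, mass s {x | ∀ m, (x, c m) ∉ G} ≤
      mass (fun t : X × U => s t.1 * W t.1 t.2) Gᶜ + Real.exp (-(M * Real.exp (-τ))) := by
  classical
  let pU : U → ℝ := fun u => ∑ x, s x * W x u
  have hpU : pU ∈ stdSimplex ℝ U := by
    refine ⟨fun u => Finset.sum_nonneg fun x _ => mul_nonneg (hs.1 x) ((hW x).1 u), ?_⟩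
    rw [Finset.sum_comm]
    simp_rw [← Finset.mul_sum, (hW _).2, mul_one, hs.2]
  -- Codewords are drawn independently from the output law; some codebook is at least as good as the
  -- average.
  obtain ⟨c, hc⟩ := exists_le_sum_mul (iidLaw_mem hpU M)
    fun c : Fin M → U => mass s {x | ∀ m, (x, c m) ∉ G}
  refine ⟨c, hc.trans ?_⟩
  have h1 : ∑ c, iidLaw pU M c * mass s {x | ∀ m, (x, c m) ∉ G} =
      ∑ x, s x * (∑ u, if (x, u) ∈ G then 0 else pU u) ^ M := by
    simp_rw [mass, Finset.mul_sum]
    rw [Finset.sum_comm]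
    refine Finset.sum_congr rfl fun x _ => ?_
    have : (∑ u, if (x, u) ∈ G then 0 else pU u) ^ M =
        ∑ c : Fin M → U, ∏ m, if (x, c m) ∈ G then 0 else pU (c m) := by
      rw [sum_prod_eq_prod_sum fun _ u => if (x, u) ∈ G then 0 else pU u]
      simp
    rw [this, Finset.mul_sum]
    refine Finset.sum_congr rfl fun c _ => ?_
    rw [Set.indicator_apply]
    split_ifs with h
    · rw [mul_comm]
      congr 1
      exact Finset.prod_congr rfl fun m _ => by rw [if_neg (h m)]
    · simp only [Set.mem_ofPred_eq, not_forall, not_not] at h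
      obtain ⟨m, hm⟩ := h
      have hz : (∏ m, if (x, c m) ∈ G then 0 else pU (c m)) = 0 :=
        Finset.prod_eq_zero (Finset.mem_univ m) (if_pos hm)
      rw [hz, mul_zero, mul_zero]
  rw [h1]
  -- Given x, all M independent words miss G with the probability on the left. The covering estimate
  -- applies with k the W-probability of the section of G and q = e^{−τ}, since `hG` gives this
  -- section output probability at least qk.
  have h2 : ∀ x, s x * (∑ u, if (x, u) ∈ G then 0 else pU u) ^ M ≤
      s x * (∑ u, if (x, u) ∈ G then 0 else W x u) +
        s x * Real.exp (-(M * Real.exp (-τ))) := by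
    intro x
    rw [← mul_add]
    refine mul_le_mul_of_nonneg_left ?_ (hs.1 x)
    have hk : ∑ u, (if (x, u) ∈ G then W x u else 0) =
        1 - ∑ u, (if (x, u) ∈ G then 0 else W x u) := by
      rw [← (hW x).2, ← Finset.sum_sub_distrib]
      exact Finset.sum_congr rfl fun u _ => by split_ifs <;> simp
    have hq : ∑ u, (if (x, u) ∈ G then 0 else pU u) =
        1 - ∑ u, (if (x, u) ∈ G then pU u else 0) := by
      rw [← hpU.2, ← Finset.sum_sub_distrib]
      exact Finset.sum_congr rfl fun u _ => by split_ifs <;> simp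
    have hk0 : 0 ≤ ∑ u, (if (x, u) ∈ G then 0 else W x u) :=
      Finset.sum_nonneg fun u _ => by split_ifs; exacts [le_rfl, (hW x).1 u]
    have hk1 : 0 ≤ ∑ u, (if (x, u) ∈ G then W x u else 0) :=
      Finset.sum_nonneg fun u _ => by split_ifs; exacts [(hW x).1 u, le_rfl]
    have := pow_le_one_sub_add_exp (v := ∑ u, if (x, u) ∈ G then 0 else pU u)
      (q := Real.exp (-τ)) (k := ∑ u, (if (x, u) ∈ G then W x u else 0))
      (Finset.sum_nonneg fun u _ => by split_ifs; exacts [le_rfl, hpU.1 u]) ?_ hk1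
      (by linarith) M
    · linarith
    · rw [hq, Finset.mul_sum]
      refine sub_le_sub_left (Finset.sum_le_sum fun u _ => ?_) _
      split_ifs with h
      · rw [Real.exp_neg, inv_mul_le_iff₀ (Real.exp_pos _)]
        exact hG x u h
      · simp
  refine (Finset.sum_le_sum fun x _ => h2 x).trans (le_of_eq ?_)
  rw [Finset.sum_add_distrib, ← Finset.sum_mul, hs.2, one_mul, mass, Fintype.sum_prod_type]
  congr 1
  refine Finset.sum_congr rfl fun x _ => ?_
  rw [Finset.mul_sum]
  refine Finset.sum_congr rfl fun u _ => ?_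
  by_cases h : (x, u) ∈ G
  · simp [h]
  · rw [Set.indicator_of_mem (by exact h), if_neg h]

lemma mass_fst {s : X → ℝ} {W : X → U → ℝ} (hW : ∀ x, ∑ u, W x u = 1) (S : Set X) :
    mass (fun t : X × U => s t.1 * W t.1 t.2) {t | t.1 ∈ S} = mass s S := by
  classical
  rw [mass, mass, Fintype.sum_prod_type]
  refine Finset.sum_congr rfl fun x _ => ?_
  simp only [Set.indicator_apply, Set.mem_ofPred_eq]
  split_ifs
  · rw [← Finset.mul_sum, hW, mul_one]
  · simp

/-- A one-shot code: an encoder (`none` meaning failure) and acceptance regions with small error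
under every source `P i` and small type II error. -/
lemma exists_one_shot_code {ι κ₁ κ₂ : Type*} [Fintype ι] [Fintype κ₁] [Fintype κ₂]
    {s : X → ℝ} (hs : s ∈ stdSimplex ℝ X) {W : X → U → ℝ}
    (hW : ∀ x, W x ∈ stdSimplex ℝ U) {P : ι → Y → X → ℝ} (hP : ∀ i y x, 0 ≤ P i y x)
    (hPs : ∀ i x, ∑ y, P i y x = s x) {QX : κ₁ → X → ℝ} (hQX : ∀ t x, 0 ≤ QX t x)
    {QY : κ₂ → Y → ℝ} (hQY : ∀ j y, 0 ≤ QY j y) (B : Set X) (τ aX : ℝ) (aI aY : ι → ℝ)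
    {κ : ℝ} (hκ : 0 < κ) (M : ℕ) {pU : U → ℝ} (hpU : ∀ u, pU u = ∑ x, s x * W x u)
    {PY : ι → Y → ℝ} (hPY : ∀ i y, PY i y = ∑ x, P i y x)
    {JY : ι → Y × U → ℝ} (hJY : ∀ i t, JY i t = ∑ x, P i t.1 x * W x t.2) :
    ∃ (e : X → Option (Fin M)) (acc : Fin M → Set Y),
      (∀ x m, e x = some m → x ∈ B) ∧
      (∀ i, mass (fun t : Y × X => P i t.1 t.2) {t | ¬ ∃ m, e t.2 = some m ∧ t.1 ∈ acc m} ≤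
        κ + (mass s Bᶜ
          + mass (fun t : X × U => s t.1 * W t.1 t.2)
              {t | ¬ s t.1 * W t.1 t.2 ≤ Real.exp τ * (s t.1 * pU t.2)}
          + ∑ t, mass s {x | ¬ Real.exp aX * QX t x ≤ s x}
          + ∑ i, (mass (JY i) {t | ¬ Real.exp (aI i) * (PY i t.1 * pU t.2) ≤ JY i t}
              + ∑ j, mass (PY i) {y | ¬ Real.exp (aY i) * QY j y ≤ PY i y}) / κ
          + Real.exp (-(M * Real.exp (-τ))))) ∧
      ∀ j t, ∑ m, mass (QX t) {x | e x = some m} * mass (QY j) (acc m) ≤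
        Real.exp (-aX) * ∑ i, Real.exp (-(aI i + aY i)) := by
  classical
  have hpU0 : ∀ u, 0 ≤ pU u := fun u => by
    rw [hpU]; exact Finset.sum_nonneg fun x _ => mul_nonneg (hs.1 x) ((hW x).1 u)
  have hPY0 : ∀ i y, 0 ≤ PY i y := fun i y => by
    rw [hPY]; exact Finset.sum_nonneg fun x _ => hP i y x
  have hJY0 : ∀ i t, 0 ≤ JY i t := fun i t => by
    rw [hJY]; exact Finset.sum_nonneg fun x _ => mul_nonneg (hP i _ x) ((hW x).1 _)
  have hJYU : ∀ i u, ∑ y, JY i (y, u) = pU u := fun i u => by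
    simp_rw [hJY, hpU]
    rw [Finset.sum_comm]
    simp_rw [← Finset.sum_mul, hPs]
  have hJYY : ∀ i y, ∑ u, JY i (y, u) = PY i y := fun i y => by
    simp_rw [hJY, hPY]
    rw [Finset.sum_comm]
    simp_rw [← Finset.mul_sum, (hW _).2, mul_one]
  have hsW0 : ∀ t : X × U, 0 ≤ s t.1 * W t.1 t.2 := fun t => mul_nonneg (hs.1 _) ((hW _).1 _)
  -- T i collects the pairs (y, u) accepted on behalf of source i: both the information density and
  -- the likelihood ratios of y are large enough.
  let T : ι → Set (Y × U) := fun i => {t | 0 < pU t.2 ∧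
    Real.exp (aI i) * (PY i t.1 * pU t.2) ≤ JY i t ∧ ∀ j, Real.exp (aY i) * QY j t.1 ≤ PY i t.1}
  let b : ι → X → U → ℝ := fun i x u => mass (fun y => P i y x) {y | (y, u) ∉ T i}
  -- A word is admissible for x only if, conditionally on x, each source is rejected with
  -- probability at most κ. This takes the place of a Markov lemma: the mean of that conditional
  -- probability is the mass of the complement of T i, so Markov's inequality (`hbmass`) controls
  -- the exceptions.
  let G : Set (X × U) := {t | t.1 ∈ B ∧ 0 < s t.1 ∧
    s t.1 * W t.1 t.2 ≤ Real.exp τ * (s t.1 * pU t.2) ∧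
    (∀ t', Real.exp aX * QX t' t.1 ≤ s t.1) ∧ ∀ i, b i t.1 t.2 ≤ κ * s t.1}
  obtain ⟨c, hc⟩ := exists_codebook hs hW G τ (by
    rintro x u ⟨_, h0, h1, _⟩
    rw [← hpU]
    have : s x * W x u ≤ s x * (Real.exp τ * pU u) := by linarith
    exact le_of_mul_le_mul_left this h0) M
  have hTc : ∀ i, mass (JY i) (T i)ᶜ ≤
      mass (JY i) {t | ¬ Real.exp (aI i) * (PY i t.1 * pU t.2) ≤ JY i t}
        + ∑ j, mass (PY i) {y | ¬ Real.exp (aY i) * QY j y ≤ PY i y} := by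
    intro i
    have e1 : ∀ j, mass (PY i) {y | ¬ Real.exp (aY i) * QY j y ≤ PY i y} =
        mass (JY i) {t | ¬ Real.exp (aY i) * QY j t.1 ≤ PY i t.1} := by
      intro j
      rw [mass, mass, Fintype.sum_prod_type]
      refine Finset.sum_congr rfl fun y _ => ?_
      simp only [Set.indicator_apply, Set.mem_ofPred_eq]
      split_ifs
      · simp
      · rw [hJYY]
    simp_rw [e1]
    refine le_trans ?_ (add_le_add_right (mass_iUnion_le (hJY0 i) _) _)
    refine le_trans ?_ (mass_union_le (hJY0 i))
    refine mass_mono_of_ne_zero (hJY0 i) fun t ht hT => ?_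
    have hpos : 0 < pU t.2 := by
      rw [← hJYU i]
      exact Finset.sum_pos' (fun y _ => hJY0 i _)
        ⟨t.1, Finset.mem_univ _, lt_of_le_of_ne (hJY0 i t) (Ne.symm ht)⟩
    by_contra hcon
    simp only [Set.mem_union, Set.mem_ofPred_eq, Set.mem_iUnion, not_or, not_not,
      not_exists] at hcon
    exact hT ⟨hpos, hcon.1, hcon.2⟩
  have hbsum : ∀ i, ∑ t : X × U, W t.1 t.2 * b i t.1 t.2 = mass (JY i) (T i)ᶜ := by
    intro i
    simp only [b, mass, Finset.mul_sum]
    rw [Finset.sum_comm, Fintype.sum_prod_type]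
    refine Finset.sum_congr rfl fun y _ => ?_
    rw [Fintype.sum_prod_type, Finset.sum_comm]
    refine Finset.sum_congr rfl fun u _ => ?_
    by_cases h : (y, u) ∈ T i
    · rw [Set.indicator_of_notMem (by simpa using h)]
      refine Finset.sum_eq_zero fun x _ => ?_
      rw [Set.indicator_of_notMem (by simpa using h), mul_zero]
    · rw [Set.indicator_of_mem (by simpa using h), hJY]
      refine Finset.sum_congr rfl fun x _ => ?_
      rw [Set.indicator_of_mem (by simpa using h), mul_comm]
  have hb0 : ∀ i x u, 0 ≤ b i x u := fun i x u => mass_nonneg fun y => hP i y x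
  have hbmass : ∀ i, mass (fun t : X × U => s t.1 * W t.1 t.2)
      {t | ¬ b i t.1 t.2 ≤ κ * s t.1} ≤ mass (JY i) (T i)ᶜ / κ := by
    intro i
    rw [le_div_iff₀ hκ, ← hbsum, mass, Finset.sum_mul]
    refine Finset.sum_le_sum fun t _ => ?_
    rw [Set.indicator_apply]
    split_ifs with h
    · simp only [Set.mem_ofPred_eq, not_le] at h
      have := mul_le_mul_of_nonneg_left h.le ((hW t.1).1 t.2)
      linarith
    · rw [zero_mul]; exact mul_nonneg ((hW _).1 _) (hb0 _ _ _)
  have hGc : mass (fun t : X × U => s t.1 * W t.1 t.2) Gᶜ ≤ mass s Bᶜ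
      + mass (fun t : X × U => s t.1 * W t.1 t.2)
          {t | ¬ s t.1 * W t.1 t.2 ≤ Real.exp τ * (s t.1 * pU t.2)}
      + ∑ t, mass s {x | ¬ Real.exp aX * QX t x ≤ s x}
      + ∑ i, (mass (JY i) {t | ¬ Real.exp (aI i) * (PY i t.1 * pU t.2) ≤ JY i t}
          + ∑ j, mass (PY i) {y | ¬ Real.exp (aY i) * QY j y ≤ PY i y}) / κ := by
    have e1 : mass s Bᶜ = mass (fun t : X × U => s t.1 * W t.1 t.2) {t | t.1 ∈ Bᶜ} :=
      (mass_fst (fun x => (hW x).2) _).symm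
    have e2 : ∀ t', mass s {x | ¬ Real.exp aX * QX t' x ≤ s x} =
        mass (fun t : X × U => s t.1 * W t.1 t.2)
          {t | t.1 ∈ {x | ¬ Real.exp aX * QX t' x ≤ s x}} :=
      fun t' => (mass_fst (fun x => (hW x).2) _).symm
    have e3 := Finset.sum_le_sum fun i (_ : i ∈ Finset.univ) =>
      (hbmass i).trans (div_le_div_of_nonneg_right (hTc i) hκ.le)
    rw [e1]
    simp_rw [e2]
    refine le_trans ?_ (add_le_add_right e3 _)
    refine le_trans ?_ (add_le_add (add_le_add_right (mass_iUnion_le hsW0 _) _)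
      (mass_iUnion_le hsW0 _))
    refine le_trans ?_ (add_le_add_left (add_le_add_left (mass_union_le hsW0) _) _)
    refine le_trans ?_ (add_le_add_left (mass_union_le hsW0) _)
    refine le_trans ?_ (mass_union_le hsW0)
    refine mass_mono_of_ne_zero hsW0 fun t ht hG => ?_
    by_contra hcon
    simp only [Set.mem_union, Set.mem_ofPred_eq, Set.mem_iUnion, not_or, not_not,
      not_exists, Set.mem_compl_iff] at hcon
    exact hG ⟨hcon.1.1.1, lt_of_le_of_ne (hs.1 _) (Ne.symm (left_ne_zero_of_mul ht)),
      hcon.1.1.2, hcon.1.2, hcon.2⟩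
  let e : X → Option (Fin M) := fun x => if h : ∃ m, (x, c m) ∈ G then some h.choose else none
  have he : ∀ x m, e x = some m → (x, c m) ∈ G := by
    intro x m h
    by_cases hx : ∃ m, (x, c m) ∈ G
    · simp only [e, hx, dif_pos, Option.some.injEq] at h
      rw [← h]; exact hx.choose_spec
    · simp [e, hx] at h
  have he' : ∀ x, e x = none → x ∈ {x | ∀ m, (x, c m) ∉ G} := by
    intro x h
    by_contra hx
    simp only [Set.mem_ofPred_eq, not_forall, not_not] at hx
    simp [e, hx] at h
  refine ⟨e, fun m => ⋃ i, {y | (y, c m) ∈ T i}, fun x m h => (he x m h).1, fun i => ?_,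
    fun j t => ?_⟩
  · have h1 : mass (fun t : Y × X => P i t.1 t.2)
        {t | ¬ ∃ m, e t.2 = some m ∧ t.1 ∈ ⋃ i, {y | (y, c m) ∈ T i}} ≤
        ∑ x, (κ * s x + ({x | ∀ m, (x, c m) ∉ G}).indicator s x) := by
      rw [mass, Fintype.sum_prod_type, Finset.sum_comm]
      refine Finset.sum_le_sum fun x _ => ?_
      cases hx : e x with
      | none =>
        rw [Set.indicator_of_mem (he' x hx)]
        refine le_trans ?_ (le_add_of_nonneg_left (mul_nonneg hκ.le (hs.1 x)))
        rw [← hPs i x]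
        exact Finset.sum_le_sum fun y _ => Set.indicator_le_self' (fun _ _ => hP i _ _) _
      | some m =>
        refine le_trans ?_ (le_add_of_nonneg_right (Set.indicator_nonneg (fun x _ => hs.1 x) x))
        refine le_trans ?_ ((he x m hx).2.2.2.2 i)
        refine Finset.sum_le_sum fun y _ => ?_
        simp only [Set.indicator_apply, Set.mem_ofPred_eq]
        by_cases hT : (y, c m) ∈ T i
        · have : ∃ m, e x = some m ∧ y ∈ ⋃ i, {y | (y, c m) ∈ T i} :=
            ⟨m, hx, Set.mem_iUnion.2 ⟨i, hT⟩⟩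
          rw [if_neg (not_not.2 this), if_neg (not_not.2 hT)]
        · rw [if_pos hT]
          split_ifs
          exacts [hP i y x, le_rfl]
    refine h1.trans ?_
    rw [Finset.sum_add_distrib, ← Finset.mul_sum, hs.2, mul_one]
    refine add_le_add_right (hc.trans ?_) κ
    exact add_le_add_left hGc _
  · have hacc : ∀ m, mass (QY j) (⋃ i, {y | (y, c m) ∈ T i}) ≤
        ∑ i, Real.exp (-(aI i + aY i)) := by
      intro m
      refine (mass_iUnion_le (hQY j) _).trans (Finset.sum_le_sum fun i _ => ?_)
      by_cases hp : 0 < pU (c m)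
      -- Change of measure on T i: QY ≤ e^{−aY} PY and PY · pU ≤ e^{−aI} JY, and summing JY over y
      -- returns pU, which cancels.
      · have h2 : mass (QY j) {y | (y, c m) ∈ T i} * (Real.exp (aI i + aY i) * pU (c m)) ≤
            pU (c m) := by
          rw [← hJYU i, mass, Finset.sum_mul]
          refine Finset.sum_le_sum fun y _ => ?_
          rw [hJYU i, Set.indicator_apply]
          split_ifs with h
          · obtain ⟨_, h3, h4⟩ := h
            calc QY j y * (Real.exp (aI i + aY i) * pU (c m))
                = Real.exp (aI i) * ((Real.exp (aY i) * QY j y) * pU (c m)) := by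
                  rw [Real.exp_add]; ring
              _ ≤ Real.exp (aI i) * (PY i y * pU (c m)) :=
                  mul_le_mul_of_nonneg_left (mul_le_mul_of_nonneg_right (h4 j) hp.le)
                    (Real.exp_pos _).le
              _ ≤ _ := h3
          · rw [zero_mul]; exact hJY0 i _
        rw [Real.exp_neg, ← one_div, le_div_iff₀ (Real.exp_pos _)]
        rw [← mul_assoc] at h2
        exact le_of_mul_le_mul_right (by rwa [one_mul]) hp
      · refine le_trans (le_of_eq ?_) (Real.exp_pos _).le
        refine Finset.sum_eq_zero fun y _ => Set.indicator_of_notMem (fun h => hp h.1) _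
    -- The encoding sets are disjoint and QX ≤ e^{−aX} s on them, so summing over messages costs no
    -- factor M.
    have h5 : ∑ m, mass (QX t) {x | e x = some m} ≤ Real.exp (-aX) := by
      simp only [mass]
      rw [Finset.sum_comm]
      calc _ ≤ ∑ x, Real.exp (-aX) * s x := by
            refine Finset.sum_le_sum fun x _ => ?_
            cases hx : e x with
            | none =>
              rw [Finset.sum_eq_zero fun m _ => Set.indicator_of_notMem (by simp [hx]) _]
              exact mul_nonneg (Real.exp_pos _).le (hs.1 x)
            | some m =>
              rw [Finset.sum_eq_single m
                (fun m' _ h => Set.indicator_of_notMem (by simpa [hx] using h.symm) _)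
                (fun h => absurd (Finset.mem_univ _) h)]
              rw [Set.indicator_of_mem (by exact hx), Real.exp_neg,
                ← div_eq_inv_mul, le_div_iff₀ (Real.exp_pos _), mul_comm]
              exact (he x m hx).2.2.2.1 t
        _ = _ := by rw [← Finset.mul_sum, hs.2, mul_one]
    calc _ ≤ ∑ m, mass (QX t) {x | e x = some m} * ∑ i, Real.exp (-(aI i + aY i)) :=
          Finset.sum_le_sum fun m _ =>
            mul_le_mul_of_nonneg_left (hacc m) (mass_nonneg (hQX t))
      _ ≤ _ := by
          rw [← Finset.sum_mul]
          exact mul_le_mul_of_nonneg_right h5 (Finset.sum_nonneg fun i _ => (Real.exp_pos _).le)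

end OneShot

/-! ### Codes for sources with a common `X`-marginal -/

section ClassCode

/-- The law of `n` i.i.d. pairs, as a law of a pair of sequences. -/
def pairLaw {A B : Type*} (P : A × B → ℝ) (n : ℕ) (t : (Fin n → A) × (Fin n → B)) : ℝ :=
  iidLaw P n fun l => (t.1 l, t.2 l)

variable {A B : Type*} [Fintype A] [Fintype B]

lemma sum_pair {n : ℕ} (F : (Fin n → A) × (Fin n → B) → ℝ) :
    ∑ t, F t = ∑ z : Fin n → A × B, F (fun l => (z l).1, fun l => (z l).2) :=
  ((Equiv.arrowProdEquivProdArrow (Fin n) (fun _ => A) fun _ => B).sum_comp F).symm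

lemma mass_pairLaw (P : A × B → ℝ) (n : ℕ) (S : Set ((Fin n → A) × (Fin n → B))) :
    mass (pairLaw P n) S =
      mass (iidLaw P n) {z | ((fun l => (z l).1, fun l => (z l).2) : (Fin n → A) × _) ∈ S} := by
  rw [mass, sum_pair]
  rfl

lemma sum_pairLaw_right {A B : Type*} [Fintype B] (P : A × B → ℝ) (n : ℕ) (y : Fin n → A) :
    ∑ x, pairLaw P n (y, x) = iidLaw (fun a => ∑ b, P (a, b)) n y :=
  sum_prod_eq_prod_sum fun l b => P (y l, b)

lemma sum_pairLaw_left {A B : Type*} [Fintype A] (P : A × B → ℝ) (n : ℕ) (x : Fin n → B) :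
    ∑ y, pairLaw P n (y, x) = iidLaw (fun b => ∑ a, P (a, b)) n x :=
  sum_prod_eq_prod_sum fun l a => P (a, x l)

lemma tendsto_mass_pairLaw_lower {P : A × B → ℝ} (hP : P ∈ stdSimplex ℝ (A × B)) {f : A → ℝ}
    {g : B → ℝ} (hf : ∀ a, 0 ≤ f a) (hg : ∀ b, 0 ≤ g b) {D : ℝ}
    (hD : (D : EReal) < klD P fun t => f t.1 * g t.2) :
    Tendsto (fun n : ℕ => mass (pairLaw P n)
      {t | ¬ Real.exp (n * D) * (iidLaw f n t.1 * iidLaw g n t.2) ≤ pairLaw P n t})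
      atTop (𝓝 0) := by
  have := lrLower_iid hP (fun t => mul_nonneg (hf t.1) (hg t.2)) hD
  refine this.congr fun n => ?_
  rw [mass_pairLaw]
  congr 1
  ext z
  simp only [Set.mem_ofPred_eq, iidLaw, pairLaw, Finset.prod_mul_distrib]

lemma tendsto_mass_pairLaw_upper {P : A × B → ℝ} (hP : P ∈ stdSimplex ℝ (A × B)) {f : A → ℝ}
    {g : B → ℝ} (hf : ∀ a, 0 ≤ f a) (hg : ∀ b, 0 ≤ g b) {D : ℝ}
    (hD : (klD P fun t => f t.1 * g t.2) < D) :
    Tendsto (fun n : ℕ => mass (pairLaw P n)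
      {t | ¬ pairLaw P n t ≤ Real.exp (n * D) * (iidLaw f n t.1 * iidLaw g n t.2)})
      atTop (𝓝 0) := by
  have := lrUpper_iid hP (fun t => mul_nonneg (hf t.1) (hg t.2)) hD
  refine this.congr fun n => ?_
  rw [mass_pairLaw]
  congr 1
  ext z
  simp only [Set.mem_ofPred_eq, iidLaw, pairLaw, Finset.prod_mul_distrib]

lemma klD_eq_mutualInfo {J : A → B → ℝ} (hJ : ∀ a b, 0 ≤ J a b) {f : A → ℝ} {g : B → ℝ}
    (hf : ∀ a, f a = ∑ b, J a b) (hg : ∀ b, g b = ∑ a, J a b) :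
    (klD (fun t : A × B => J t.1 t.2) fun t => f t.1 * g t.2) = (mutualInfo J : EReal) := by
  rw [klD, if_pos, Fintype.sum_prod_type, mutualInfo]
  · simp_rw [hf, hg]
  · rintro ⟨a, b⟩ h
    simp only [mul_eq_zero] at h
    rcases h with h | h
    · rw [hf] at h
      exact (Finset.sum_eq_zero_iff_of_nonneg fun b _ => hJ a b).1 h b (Finset.mem_univ _)
    · rw [hg] at h
      exact (Finset.sum_eq_zero_iff_of_nonneg fun a _ => hJ a b).1 h a (Finset.mem_univ _)

variable {X Y : Type*} [Fintype X] [Fintype Y]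

/-- The one-shot code for n letters and the product kernel. One codebook serves all i because the
sources share the law of X, hence that of U; only the acceptance regions depend on i, and these are
united. Every error term vanishes by the law of large numbers for likelihood ratios. -/
lemma exists_class_code {ι κ₁ κ₂ : Type*} [Fintype ι] [Fintype κ₁] [Fintype κ₂] {s : X → ℝ}
    (hs : s ∈ stdSimplex ℝ X) {P : ι → Y × X → ℝ} (hP : ∀ i, P i ∈ stdSimplex ℝ (Y × X))
    (hPs : ∀ i, margX (P i) = s) (K : TestChannel X) {R : ℝ} (hR : Setup.infoXU s K ≤ R)
    {QX : κ₁ → SeqLaw X} (hQX : ∀ t n x, 0 ≤ QX t n x) {QY : κ₂ → SeqLaw Y}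
    (hQY : ∀ j n y, 0 ≤ QY j n y) {DX : ℝ} (hDX : ∀ t, LRLower s (QX t) DX) {DY : ι → ℝ}
    (hDY : ∀ i j, LRLower (margY (P i)) (QY j) (DY i)) (B : (n : ℕ) → Set (Fin n → X))
    (hB : Tendsto (fun n => mass (iidLaw s n) (B n)ᶜ) atTop (𝓝 0)) {E δ : ℝ} (hδ : 0 < δ)
    (hE : ∀ i, E ≤ chanYU (P i) K - δ + DY i + DX) :
    ∀ᶠ n : ℕ in atTop, ∃ (e : (Fin n → X) → Option (Fin ⌈Real.exp (n * (R + δ))⌉₊))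
      (acc : Fin ⌈Real.exp (n * (R + δ))⌉₊ → Set (Fin n → Y)),
      (∀ x m, e x = some m → x ∈ B n) ∧
      (∀ i, mass (pairLaw (P i) n) {t | ¬ ∃ m, e t.2 = some m ∧ t.1 ∈ acc m} ≤ δ) ∧
      ∀ j t, ∑ m, mass (QX t n) {x | e x = some m} * mass (QY j n) (acc m) ≤
        Fintype.card ι * Real.exp (-(n * E)) := by
  let W : (n : ℕ) → (Fin n → X) → (Fin n → Fin K.size) → ℝ := fun n x u => ∏ l, K.prob (x l) (u l)
  have hW : ∀ n x, W n x ∈ stdSimplex ℝ (Fin n → Fin K.size) := by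
    intro n x
    refine ⟨fun u => Finset.prod_nonneg fun l _ => (K.mem _).1 _, ?_⟩
    rw [sum_prod_eq_prod_sum fun l u => K.prob (x l) u]
    simp [(K.mem _).2]
  let pU : Fin K.size → ℝ := fun u => ∑ x, s x * K.prob x u
  have hpU0 : ∀ u, 0 ≤ pU u := fun u =>
    Finset.sum_nonneg fun x _ => mul_nonneg (hs.1 x) ((K.mem x).1 u)
  let JX : X × Fin K.size → ℝ := fun t => s t.1 * K.prob t.1 t.2
  have hJX : JX ∈ stdSimplex ℝ (X × Fin K.size) := by
    refine ⟨fun t => mul_nonneg (hs.1 _) ((K.mem _).1 _), ?_⟩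
    rw [Fintype.sum_prod_type]
    simp only [JX, ← Finset.mul_sum, (K.mem _).2, mul_one, hs.2]
  let JY : ι → Y × Fin K.size → ℝ := fun i t => ∑ x, P i (t.1, x) * K.prob x t.2
  have hJY0 : ∀ i t, 0 ≤ JY i t := fun i t =>
    Finset.sum_nonneg fun x _ => mul_nonneg ((hP i).1 _) ((K.mem x).1 _)
  have hJYY : ∀ i y, margY (P i) y = ∑ u, JY i (y, u) := by
    intro i y
    simp only [JY]
    rw [Finset.sum_comm]
    simp only [← Finset.mul_sum, (K.mem _).2, mul_one, margY]
  have hJYU : ∀ i u, pU u = ∑ y, JY i (y, u) := by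
    intro i u
    simp only [JY, pU]
    rw [Finset.sum_comm]
    simp only [← Finset.sum_mul, ← hPs i, margX]
  have hJY : ∀ i, JY i ∈ stdSimplex ℝ (Y × Fin K.size) := by
    intro i
    refine ⟨hJY0 i, ?_⟩
    rw [Fintype.sum_prod_type]
    simp only [← hJYY]
    exact (margY_mem (hP i)).2
  have hXU : (klD JX fun t => s t.1 * pU t.2) = (Setup.infoXU s K : EReal) :=
    klD_eq_mutualInfo (J := fun x u => s x * K.prob x u)
      (fun x u => mul_nonneg (hs.1 x) ((K.mem x).1 u))
      (fun x => by rw [← Finset.mul_sum, (K.mem x).2, mul_one]) fun u => rfl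
  have hYU : ∀ i, (klD (JY i) fun t => margY (P i) t.1 * pU t.2) = (chanYU (P i) K : EReal) :=
    fun i => klD_eq_mutualInfo (J := fun y u => JY i (y, u)) (fun y u => hJY0 i _) (hJYY i)
      (hJYU i)
  have hlim : Tendsto (fun n : ℕ => mass (iidLaw s n) (B n)ᶜ
      + mass (pairLaw JX n) {t | ¬ pairLaw JX n t ≤
          Real.exp (n * (R + δ / 2)) * (iidLaw s n t.1 * iidLaw pU n t.2)}
      + ∑ t, mass (iidLaw s n) {x | ¬ Real.exp (n * DX) * QX t n x ≤ iidLaw s n x}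
      + ∑ i, (mass (pairLaw (JY i) n) {t | ¬ Real.exp (n * (chanYU (P i) K - δ)) *
            (iidLaw (margY (P i)) n t.1 * iidLaw pU n t.2) ≤ pairLaw (JY i) n t}
          + ∑ j, mass (iidLaw (margY (P i)) n)
            {y | ¬ Real.exp (n * DY i) * QY j n y ≤ iidLaw (margY (P i)) n y}) / (δ / 2)
      + Real.exp (-(⌈Real.exp (n * (R + δ))⌉₊ * Real.exp (-(n * (R + δ / 2)))))) atTop (𝓝 0) := by
    have h1 := tendsto_mass_pairLaw_upper hJX hs.1 hpU0 (D := R + δ / 2) (by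
      rw [hXU, EReal.coe_lt_coe_iff]; linarith)
    have h2 : Tendsto (fun n : ℕ => ∑ t, mass (iidLaw s n)
        {x | ¬ Real.exp (n * DX) * QX t n x ≤ iidLaw s n x}) atTop (𝓝 0) := by
      simpa using tendsto_finsetSum Finset.univ fun t _ => hDX t
    have h3 : ∀ i, Tendsto (fun n : ℕ => mass (pairLaw (JY i) n)
        {t | ¬ Real.exp (n * (chanYU (P i) K - δ)) *
            (iidLaw (margY (P i)) n t.1 * iidLaw pU n t.2) ≤ pairLaw (JY i) n t}) atTop (𝓝 0) :=
      fun i => tendsto_mass_pairLaw_lower (hJY i) (margY_mem (hP i)).1 hpU0 (by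
        rw [hYU, EReal.coe_lt_coe_iff]; linarith)
    have h4 : ∀ i, Tendsto (fun n : ℕ => ∑ j, mass (iidLaw (margY (P i)) n)
        {y | ¬ Real.exp (n * DY i) * QY j n y ≤ iidLaw (margY (P i)) n y}) atTop (𝓝 0) := by
      intro i
      simpa using tendsto_finsetSum Finset.univ fun j _ => hDY i j
    have h5 := tendsto_finsetSum Finset.univ fun i (_ : i ∈ Finset.univ) =>
      ((h3 i).add (h4 i)).div_const (δ / 2)
    -- The codebook has e^{n(R+δ)} words while covering needs about e^{n(R+δ/2)}; the surplus
    -- e^{nδ/2} sits in the exponent.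
    have h6 : Tendsto (fun n : ℕ => Real.exp (-(⌈Real.exp (n * (R + δ))⌉₊ *
        Real.exp (-(n * (R + δ / 2)))))) atTop (𝓝 0) := by
      rw [Real.tendsto_exp_comp_nhds_zero, tendsto_neg_atBot_iff]
      have h7 : Tendsto (fun n : ℕ => Real.exp (n * (δ / 2))) atTop atTop :=
        Real.tendsto_exp_atTop.comp (tendsto_natCast_atTop_atTop.atTop_mul_const (by positivity))
      refine tendsto_atTop_mono (fun n => ?_) h7
      calc Real.exp (n * (δ / 2)) = Real.exp (n * (R + δ)) * Real.exp (-(n * (R + δ / 2))) := by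
            rw [← Real.exp_add]; ring_nf
        _ ≤ _ := mul_le_mul_of_nonneg_right (Nat.le_ceil _) (Real.exp_pos _).le
    simpa using (((hB.add h1).add h2).add h5).add h6
  filter_upwards [hlim.eventually_le_const (half_pos hδ)] with n hn
  obtain ⟨e, acc, h1, h2, h3⟩ := exists_one_shot_code (iidLaw_mem hs n) (hW n)
    (P := fun i y x => pairLaw (P i) n (y, x)) (fun i y x => iidLaw_nonneg (hP i).1 _)
    (fun i x => by rw [sum_pairLaw_left, ← hPs i]; rfl) (fun t => hQX t n) (fun j => hQY j n) (B n)
    (n * (R + δ / 2)) (n * DX) (fun i => n * (chanYU (P i) K - δ)) (fun i => n * DY i)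
    (half_pos hδ) ⌈Real.exp (n * (R + δ))⌉₊ (pU := iidLaw pU n)
    (fun u => by
      simp only [iidLaw, W, ← Finset.prod_mul_distrib]
      exact (sum_prod_eq_prod_sum fun l x => s x * K.prob x (u l)).symm)
    (PY := fun i => iidLaw (margY (P i)) n) (fun i y => (sum_pairLaw_right _ _ _).symm)
    (JY := fun i => pairLaw (JY i) n)
    (fun i t => by
      simp only [pairLaw, iidLaw, W, ← Finset.prod_mul_distrib]
      exact (sum_prod_eq_prod_sum fun l x => P i (t.1 l, x) * K.prob x (t.2 l)).symm)
  refine ⟨e, acc, h1, fun i => (h2 i).trans ?_, fun j t => (h3 j t).trans ?_⟩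
  · have e1 : (fun t : (Fin n → X) × (Fin n → Fin K.size) => iidLaw s n t.1 * W n t.1 t.2) =
        pairLaw JX n := by
      funext t
      simp only [pairLaw, iidLaw, W, JX, Finset.prod_mul_distrib]
    have e2 : ∀ t : (Fin n → X) × (Fin n → Fin K.size), iidLaw s n t.1 * W n t.1 t.2 =
        pairLaw JX n t := congrFun e1
    simp only [e2]
    linarith
  · rw [Finset.mul_sum]
    refine (Finset.sum_le_card_nsmul _ _ (Real.exp (-(n * E))) fun i _ => ?_).trans ?_
    · rw [← Real.exp_add, Real.exp_le_exp]
      have := mul_le_mul_of_nonneg_left (hE i) (Nat.cast_nonneg (α := ℝ) n)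
      linarith
    · simp

end ClassCode

/-! ### Optimal kernels for a class of sources -/

namespace Setup

variable {X Y : Type*} [Fintype X] [Fintype Y] {m k r : ℕ} {S : Setup X Y m k r}

lemma Valid.mem (hS : S.Valid) (i : Fin m) : S.P i ∈ stdSimplex ℝ (Y × X) := hS.1 i

/-- Data processing bounds the set in the definition of ξ from above, without which the real
supremum would carry no information. -/
lemma infoYU_le_xi (hS : S.Valid) {R : ℝ} {i : Fin m} {K : TestChannel X}
    (hK : infoXU (S.PX i) K ≤ R) : S.infoYU i K + (S.dY i + S.dX (S.PX i)) ≤ S.xi R i := by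
  have hb : BddAbove {v | ∃ K : TestChannel X, infoXU (S.PX i) K ≤ R ∧ v = S.infoYU i K} := by
    refine ⟨ent (margY (S.P i)) - (ent (S.P i) - ent (margX (S.P i))), ?_⟩
    rintro _ ⟨K', _, rfl⟩
    exact chanYU_le (hS.mem i) K'
  exact add_le_add_left (le_csSup hb ⟨K, hK, rfl⟩) _

lemma xi_eq_of_optimal {R : ℝ} {i : Fin m} {K : TestChannel X}
    (hK : infoXU (S.PX i) K ≤ R)
    (hopt : ∀ K', infoXU (S.PX i) K' ≤ R → S.infoYU i K' ≤ S.infoYU i K) :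
    S.infoYU i K + (S.dY i + S.dX (S.PX i)) = S.xi R i := by
  rw [xi]
  congr 1
  symm
  refine IsGreatest.csSup_eq ⟨⟨K, hK, rfl⟩, ?_⟩
  rintro _ ⟨K₁, hK₁, rfl⟩
  exact hopt K₁ hK₁

/-- Under separability one kernel serves all sources of a class whose optimum exceeds a given
level. -/
lemma exists_class_kernel (hS : S.Valid) {R : ℝ} (hR : 0 ≤ R) (hsep : S.Separable R) (v : ℝ)
    {s : X → ℝ} (hs : s ∈ Set.range S.PX) : ∃ K : TestChannel X, infoXU s K ≤ R ∧
      ∀ i ∈ S.cls s, v ≤ S.xi R i → v ≤ S.infoYU i K + (S.dY i + S.dX s) := by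
  -- Above H(X) no kernel has rate exactly R, so separability is void; the noiseless channel is then
  -- optimal for every source of the class.
  rcases lt_or_ge (ent s) R with hRs | hRs
  · obtain ⟨i₀, rfl⟩ := hs
    refine ⟨idChannel X, (idChannel_info (hS.mem i₀)).1.trans_le hRs.le, fun i hi hv => ?_⟩
    have hi' : S.PX i = S.PX i₀ := hi
    rw [← hi'] at hRs ⊢
    refine hv.trans (le_of_eq (xi_eq_of_optimal ?_ fun K' _ => ?_).symm)
    · exact (idChannel_info (hS.mem i)).1.trans_le hRs.le
    · exact (chanYU_le (hS.mem i) K').trans (idChannel_info (hS.mem i)).2.ge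
  have hopt : ∀ i ∈ S.cls s, (S.optKernels R s i).Nonempty := by
    rintro i rfl
    obtain ⟨K, hK, hK'⟩ := exists_optimal_channel (hS.mem i) hR hRs
    exact ⟨K, hK, xi_eq_of_optimal hK.le hK'⟩
  obtain ⟨σ, hσ⟩ := hsep s hs
  by_cases hne : (⋂ i ∈ S.cls s, S.optKernels R s i).Nonempty
  · obtain ⟨K, hK⟩ := hne
    simp only [Set.mem_iInter] at hK
    obtain ⟨i₀, hi₀⟩ := hs
    refine ⟨K, (hK i₀ hi₀).1.le, fun i hi hv => hv.trans (hK i hi).2.ge⟩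
  -- No common optimal kernel, so the ordering holds for every source's optimal kernels. A kernel
  -- optimal for the first source in this order with ξ ≥ v works: every other such source comes
  -- later and has at least the same value under it.
  · rw [commonKernels, if_neg hne] at hσ
    by_cases hA : ({a | v ≤ S.xi R (σ a)} : Set _).Nonempty
    · obtain ⟨a, ha, hmin⟩ := wellFounded_lt.has_min {a | v ≤ S.xi R (σ a)} hA
      obtain ⟨K, hK⟩ := hopt (σ a) (σ a).2
      have harr := hσ K (Set.mem_biUnion (σ a).2 hK)
      refine ⟨K, hK.1.le, fun i hi hv => ?_⟩
      obtain ⟨b, hb⟩ := σ.surjective ⟨i, hi⟩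
      have hbi : (σ b : Fin m) = i := by rw [hb]
      have hab : a ≤ b := not_lt.1 (hmin b (by rw [Set.mem_ofPred_eq, hbi]; exact hv))
      have h1 := harr hab
      simp only [hbi] at h1
      have h2 := hK.2
      have h3 : v ≤ S.xi R (σ a) := ha
      linarith
    · obtain ⟨i₀, hi₀⟩ := hs
      obtain ⟨K, hK⟩ := hopt i₀ hi₀
      refine ⟨K, hK.1.le, fun i hi hv => absurd ?_ hA⟩
      obtain ⟨b, hb⟩ := σ.surjective ⟨i, hi⟩
      exact ⟨b, by rw [Set.mem_ofPred_eq, hb]; exact hv⟩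

end Setup

/-! ### Distinguishing the classes -/

/-- Distinct laws have positive divergence, so the likelihood ratio exceeds some e^{nD} > 1 with
probability tending to one. -/
lemma tendsto_mass_not_lt {X : Type*} [Fintype X] {s s' : X → ℝ} (hs : s ∈ stdSimplex ℝ X)
    (hs' : s' ∈ stdSimplex ℝ X) (hne : s ≠ s') :
    Tendsto (fun n : ℕ => mass (iidLaw s n) {x | ¬ iidLaw s' n x < iidLaw s n x})
      atTop (𝓝 0) := by
  have hpos : (0 : EReal) < klD s s' := by
    by_cases hac : AbsCont s s'
    · rw [klD_eq_of_absCont hac]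
      rw [EReal.coe_pos]
      by_contra h
      exact hne (eq_of_gibbs hs.1 hs'.1 hac (by rw [hs.2, hs'.2]) (not_lt.1 h))
    · rw [klD, if_neg hac]; exact EReal.zero_lt_top
  obtain ⟨D, hD0, hD⟩ := EReal.lt_iff_exists_real_btwn.1 hpos
  have hD0' : 0 < D := by exact_mod_cast hD0
  refine squeeze_zero' (Eventually.of_forall fun n => mass_nonneg fun x => iidLaw_nonneg hs.1 x) ?_
    (lrLower_iid hs hs'.1 hD)
  filter_upwards [eventually_gt_atTop 0] with n hn
  refine mass_mono_of_ne_zero (fun x => iidLaw_nonneg hs.1 x) fun x hx h => ?_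
  simp only [Set.mem_ofPred_eq, not_lt, not_le] at h ⊢
  have hx' : 0 < iidLaw s n x := lt_of_le_of_ne (iidLaw_nonneg hs.1 x) (Ne.symm hx)
  refine h.trans_lt ?_
  have : 1 < Real.exp (n * D) := Real.one_lt_exp_iff.2 (by positivity)
  exact lt_mul_of_one_lt_left (hx'.trans_le h) this

/-- The sequences that are more likely under `s` than under all other members of a family. -/
def likelihoodRegion {X : Type*} (F : Set (X → ℝ)) (s : X → ℝ) (n : ℕ) : Set (Fin n → X) :=
  {x | ∀ s' ∈ F, s' ≠ s → iidLaw s' n x < iidLaw s n x}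

/-- Disjointness of the regions is what allows the encoders of different classes to be merged
without conflict. -/
lemma likelihoodRegion_unique {X : Type*} {F : Set (X → ℝ)} {s s' : X → ℝ} (hs : s ∈ F)
    (hs' : s' ∈ F) {n : ℕ} {x : Fin n → X} (hx : x ∈ likelihoodRegion F s n)
    (hx' : x ∈ likelihoodRegion F s' n) : s = s' := by
  by_contra hne
  exact lt_asymm (hx s' hs' (Ne.symm hne)) (hx' s hs hne)

lemma tendsto_mass_likelihoodRegion {X : Type*} [Fintype X] {F : Set (X → ℝ)} (hF : F.Finite)
    (hFs : F ⊆ stdSimplex ℝ X) {s : X → ℝ} (hs : s ∈ F) :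
    Tendsto (fun n => mass (iidLaw s n) (likelihoodRegion F s n)ᶜ) atTop (𝓝 0) := by
  classical
  have : Fintype {s' // s' ∈ F ∧ s' ≠ s} :=
    (hF.subset (fun _ h => h.1 : {s' | s' ∈ F ∧ s' ≠ s} ⊆ F)).fintype
  have hlim : Tendsto (fun n => ∑ s' : {s' // s' ∈ F ∧ s' ≠ s},
      mass (iidLaw s n) {x | ¬ iidLaw s'.1 n x < iidLaw s n x}) atTop (𝓝 0) := by
    simpa using tendsto_finsetSum Finset.univ fun (s' : {s' // s' ∈ F ∧ s' ≠ s}) _ =>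
      tendsto_mass_not_lt (hFs hs) (hFs s'.2.1) (Ne.symm s'.2.2)
  refine squeeze_zero (fun n => mass_nonneg fun x => iidLaw_nonneg (hFs hs).1 x) (fun n => ?_) hlim
  have h0 : ∀ x, 0 ≤ iidLaw s n x := fun x => iidLaw_nonneg (hFs hs).1 x
  refine le_trans (mass_mono h0 fun x hx => ?_) (mass_iUnion_le h0 _)
  simp only [likelihoodRegion, Set.mem_compl_iff, Set.mem_ofPred_eq, not_forall] at hx
  obtain ⟨s', h1, h2, h3⟩ := hx
  exact Set.mem_iUnion.2 ⟨⟨s', h1, h2⟩, h3⟩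

/-! ### Schemes from codes -/

open Classical in
/-- The scheme with message map `f` and acceptance regions `D`. -/
def Scheme.ofRegions {X Y : Type*} {n : ℕ} {Msg : Type*} [Fintype Msg] (f : (Fin n → X) → Msg)
    (D : Msg → Set (Fin n → Y)) : Scheme X Y n where
  size := Fintype.card Msg
  enc x := Fintype.equivFin Msg (f x)
  accept y u := if y ∈ D ((Fintype.equivFin Msg).symm u) then 1 else 0
  mem y u := by split_ifs <;> simp

open Classical in
lemma Scheme.ofRegions_accept {X Y : Type*} {n : ℕ} {Msg : Type*} [Fintype Msg]
    (f : (Fin n → X) → Msg) (D : Msg → Set (Fin n → Y)) (y : Fin n → Y) (x : Fin n → X) :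
    (Scheme.ofRegions f D).accept y ((Scheme.ofRegions f D).enc x) =
      if y ∈ D (f x) then 1 else 0 := by
  simp [Scheme.ofRegions]

namespace Setup

variable {X Y : Type*} [Fintype X] [Fintype Y] {m k r : ℕ} {S : Setup X Y m k r}

lemma typeI_eq (ν : Fin m → ℝ) {n : ℕ} (T : Scheme X Y n) :
    S.typeI ν T = ∑ i, ν i * ∑ t : (Fin n → Y) × (Fin n → X),
      pairLaw (S.P i) n t * (1 - T.accept t.1 (T.enc t.2)) := by
  simp only [typeI, mixture, Finset.sum_mul, Finset.mul_sum, Fintype.sum_prod_type, pairLaw]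
  have : ∀ y : Fin n → Y, ∑ x : Fin n → X, ∑ i, ν i * iidLaw (S.P i) n (fun l => (y l, x l)) *
      (1 - T.accept y (T.enc x)) = ∑ i, ∑ x : Fin n → X,
        ν i * iidLaw (S.P i) n (fun l => (y l, x l)) * (1 - T.accept y (T.enc x)) :=
    fun y => Finset.sum_comm
  simp_rw [this]
  rw [Finset.sum_comm]
  simp_rw [mul_assoc]

/-- The acceptance probability under `Q_{Y_j} × Q_{X_t}`. -/
def accProb (S : Setup X Y m k r) {n : ℕ} (T : Scheme X Y n) (j : Fin k) (t : Fin r) : ℝ :=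
  ∑ y, ∑ x, S.QY j n y * S.QX t n x * T.accept y (T.enc x)

lemma sum_alternative (τ : Fin k → Fin r → ℝ) {n : ℕ} (T : Scheme X Y n) :
    ∑ y, ∑ x, (∑ j, ∑ t, τ j t * (S.QY j n y * S.QX t n x)) * T.accept y (T.enc x) =
      ∑ j, ∑ t, τ j t * S.accProb T j t := by
  simp only [accProb, Finset.sum_mul, Finset.mul_sum]
  simp_rw [Finset.sum_comm (s := (Finset.univ : Finset (Fin n → X)))]
  rw [Finset.sum_comm]
  refine Finset.sum_congr rfl fun j _ => ?_
  rw [Finset.sum_comm]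
  refine Finset.sum_congr rfl fun t _ => ?_
  refine Finset.sum_congr rfl fun x _ => Finset.sum_congr rfl fun y _ => ?_
  ring

/-! ### Achievability -/

lemma Valid.exists_minX (hS : S.Valid) (i : Fin m) :
    (∀ t, CatRel S.cat (S.PX i) (S.QX t)) ∧
      (∀ t, (S.dX (S.PX i) : EReal) ≤ divRate S.cat (S.PX i) (S.QX t)) ∧
      ∃ t, divRate S.cat (S.PX i) (S.QX t) = (S.dX (S.PX i) : EReal) :=
  hS.2.1.exists_min (fun i => margX_mem (hS.mem i)) i

lemma Valid.exists_minY (hS : S.Valid) (i : Fin m) :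
    (∀ j, CatRel S.cat (S.PY i) (S.QY j)) ∧
      (∀ j, (S.dY i : EReal) ≤ divRate S.cat (S.PY i) (S.QY j)) ∧
      ∃ j, divRate S.cat (S.PY i) (S.QY j) = (S.dY i : EReal) :=
  hS.2.2.exists_min (fun i => margY_mem (hS.mem i)) i

lemma accProb_nonneg (hS : S.Valid) (i : Fin m) {n : ℕ} (T : Scheme X Y n) (j : Fin k)
    (t : Fin r) : 0 ≤ S.accProb T j t :=
  Finset.sum_nonneg fun y _ => Finset.sum_nonneg fun x _ => mul_nonneg (mul_nonneg
    (((hS.exists_minY i).1 j).nonneg n y) (((hS.exists_minX i).1 t).nonneg n x)) (T.mem y _).1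

open Classical in
-- The class codes run in parallel. At most one of them encodes a given x, since each is confined to
-- its likelihood region; the message is a class with a word of its code, or failure, whence the +
-- 1. The loss 3δ consists of one δ each for the information density and the two likelihood ratios.
lemma exists_scheme (hS : S.Valid) {ν : Fin m → ℝ} (hν : ∀ i, 0 < ν i) (hν1 : ∑ i, ν i = 1)
    {R : ℝ} (hR : 0 ≤ R) (hsep : S.Separable R) (v : ℝ) {δ : ℝ} (hδ : 0 < δ) :
    ∀ᶠ n : ℕ in atTop, ∃ T : Scheme X Y n,
      S.typeI ν T ≤ ∑ i with S.xi R i < v, ν i + δ ∧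
      (∀ j t, S.accProb T j t ≤
        Nat.card (Set.range S.PX) * (m * Real.exp (-(n * (v - 3 * δ))))) ∧
      T.size = Nat.card (Set.range S.PX) * ⌈Real.exp (n * (R + δ))⌉₊ + 1 := by
  rcases Nat.eq_zero_or_pos m with rfl | hm
  · simp at hν1
  have i₀ : Fin m := ⟨0, hm⟩
  let 𝒮 := Set.range S.PX
  have : Fintype 𝒮 := Fintype.ofFinite _
  choose K hKR hK using fun s : 𝒮 => S.exists_class_kernel hS hR hsep v s.2
  let ι : 𝒮 → Type := fun s => {i : Fin m // i ∈ S.cls s ∧ v ≤ S.xi R i}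
  have hsimp : Set.range S.PX ⊆ stdSimplex ℝ X := by
    rintro _ ⟨i, rfl⟩; exact margX_mem (hS.mem i)
  have hQX : ∀ t n x, 0 ≤ S.QX t n x := fun t => ((hS.exists_minX i₀).1 t).nonneg
  have hQY : ∀ j n y, 0 ≤ S.QY j n y := fun j => ((hS.exists_minY i₀).1 j).nonneg
  have hcode : ∀ s : 𝒮, _ := fun s => exists_class_code (ι := ι s) (hsimp s.2)
    (P := fun i => S.P i.1) (fun i => hS.mem i.1) (fun i => i.2.1) (K s) (hKR s) hQX hQY
    (DX := S.dX s - δ) (fun t => by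
      obtain ⟨i, hi⟩ := s.2
      rw [← hi]
      refine ((hS.exists_minX i).1 t).lrLower (margX_mem (hS.mem i))
        (lt_of_lt_of_le ?_ ((hS.exists_minX i).2.1 t))
      exact EReal.coe_lt_coe_iff.2 (by linarith))
    (DY := fun i => S.dY i.1 - δ) (fun i j => by
      refine ((hS.exists_minY i.1).1 j).lrLower (margY_mem (hS.mem i.1))
        (lt_of_lt_of_le ?_ ((hS.exists_minY i.1).2.1 j))
      exact EReal.coe_lt_coe_iff.2 (by linarith))
    (likelihoodRegion (Set.range S.PX) s)
    (tendsto_mass_likelihoodRegion (Set.finite_range _) hsimp s.2) (E := v - 3 * δ) hδ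
    (fun i => by
      have : v ≤ chanYU (S.P i.1) (K s) + (S.dY i.1 + S.dX s) := hK s i.1 i.2.1 i.2.2
      linarith)
  filter_upwards [eventually_all.2 hcode] with n hn
  generalize ⌈Real.exp (n * (R + δ))⌉₊ = M at hn ⊢
  choose e acc h1 h2 h3 using hn
  let f : (Fin n → X) → Option (𝒮 × Fin M) := fun x =>
    if h : ∃ t : 𝒮 × Fin M, e t.1 x = some t.2 then some h.choose else none
  have hf : ∀ x t, f x = some t → e t.1 x = some t.2 := by
    intro x t h
    by_cases hx : ∃ t : 𝒮 × Fin M, e t.1 x = some t.2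
    · simp only [f, hx, dif_pos, Option.some.injEq] at h
      rw [← h]; exact hx.choose_spec
    · rw [show f x = none from dif_neg hx] at h
      cases h
  have hf' : ∀ x s l, e s x = some l → f x = some (s, l) := by
    intro x s l h
    have hx : ∃ t : 𝒮 × Fin M, e t.1 x = some t.2 := ⟨(s, l), h⟩
    have h4 := hx.choose_spec
    have hs : hx.choose.1 = s := Subtype.ext
      (likelihoodRegion_unique hx.choose.1.2 s.2 (h1 _ _ _ h4) (h1 _ _ _ h))
    rw [hs, h] at h4
    simp only [f, hx, dif_pos, Option.some.injEq]
    exact Prod.ext hs (Option.some.inj h4).symm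
  let D : Option (𝒮 × Fin M) → Set (Fin n → Y) := fun o =>
    match o with
    | none => ∅
    | some t => acc t.1 t.2
  have hD : ∀ x y, y ∈ D (f x) ↔ ∃ s l, e s x = some l ∧ y ∈ acc s l := by
    intro x y
    constructor
    · intro h
      cases hfx : f x with
      | none => rw [hfx] at h; exact absurd h (Set.notMem_empty _)
      | some t => rw [hfx] at h; exact ⟨t.1, t.2, hf x t hfx, h⟩
    · rintro ⟨s, l, h, hy⟩
      rw [hf' x s l h]; exact hy
  refine ⟨Scheme.ofRegions f D, ?_, fun j t => ?_, ?_⟩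
  · rw [typeI_eq]
    simp_rw [Scheme.ofRegions_accept]
    -- Abandoned sources are bounded by the trivial error 1. For the others an error of the merged
    -- scheme is an error of their own class code.
    have hle : ∀ i, ∑ t : (Fin n → Y) × (Fin n → X), pairLaw (S.P i) n t *
        (1 - if t.1 ∈ D (f t.2) then 1 else 0) ≤ if S.xi R i < v then 1 else δ := by
      intro i
      have h0 : ∀ t, 0 ≤ pairLaw (S.P i) n t := fun t => iidLaw_nonneg (hS.mem i).1 _
      have h01 : ∑ t, pairLaw (S.P i) n t = 1 := by
        rw [sum_pair]; exact sum_iidLaw (hS.mem i).2 n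
      split_ifs with hi
      · refine (Finset.sum_le_sum fun t _ => mul_le_of_le_one_right (h0 t) ?_).trans h01.le
        split_ifs <;> simp
      · refine le_trans ?_ (h2 ⟨S.PX i, Set.mem_range_self i⟩ ⟨i, rfl, not_lt.1 hi⟩)
        rw [mass]
        refine Finset.sum_le_sum fun t _ => ?_
        rw [Set.indicator_apply]
        by_cases ht : t.1 ∈ D (f t.2)
        · simp only [ht, if_true, sub_self, mul_zero]
          split_ifs
          exacts [h0 t, le_rfl]
        · rw [if_neg ht, sub_zero, mul_one, if_pos]
          rintro ⟨l, hl, hl'⟩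
          exact ht ((hD _ _).2 ⟨_, l, hl, hl'⟩)
    calc _ ≤ ∑ i, ν i * (if S.xi R i < v then 1 else δ) :=
          Finset.sum_le_sum fun i _ => mul_le_mul_of_nonneg_left (hle i) (hν i).le
      _ ≤ ∑ i, ((if S.xi R i < v then ν i else 0) + ν i * δ) := by
          refine Finset.sum_le_sum fun i _ => ?_
          have := mul_pos (hν i) hδ
          split_ifs <;> simp [this.le]
      _ = _ := by
          rw [Finset.sum_add_distrib, ← Finset.sum_mul, hν1, one_mul, Finset.sum_filter]
  · have hpt : ∀ y x, S.QY j n y * S.QX t n x * (if y ∈ D (f x) then 1 else 0) ≤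
        ∑ s, ∑ l, Set.indicator {x | e s x = some l} (S.QX t n) x *
          Set.indicator (acc s l) (S.QY j n) y := by
      intro y x
      have h0 : ∀ s l, 0 ≤ Set.indicator {x | e s x = some l} (S.QX t n) x *
          Set.indicator (acc s l) (S.QY j n) y := fun s l =>
        mul_nonneg (Set.indicator_nonneg (fun x _ => hQX t n x) x)
          (Set.indicator_nonneg (fun y _ => hQY j n y) y)
      split_ifs with h
      · obtain ⟨s, l, hl, hy⟩ := (hD x y).1 h
        refine le_trans ?_ (Finset.single_le_sum
          (fun s _ => Finset.sum_nonneg fun l _ => h0 s l) (Finset.mem_univ s))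
        refine le_trans ?_ (Finset.single_le_sum (fun l _ => h0 s l) (Finset.mem_univ l))
        rw [Set.indicator_of_mem (by exact hl), Set.indicator_of_mem hy, mul_one, mul_comm]
      · rw [mul_zero]
        exact Finset.sum_nonneg fun s _ => Finset.sum_nonneg fun l _ => h0 s l
    have hacc : S.accProb (Scheme.ofRegions f D) j t ≤
        ∑ s, ∑ l, mass (S.QX t n) {x | e s x = some l} * mass (S.QY j n) (acc s l) := by
      simp only [accProb, Scheme.ofRegions_accept]
      refine (Finset.sum_le_sum fun y _ => Finset.sum_le_sum fun x _ => hpt y x).trans (le_of_eq ?_)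
      simp only [mass, Finset.sum_mul_sum]
      rw [Finset.sum_comm]
      simp_rw [Finset.sum_comm (s := (Finset.univ : Finset (Fin n → Y)))]
      rw [Finset.sum_comm]
      refine Finset.sum_congr rfl fun s _ => ?_
      rw [Finset.sum_comm]
    refine hacc.trans ?_
    calc _ ≤ ∑ _s : 𝒮, (m * Real.exp (-(n * (v - 3 * δ)))) := by
          refine Finset.sum_le_sum fun s _ => (h3 s j t).trans ?_
          refine mul_le_mul_of_nonneg_right ?_ (Real.exp_pos _).le
          have := Fintype.card_subtype_le fun i : Fin m => i ∈ S.cls s ∧ v ≤ S.xi R i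
          rw [Fintype.card_fin] at this
          exact_mod_cast this
      _ = _ := by simp [𝒮, Nat.card_eq_fintype_card]
  · simp [Scheme.ofRegions, 𝒮, Nat.card_eq_fintype_card]

/-- Only the upper bound on the weights is needed, and it costs the subexponential factor Γ k r. -/
lemma typeII_le (hΓ : ∀ j t n, ∀ T : Scheme X Y n, 0 ≤ S.accProb T j t) {γ Γ : ℝ} {n : ℕ}
    (T : Scheme X Y n) {b : ℝ} (hΓ0 : 0 ≤ Γ) (hb : ∀ j t, S.accProb T j t ≤ b) :
    S.typeII γ Γ T ≤ ENNReal.ofReal (Γ * (k * (r * b))) := by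
  refine iSup₂_le ?_
  rintro _ ⟨τ, hτ, rfl⟩
  refine ENNReal.ofReal_le_ofReal ?_
  rw [sum_alternative]
  calc _ ≤ ∑ _j : Fin k, ∑ _t : Fin r, Γ * b := Finset.sum_le_sum fun j _ =>
        Finset.sum_le_sum fun t _ => mul_le_mul (hτ.1 j t).2 (hb j t) (hΓ j t n T) hΓ0
    _ = _ := by simp; ring

end Setup

/-- A diagonal argument: objects that are good up to any fixed tolerance, for large `n`, can be
chosen with tolerance tending to zero. -/
lemma exists_diagonal {α : ℕ → Type*} [∀ n, Nonempty (α n)] {p : (n : ℕ) → ℝ → α n → Prop}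
    (hmono : ∀ n d d' a, d ≤ d' → p n d a → p n d' a)
    (h : ∀ d > 0, ∀ᶠ n in atTop, ∃ a, p n d a) :
    ∃ a : (n : ℕ) → α n, ∀ d > 0, ∀ᶠ n in atTop, p n d (a n) := by
  classical
  -- At blocklength n the finest tolerance 1/(l + 1) with l ≤ n that can be met is used. For each L,
  -- eventually κ n ≥ L.
  let κ : ℕ → ℕ := fun n => Nat.findGreatest (fun l => ∃ a, p n (1 / ((l : ℝ) + 1)) a) n
  refine ⟨fun n => if hn : ∃ a, p n (1 / ((κ n : ℝ) + 1)) a then hn.choose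
    else Classical.arbitrary _, fun d hd => ?_⟩
  obtain ⟨L, hL⟩ := exists_nat_one_div_lt hd
  filter_upwards [h _ (Nat.one_div_pos_of_nat (n := L) (α := ℝ)), eventually_ge_atTop L]
    with n hn hnL
  have h1 : ∃ a, p n (1 / ((κ n : ℝ) + 1)) a :=
    Nat.findGreatest_spec (P := fun l => ∃ a, p n (1 / ((l : ℝ) + 1)) a) hnL hn
  have h2 : L ≤ κ n := Nat.le_findGreatest hnL hn
  simp only [h1, dif_pos]
  refine hmono _ _ _ _ ?_ h1.choose_spec
  refine le_trans ?_ hL.le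
  exact one_div_le_one_div_of_le (by positivity) (by exact_mod_cast Nat.succ_le_succ h2)

/-! ### Achievability with vanishing tolerance. -/

namespace Setup

variable {X Y : Type*} [Fintype X] [Fintype Y] {m k r : ℕ} {S : Setup X Y m k r}

lemma eventually_mul_le_exp {Γ : ℕ → ℝ} (hΓ1 : ∀ n, 1 ≤ Γ n)
    (hΓ : Tendsto (fun n : ℕ => Real.log (Γ n) / n) atTop (𝓝 0)) (C : ℝ) {δ : ℝ} (hδ : 0 < δ) :
    ∀ᶠ n : ℕ in atTop, Γ n * C ≤ Real.exp (n * δ) := by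
  have h2 : Tendsto (fun n : ℕ => Real.exp (n * (δ / 2))) atTop atTop :=
    Real.tendsto_exp_atTop.comp (tendsto_natCast_atTop_atTop.atTop_mul_const (by positivity))
  filter_upwards [hΓ.eventually_lt_const (half_pos hδ), h2.eventually_ge_atTop C,
    eventually_gt_atTop 0] with n hn1 hn2 hn0
  have hn0' : (0 : ℝ) < n := by exact_mod_cast hn0
  rw [div_lt_iff₀ hn0'] at hn1
  have hΓpos : 0 < Γ n := zero_lt_one.trans_le (hΓ1 n)
  have h3 : Γ n ≤ Real.exp (n * (δ / 2)) := by
    rw [← Real.log_le_iff_le_exp hΓpos]; linarith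
  calc Γ n * C ≤ Γ n * Real.exp (n * (δ / 2)) := mul_le_mul_of_nonneg_left hn2 hΓpos.le
    _ ≤ Real.exp (n * (δ / 2)) * Real.exp (n * (δ / 2)) :=
        mul_le_mul_of_nonneg_right h3 (Real.exp_pos _).le
    _ = _ := by rw [← Real.exp_add]; ring_nf

lemma le_log_inv_div {β : ℝ≥0∞} {n : ℕ} (hn : 0 < n) {c : ℝ}
    (h : β ≤ ENNReal.ofReal (Real.exp (-(n * c)))) :
    (c : EReal) ≤ ENNReal.log β⁻¹ / (n : EReal) := by
  rw [EReal.le_div_iff_mul_le (by exact_mod_cast hn) (EReal.natCast_ne_top n), ENNReal.log_inv]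
  have h1 := ENNReal.log_le_log h
  rw [ENNReal.log_ofReal_of_pos (Real.exp_pos _), Real.log_exp] at h1
  have h2 := EReal.neg_le_neg_iff.2 h1
  refine le_trans (le_of_eq ?_) h2
  rw [← EReal.coe_neg, neg_neg, mul_comm]
  norm_cast

open Classical in
-- Schemes with slack d in error, exponent and rate exist for every d > 0 and large n;
-- diagonalisation lets d tend to zero and reaches ε, v and R exactly.
theorem achievable_of_sum_le (hS : S.Valid) {ν : Fin m → ℝ} (hν : ∀ i, 0 < ν i)
    (hν1 : ∑ i, ν i = 1) {γ : ℝ} {Γ : ℕ → ℝ} (hΓ1 : ∀ n, 1 ≤ Γ n)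
    (hΓ : Tendsto (fun n : ℕ => Real.log (Γ n) / n) atTop (𝓝 0))
    {R : ℝ} (hR : 0 ≤ R) (hsep : S.Separable R) {v ε : ℝ}
    (hε : ∑ i with S.xi R i < v, ν i ≤ ε) : S.Achievable ν γ Γ ε R v := by
  have hm : 0 < m := by
    rcases Nat.eq_zero_or_pos m with rfl | hm
    · simp at hν1
    · exact hm
  have hacc : ∀ j t n, ∀ T : Scheme X Y n, 0 ≤ S.accProb T j t := fun j t n T =>
    accProb_nonneg hS ⟨0, hm⟩ T j t
  have hne : ∀ n, Nonempty (Scheme X Y n) := fun n =>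
    ⟨⟨1, fun _ => 0, fun _ _ => 0, fun _ _ => by simp⟩⟩
  obtain ⟨T, hT⟩ := exists_diagonal (α := fun n => Scheme X Y n)
    (p := fun n d T => S.typeI ν T ≤ ε + d ∧
      S.typeII γ (Γ n) T ≤ ENNReal.ofReal (Real.exp (-(n * (v - d)))) ∧
      Real.log T.size ≤ n * (R + d))
    (by
      rintro n d d' T hd ⟨h1, h2, h3⟩
      refine ⟨h1.trans (by linarith), h2.trans (ENNReal.ofReal_le_ofReal ?_), h3.trans ?_⟩
      · rw [Real.exp_le_exp]
        have := mul_le_mul_of_nonneg_left hd (Nat.cast_nonneg (α := ℝ) n)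
        linarith
      · exact mul_le_mul_of_nonneg_left (by linarith) (Nat.cast_nonneg n))
    (by
      intro d hd
      set N : ℝ := (Nat.card (Set.range S.PX) : ℝ) with hN
      -- Three quarters of d are lost in the code exponent, and the last quarter absorbs Γ(n) and
      -- the constants.
      filter_upwards [S.exists_scheme hS hν hν1 hR hsep v (δ := d / 4) (by positivity),
        eventually_mul_le_exp hΓ1 hΓ (k * (r * (N * m))) (δ := d / 4) (by positivity),
        eventually_mul_le_exp hΓ1 hΓ (2 * N + 1) (δ := d / 4) (by positivity)]
        with n ⟨T, h1, h2, h3⟩ hn1 hn2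
      refine ⟨T, by linarith, ?_, ?_⟩
      · refine (typeII_le hacc T (zero_le_one.trans (hΓ1 n)) h2).trans
          (ENNReal.ofReal_le_ofReal ?_)
        calc _ = Γ n * (k * (r * (N * m))) * Real.exp (-(n * (v - 3 * (d / 4)))) := by
              rw [hN]; ring
          _ ≤ Real.exp (n * (d / 4)) * Real.exp (-(n * (v - 3 * (d / 4)))) :=
              mul_le_mul_of_nonneg_right hn1 (Real.exp_pos _).le
          _ = _ := by rw [← Real.exp_add]; ring_nf
      · have hexp : 1 ≤ Real.exp (n * (R + d / 4)) := Real.one_le_exp (by positivity)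
        have h4 : (T.size : ℝ) ≤ Real.exp (n * (R + d)) := by
          rw [h3]; push_cast
          have h5 := (Nat.ceil_lt_add_one (Real.exp_pos (n * (R + d / 4))).le).le
          have hN0 : 0 ≤ N := by positivity
          have h6 : 2 * N + 1 ≤ Γ n * (2 * N + 1) := le_mul_of_one_le_left (by positivity) (hΓ1 n)
          calc _ ≤ N * (2 * Real.exp (n * (R + d / 4))) + Real.exp (n * (R + d / 4)) :=
                add_le_add (mul_le_mul_of_nonneg_left (by linarith) hN0) hexp
            _ = (2 * N + 1) * Real.exp (n * (R + d / 4)) := by ring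
            _ ≤ Real.exp (n * (d / 4)) * Real.exp (n * (R + d / 4)) :=
                mul_le_mul_of_nonneg_right (h6.trans hn2) (Real.exp_pos _).le
            _ ≤ _ := by
                rw [← Real.exp_add, Real.exp_le_exp]
                have : (0 : ℝ) ≤ n * d := by positivity
                nlinarith
        have hpos : (0 : ℝ) < T.size := by rw [h3]; positivity
        rwa [Real.log_le_iff_le_exp hpos])
  refine ⟨T, ?_, ?_, ?_⟩
  · refine le_of_forall_gt_imp_ge_of_dense fun a ha => ?_
    obtain ⟨c, hc1, hc2⟩ := EReal.lt_iff_exists_real_btwn.1 ha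
    rw [EReal.coe_lt_coe_iff] at hc1
    refine le_trans (limsup_le_of_le (h := ?_)) hc2.le
    filter_upwards [hT (c - ε) (by linarith)] with n hn
    exact EReal.coe_le_coe_iff.2 (hn.1.trans (by linarith))
  · refine le_of_forall_lt_imp_le_of_dense fun a ha => ?_
    obtain ⟨c, hc1, hc2⟩ := EReal.lt_iff_exists_real_btwn.1 ha
    rw [EReal.coe_lt_coe_iff] at hc2
    refine le_trans hc1.le (le_liminf_of_le (h := ?_))
    filter_upwards [hT (v - c) (by linarith), eventually_gt_atTop 0] with n hn hn0
    refine le_log_inv_div hn0 (hn.2.1.trans (le_of_eq ?_))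
    congr 2; ring
  · refine le_of_forall_gt_imp_ge_of_dense fun a ha => ?_
    obtain ⟨c, hc1, hc2⟩ := EReal.lt_iff_exists_real_btwn.1 ha
    rw [EReal.coe_lt_coe_iff] at hc1
    refine le_trans (limsup_le_of_le (h := ?_)) hc2.le
    filter_upwards [hT (c - R) (by linarith), eventually_gt_atTop 0] with n hn hn0
    rw [EReal.coe_le_coe_iff, div_le_iff₀ (by exact_mod_cast hn0)]
    exact hn.2.2.trans (by ring_nf; exact le_rfl)

end Setup

/-! ### Entropies of random variables on a finite probability space -/

open Classical in
/-- The law of the random variable `f`. -/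
def push {Ω A : Type*} [Fintype Ω] (p : Ω → ℝ) (f : Ω → A) (a : A) : ℝ :=
  ∑ ω, if f ω = a then p ω else 0

/-- The entropy of the random variable `f`. -/
def rvEnt {Ω A : Type*} [Fintype Ω] [Fintype A] (p : Ω → ℝ) (f : Ω → A) : ℝ := ent (push p f)

section RV

variable {Ω A B C : Type*} [Fintype Ω] {p : Ω → ℝ}

lemma push_nonneg (hp : ∀ ω, 0 ≤ p ω) (f : Ω → A) (a : A) : 0 ≤ push p f a :=
  Finset.sum_nonneg fun ω _ => by split_ifs; exacts [hp ω, le_rfl]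

lemma le_push (hp : ∀ ω, 0 ≤ p ω) (f : Ω → A) (ω : Ω) : p ω ≤ push p f (f ω) := by
  classical
  refine le_trans (le_of_eq ?_) (Finset.single_le_sum
    (f := fun ω' => if f ω' = f ω then p ω' else 0)
    (fun ω' _ => by split_ifs; exacts [hp ω', le_rfl]) (Finset.mem_univ ω))
  simp

lemma exists_of_push_ne_zero {f : Ω → A} {a : A} (h : push p f a ≠ 0) :
    ∃ ω, p ω ≠ 0 ∧ f ω = a := by
  obtain ⟨ω, _, hω⟩ := Finset.exists_ne_zero_of_sum_ne_zero h
  by_cases hf : f ω = a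
  · exact ⟨ω, by simpa [hf] using hω, hf⟩
  · simp [hf] at hω

lemma sum_push_mul [Fintype A] (f : Ω → A) (g : A → ℝ) :
    ∑ a, push p f a * g a = ∑ ω, p ω * g (f ω) := by
  classical
  simp only [push, Finset.sum_mul]
  rw [Finset.sum_comm]
  refine Finset.sum_congr rfl fun ω _ => ?_
  rw [Finset.sum_eq_single (f ω)]
  · simp
  · intro a _ ha; simp [Ne.symm ha]
  · simp

lemma push_mem [Fintype A] (hp : p ∈ stdSimplex ℝ Ω) (f : Ω → A) : push p f ∈ stdSimplex ℝ A :=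
  ⟨push_nonneg hp.1 f, by simpa [hp.2] using sum_push_mul (p := p) f fun _ => 1⟩

lemma push_push [Fintype A] (f : Ω → A) (g : A → B) (b : B) :
    push (push p f) g b = push p (fun ω => g (f ω)) b := by
  classical
  have := sum_push_mul (p := p) f fun a => if g a = b then 1 else 0
  simpa [push] using this

lemma sum_push_pair_right [Fintype B] (f : Ω → A) (g : Ω → B) (a : A) :
    ∑ b, push p (fun ω => (f ω, g ω)) (a, b) = push p f a := by
  classical
  simp only [push]
  rw [Finset.sum_comm]
  refine Finset.sum_congr rfl fun ω _ => ?_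
  by_cases h : f ω = a <;> simp [h]

lemma sum_push_pair_left [Fintype A] (f : Ω → A) (g : Ω → B) (b : B) :
    ∑ a, push p (fun ω => (f ω, g ω)) (a, b) = push p g b := by
  classical
  simp only [push]
  rw [Finset.sum_comm]
  refine Finset.sum_congr rfl fun ω _ => ?_
  by_cases h : g ω = b <;> simp [h]

lemma rvEnt_eq [Fintype A] (f : Ω → A) :
    rvEnt p f = -∑ ω, p ω * Real.log (push p f (f ω)) := by
  rw [rvEnt, ent_eq, sum_push_mul f fun a => Real.log (push p f a)]

lemma rvEnt_self (p : Ω → ℝ) : rvEnt p (fun ω => ω) = ent p := by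
  rw [rvEnt]
  congr 1
  funext ω
  exact (Finset.sum_eq_single ω (fun x _ hx => if_neg hx) (by simp)).trans (if_pos rfl)

/-- Random variables that determine each other have the same entropy. -/
lemma rvEnt_congr [Fintype A] [Fintype B] {f : Ω → A} {g : Ω → B}
    (h : ∀ ω ω', f ω = f ω' ↔ g ω = g ω') : rvEnt p f = rvEnt p g := by
  rw [rvEnt_eq, rvEnt_eq]
  congr 1
  refine Finset.sum_congr rfl fun ω _ => ?_
  congr 2
  simp only [push]
  exact Finset.sum_congr rfl fun ω' _ => by
    classical exact if_congr (h ω' ω) rfl rfl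

lemma rvEnt_strong_subadditive [Fintype A] [Fintype B] [Fintype C] (hp : ∀ ω, 0 ≤ p ω)
    (f : Ω → A) (g : Ω → B) (h : Ω → C) :
    rvEnt p (fun ω => (f ω, g ω, h ω)) + rvEnt p h ≤
      rvEnt p (fun ω => (f ω, h ω)) + rvEnt p (fun ω => (g ω, h ω)) := by
  have key := ent_strong_subadditive (push_nonneg hp fun ω => (f ω, g ω, h ω))
  have e1 : ∀ t : B × C, ∑ a, push p (fun ω => (f ω, g ω, h ω)) (a, t) =
      push p (fun ω => (g ω, h ω)) t := fun t => sum_push_pair_left f (fun ω => (g ω, h ω)) t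
  have e2 : ∀ a c, ∑ b, push p (fun ω => (f ω, g ω, h ω)) (a, b, c) =
      push p (fun ω => (f ω, h ω)) (a, c) := by
    intro a c
    classical
    simp only [push]
    rw [Finset.sum_comm]
    refine Finset.sum_congr rfl fun ω _ => ?_
    by_cases h1 : f ω = a <;> by_cases h2 : h ω = c <;> simp [h1, h2]
  have e3 : ∀ c, ∑ a, ∑ b, push p (fun ω => (f ω, g ω, h ω)) (a, b, c) = push p h c := by
    intro c
    simp_rw [e2]
    exact sum_push_pair_left f h c
  simp only [e3] at key
  simp only [e1, e2] at key
  exact key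

variable {X Y V : Type*} [Fintype X] [Fintype Y] [Fintype V]

/-- The point of the entropy region of a pair `Z = (Y, X)` observed with `V`. -/
def rvPoint (p : Ω → ℝ) (v : Ω → V) (z : Ω → Y × X) : (Y × X → ℝ) × ℝ × ℝ × ℝ :=
  (push p z, rvEnt p (fun ω => (v ω, (z ω).2)) - rvEnt p v,
    rvEnt p (fun ω => (v ω, (z ω).1)) - rvEnt p v, rvEnt p (fun ω => (v ω, z ω)) - rvEnt p v)

lemma rvPoint_mem (hp : p ∈ stdSimplex ℝ Ω) (v : Ω → V) (z : Ω → Y × X) :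
    rvPoint p v z ∈ entRegion X Y := by
  classical
  convert jointPoint_mem (push_mem hp fun ω => (v ω, z ω)) using 1
  have e1 : ∀ t, ∑ a, push p (fun ω => (v ω, z ω)) (a, t) = push p z t :=
    fun t => sum_push_pair_left v z t
  have e2 : ∀ a, ∑ t, push p (fun ω => (v ω, z ω)) (a, t) = push p v a :=
    fun a => sum_push_pair_right v z a
  have e3 : ∀ t : V × X, ∑ y, push p (fun ω => (v ω, z ω)) (t.1, y, t.2) =
      push p (fun ω => (v ω, (z ω).2)) t := by
    intro t
    simp only [push]
    rw [Finset.sum_comm]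
    refine Finset.sum_congr rfl fun ω _ => ?_
    by_cases h1 : v ω = t.1 <;> by_cases h2 : (z ω).2 = t.2 <;> simp [h1, h2, Prod.ext_iff]
  have e4 : ∀ t : V × Y, ∑ x, push p (fun ω => (v ω, z ω)) (t.1, t.2, x) =
      push p (fun ω => (v ω, (z ω).1)) t := by
    intro t
    simp only [push]
    rw [Finset.sum_comm]
    refine Finset.sum_congr rfl fun ω _ => ?_
    by_cases h1 : v ω = t.1 <;> by_cases h2 : (z ω).1 = t.2 <;> simp [h1, h2, Prod.ext_iff]
  simp only [jointPoint, rvPoint, e1, e2, e3, e4, rvEnt]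

end RV

/-! ### Single-letter bounds -/

section Letters

variable {A B U : Type*} {n : ℕ}

/-- The first `l` letters of a sequence, after the letterwise map `π`. -/
def prefixMap (π : A → B) (l : ℕ) (ω : Fin n → A) : Fin n → Option B :=
  fun j => if (j : ℕ) < l then some (π (ω j)) else none

lemma prefixMap_eq_iff (π : A → B) (l : ℕ) (ω ω' : Fin n → A) :
    prefixMap π l ω = prefixMap π l ω' ↔ ∀ j : Fin n, (j : ℕ) < l → π (ω j) = π (ω' j) := by
  simp only [funext_iff, prefixMap]
  refine forall_congr' fun j => ?_
  by_cases h : (j : ℕ) < l <;> simp [h]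

lemma forall_lt_succ_iff {q : Fin n → Prop} (l : Fin n) :
    (∀ j : Fin n, (j : ℕ) < l + 1 → q j) ↔ q l ∧ ∀ j : Fin n, (j : ℕ) < l → q j := by
  constructor
  · exact fun h => ⟨h l (Nat.lt_succ_self _), fun j hj => h j (Nat.lt_succ_of_lt hj)⟩
  · rintro ⟨h1, h2⟩ j hj
    rcases Nat.lt_succ_iff_lt_or_eq.1 hj with h | h
    · exact h2 j h
    · exact (Fin.ext h : j = l) ▸ h1

/-- The side information for the `l`-th letter. -/
def sideInfo (u : (Fin n → A) → U) (l : ℕ) (ω : Fin n → A) : U × (Fin n → Option A) :=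
  (u ω, prefixMap id l ω)

lemma log_iidLaw {q : A → ℝ} {ω : Fin n → A} (h : ∀ l, q (ω l) ≠ 0) :
    Real.log (iidLaw q n ω) = ∑ l, Real.log (q (ω l)) :=
  Real.log_prod fun l _ => h l

variable [Fintype A] [Fintype B] [Fintype U] {p : (Fin n → A) → ℝ}

/-- The chain rule for the image letters conditions on the image prefix. Conditioning on the prefix
of full letters, which determines it, can only lower each term. -/
lemma sum_condEnt_le (hp : ∀ ω, 0 ≤ p ω) (u : (Fin n → A) → U) (π : A → B) :
    ∑ l : Fin n, (rvEnt p (fun ω => (sideInfo u l ω, π (ω l))) - rvEnt p (sideInfo u l)) ≤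
      rvEnt p (fun ω => (u ω, fun j => π (ω j))) - rvEnt p u := by
  let h : ℕ → ℝ := fun l => rvEnt p fun ω => (u ω, prefixMap π l ω)
  have hstep : ∀ l : Fin n, rvEnt p (fun ω => (sideInfo u l ω, π (ω l))) -
      rvEnt p (sideInfo u l) ≤ h (l + 1) - h l := by
    intro l
    -- Strong subadditivity here says that adding the full prefix to the condition reduces the
    -- entropy of the l-th image letter.
    have key := rvEnt_strong_subadditive hp (fun ω => π (ω l)) (prefixMap (id : A → A) l)
      (fun ω => (u ω, prefixMap π l ω))
    have e1 : rvEnt p (fun ω => (π (ω l), prefixMap (id : A → A) l ω, u ω, prefixMap π l ω)) =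
        rvEnt p (fun ω => (sideInfo u l ω, π (ω l))) := by
      refine rvEnt_congr fun ω ω' => ?_
      simp only [sideInfo, Prod.mk.injEq, prefixMap_eq_iff, id]
      constructor
      · rintro ⟨h1, h2, h3, h4⟩; exact ⟨⟨h3, h2⟩, h1⟩
      · rintro ⟨⟨h3, h2⟩, h1⟩; exact ⟨h1, h2, h3, fun j hj => by rw [h2 j hj]⟩
    have e2 : rvEnt p (fun ω => (prefixMap (id : A → A) l ω, u ω, prefixMap π l ω)) =
        rvEnt p (sideInfo u l) := by
      refine rvEnt_congr fun ω ω' => ?_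
      simp only [sideInfo, Prod.mk.injEq, prefixMap_eq_iff, id]
      constructor
      · rintro ⟨h2, h3, h4⟩; exact ⟨h3, h2⟩
      · rintro ⟨h3, h2⟩; exact ⟨h2, h3, fun j hj => by rw [h2 j hj]⟩
    have e3 : rvEnt p (fun ω => (π (ω l), u ω, prefixMap π l ω)) = h (l + 1) := by
      refine rvEnt_congr fun ω ω' => ?_
      simp only [Prod.mk.injEq, prefixMap_eq_iff, forall_lt_succ_iff]
      tauto
    rw [e1, e2, e3] at key
    simp only [h] at key ⊢
    linarith
  have h0 : h 0 = rvEnt p u := by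
    refine rvEnt_congr fun ω ω' => ?_
    simp [prefixMap_eq_iff]
  have hn : h n = rvEnt p (fun ω => (u ω, fun j => π (ω j))) := by
    refine rvEnt_congr fun ω ω' => ?_
    simp only [Prod.mk.injEq, prefixMap_eq_iff, Fin.is_lt, forall_true_left]
    rw [funext_iff]
  refine (Finset.sum_le_sum fun l _ => hstep l).trans (le_of_eq ?_)
  rw [Fin.sum_univ_eq_sum_range (fun l => h (l + 1) - h l) n, Finset.sum_range_sub, h0, hn]

/-- With the full letters themselves the chain rule is exact; using the same side information in
both sums lets one auxiliary variable serve X, Y and the pair. -/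
lemma sum_condEnt_eq (u : (Fin n → A) → U) :
    ∑ l : Fin n, (rvEnt p (fun ω => (sideInfo u l ω, ω l)) - rvEnt p (sideInfo u l)) =
      ent p - rvEnt p u := by
  let h : ℕ → ℝ := fun l => rvEnt p (sideInfo u l)
  have hstep : ∀ l : Fin n, rvEnt p (fun ω => (sideInfo u l ω, ω l)) = h (l + 1) := by
    intro l
    refine rvEnt_congr fun ω ω' => ?_
    simp only [sideInfo, Prod.mk.injEq, prefixMap_eq_iff, forall_lt_succ_iff, id]
    tauto
  have h0 : h 0 = rvEnt p u := by
    refine rvEnt_congr fun ω ω' => ?_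
    simp [sideInfo, prefixMap_eq_iff]
  have hn : h n = ent p := by
    rw [← rvEnt_self]
    refine rvEnt_congr fun ω ω' => ?_
    simp only [sideInfo, Prod.mk.injEq, prefixMap_eq_iff, id, Fin.is_lt, forall_true_left]
    constructor
    · rintro ⟨_, h⟩; exact funext h
    · rintro rfl; simp
  simp only [hstep]
  change ∑ l : Fin n, (h (l + 1) - h l) = _
  rw [Fin.sum_univ_eq_sum_range (fun l => h (l + 1) - h l) n, Finset.sum_range_sub, h0, hn]

/-- The average law of a letter. -/
def avgLaw (p : (Fin n → A) → ℝ) (a : A) : ℝ := (n : ℝ)⁻¹ * ∑ l, push p (fun ω => ω l) a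

lemma sum_letters (hn : 0 < n) (g : A → ℝ) :
    ∑ ω, p ω * ∑ l, g (ω l) = n * ∑ a, avgLaw p a * g a := by
  have hn' : (n : ℝ) ≠ 0 := by positivity
  have : ∑ a, avgLaw p a * g a = (n : ℝ)⁻¹ * ∑ l, ∑ a, push p (fun ω => ω l) a * g a := by
    simp only [avgLaw, Finset.mul_sum, Finset.sum_mul]
    rw [Finset.sum_comm]
    exact Finset.sum_congr rfl fun l _ => Finset.sum_congr rfl fun a _ => by ring
  rw [this, mul_inv_cancel_left₀ hn']
  simp_rw [sum_push_mul, Finset.mul_sum]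
  rw [Finset.sum_comm]

lemma avgLaw_mem (hn : 0 < n) (hp : p ∈ stdSimplex ℝ (Fin n → A)) :
    avgLaw p ∈ stdSimplex ℝ A := by
  have hn' : (n : ℝ) ≠ 0 := by positivity
  refine ⟨fun a => mul_nonneg (by positivity) (Finset.sum_nonneg fun l _ => push_nonneg hp.1 _ a),
    ?_⟩
  have := sum_letters (p := p) hn fun _ => 1
  simp only [Finset.sum_const, Finset.card_univ, Fintype.card_fin, nsmul_eq_mul, mul_one,
    ← Finset.sum_mul, hp.2, one_mul] at this
  field_simp at this
  exact this.symm

lemma avgLaw_ne_zero (hn : 0 < n) (hp : ∀ ω, 0 ≤ p ω) {ω : Fin n → A} (hω : p ω ≠ 0)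
    (l : Fin n) : avgLaw p (ω l) ≠ 0 := by
  have h1 : 0 < push p (fun ω => ω l) (ω l) :=
    (lt_of_le_of_ne (hp ω) (Ne.symm hω)).trans_le (le_push hp (fun ω => ω l) ω)
  have : 0 < ∑ l', push p (fun ω => ω l') (ω l) :=
    Finset.sum_pos' (fun l' _ => push_nonneg hp _ _) ⟨l, Finset.mem_univ _, h1⟩
  exact (mul_pos (by positivity) this).ne'

/-- The entropy of a sequence of letters is at most the single-letter cross entropy. -/
lemma rvEnt_letters_le (hn : 0 < n) (hp : p ∈ stdSimplex ℝ (Fin n → A)) (π : A → B) {q : B → ℝ}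
    (hq : q ∈ stdSimplex ℝ B) (hpq : ∀ ω, p ω ≠ 0 → ∀ l, q (π (ω l)) ≠ 0) :
    rvEnt p (fun ω j => π (ω j)) ≤ n * -∑ a, avgLaw p a * Real.log (q (π a)) := by
  have hmem := push_mem hp fun ω j => π (ω j)
  have hq' := iidLaw_mem hq n
  refine (ent_le_cross hmem.1 hq'.1 ?_ (by rw [hmem.2, hq'.2])).trans (le_of_eq ?_)
  · intro b hb
    by_contra h
    obtain ⟨ω, hω, rfl⟩ := exists_of_push_ne_zero h
    exact iidLaw_ne_zero.2 (hpq ω hω) hb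
  · rw [sum_push_mul, mul_neg, ← sum_letters hn]
    congr 1
    refine Finset.sum_congr rfl fun ω _ => ?_
    by_cases h : p ω = 0
    · simp [h]
    · rw [log_iidLaw (hpq ω h)]

end Letters

/-! ### The change of measure argument -/

section Change

variable {X Y : Type*} [Fintype X] [Fintype Y] {P : Y × X → ℝ}

lemma entRegion_fst_mem {z : (Y × X → ℝ) × ℝ × ℝ × ℝ} (hz : z ∈ entRegion X Y) :
    z.1 ∈ stdSimplex ℝ (Y × X) := by
  obtain ⟨V, _, J, hJ, rfl⟩ := exists_jointPoint_eq hz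
  refine ⟨fun t => Finset.sum_nonneg fun _ _ => hJ.1 _, ?_⟩
  change ∑ t, ∑ v, J (v, t) = 1
  rw [Finset.sum_comm, ← hJ.2, Fintype.sum_prod_type]

lemma push_iidLaw_snd (P : Y × X → ℝ) (n : ℕ) :
    push (iidLaw P n) (fun ω j => (ω j).2) = iidLaw (margX P) n := by
  classical
  funext x
  have h := sum_pairLaw_left P n x
  have h2 := sum_pair (n := n) (A := Y) (B := X) fun t => if t.2 = x then pairLaw P n t else 0
  rw [Fintype.sum_prod_type] at h2
  simp only [Finset.sum_ite_eq', Finset.mem_univ, if_true] at h2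
  rw [h] at h2
  unfold margX
  rw [h2]
  refine Finset.sum_congr rfl fun ω _ => ?_
  by_cases hω : (fun j => (ω j).2) = x
  · rw [if_pos hω, if_pos hω]; rfl
  · rw [if_neg hω, if_neg hω]

lemma marg_ne_zero (hP : ∀ t, 0 ≤ P t) {t : Y × X} (ht : P t ≠ 0) :
    margX P t.2 ≠ 0 ∧ margY P t.1 ≠ 0 := by
  have h : 0 < P t := lt_of_le_of_ne (hP t) (Ne.symm ht)
  exact ⟨(Finset.sum_pos' (fun y _ => hP (y, t.2)) ⟨t.1, Finset.mem_univ _, h⟩).ne',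
    (Finset.sum_pos' (fun x _ => hP (t.1, x)) ⟨t.2, Finset.mem_univ _, h⟩).ne'⟩

/-- A lower bound on the mass of an event under a product law, in terms of a law supported on
it. -/
lemma log_mass_ge {A : Type*} [Fintype A] {a b : A → ℝ} (ha : a ∈ stdSimplex ℝ A)
    (hb : ∀ t, 0 ≤ b t) (hab : AbsCont a b) :
    ent a + ∑ t, a t * Real.log (b t) ≤ Real.log (∑ t, b t) := by
  have hpos : 0 < ∑ t, b t := by
    obtain ⟨t, _, ht⟩ := Finset.exists_ne_zero_of_sum_ne_zero (ha.2.trans_ne one_ne_zero)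
    exact Finset.sum_pos' (fun t _ => hb t)
      ⟨t, Finset.mem_univ _, lt_of_le_of_ne (hb t) fun h => ht (hab t h.symm)⟩
  -- The bound is the cross-entropy inequality against b normalised by Q.
  set Q := ∑ t, b t
  have := ent_le_cross (q := fun t => b t / Q) ha.1 (fun t => div_nonneg (hb t) hpos.le)
    (fun t ht => hab t ((div_eq_zero_iff.1 ht).resolve_right hpos.ne'))
    (by rw [← Finset.sum_div, ha.2, div_self hpos.ne'])
  have e : ∑ t, a t * Real.log (b t / Q) = ∑ t, a t * Real.log (b t) - Real.log Q := by
    rw [eq_sub_iff_add_eq, ← one_mul (Real.log Q), ← ha.2, Finset.sum_mul,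
      ← Finset.sum_add_distrib]
    refine Finset.sum_congr rfl fun t _ => ?_
    by_cases h : a t = 0
    · simp [h]
    · rw [Real.log_div (fun h' => h (hab t h')) hpos.ne']; ring
  rw [e] at this
  linarith

/-- The multi-letter converse: an event that depends on `X^n` through a message and has mass at
least `η` under `P^n` yields a point of the entropy region. -/
lemma exists_converse_point (hP : P ∈ stdSimplex ℝ (Y × X)) {n : ℕ} (hn : 0 < n) {U : Type*}
    [Fintype U] (φ : (Fin n → X) → U) (D : Set ((Fin n → Y) × U)) {η : ℝ} (hη : 0 < η)
    (hA : η ≤ mass (pairLaw P n) {t | (t.1, φ t.2) ∈ D}) :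
    ∃ z ∈ entRegion X Y, AbsCont z.1 P ∧
      -∑ t, z.1 t * Real.log (P t) + Real.log η / n ≤ ent z.1 ∧
      -∑ t, z.1 t * Real.log (P t) + ∑ t, z.1 t * Real.log (margX P t.2) + Real.log η / n ≤
        z.2.2.2 - z.2.1 ∧
      -∑ t, z.1 t * Real.log (P t) + Real.log η / n - Real.log (Fintype.card U) / n ≤
        z.2.2.2 ∧
      z.2.2.1 + ∑ t, z.1 t * Real.log (margY P t.1) + Real.log η / n ≤
        Real.log (mass (fun t : (Fin n → Y) × (Fin n → X) =>
          iidLaw (margY P) n t.1 * iidLaw (margX P) n t.2) {t | (t.1, φ t.2) ∈ D}) / n := by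
  classical
  have hn' : (0 : ℝ) < n := by exact_mod_cast hn
  let u : (Fin n → Y × X) → U := fun ω => φ fun j => (ω j).2
  let yu : (Fin n → Y × X) → (Fin n → Y) × U := fun ω => (fun j => (ω j).1, u ω)
  let S : Set (Fin n → Y × X) := {ω | yu ω ∈ D}
  set a := mass (iidLaw P n) S with ha
  have hηa : η ≤ a := by rw [mass_pairLaw] at hA; exact hA
  have ha0 : 0 < a := hη.trans_le hηa
  -- The source law conditioned on the event S. Its density is exactly 1/a on S, so `hent` computes
  -- its entropy with no error beyond log a.
  let p : (Fin n → Y × X) → ℝ := fun ω => S.indicator (iidLaw P n) ω / a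
  have hp : p ∈ stdSimplex ℝ (Fin n → Y × X) := by
    refine ⟨fun ω => div_nonneg (Set.indicator_nonneg (fun ω _ => iidLaw_nonneg hP.1 ω) ω) ha0.le,
      ?_⟩
    rw [← Finset.sum_div]; exact div_self ha0.ne'
  have hpS : ∀ ω, p ω ≠ 0 → ω ∈ S ∧ iidLaw P n ω ≠ 0 ∧ p ω = iidLaw P n ω / a := by
    intro ω h
    have hS : ω ∈ S := by
      by_contra hS
      exact h (by simp [p, Set.indicator_of_notMem hS])
    have e : p ω = iidLaw P n ω / a := by simp only [p, Set.indicator_of_mem hS]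
    refine ⟨hS, fun h0 => h (by rw [e, h0, zero_div]), e⟩
  have hpP : ∀ ω, p ω ≠ 0 → ∀ l, P (ω l) ≠ 0 := fun ω h => iidLaw_ne_zero.1 (hpS ω h).2.1
  have hlog : Real.log η ≤ Real.log a := Real.log_le_log hη hηa
  -- the joint entropy
  have hent : ent p = n * -∑ t, avgLaw p t * Real.log (P t) + Real.log a := by
    rw [ent_eq, mul_neg, ← sum_letters hn, ← one_mul (Real.log a), ← hp.2, Finset.sum_mul,
      ← Finset.sum_neg_distrib, ← Finset.sum_neg_distrib, ← Finset.sum_add_distrib]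
    refine Finset.sum_congr rfl fun ω _ => ?_
    by_cases h : p ω = 0
    · simp [h]
    · have e := (hpS ω h).2.2
      rw [← log_iidLaw (hpP ω h)]
      nth_rewrite 2 [e]
      rw [Real.log_div (hpS ω h).2.1 ha0.ne']
      ring
  have hent_le : ent p ≤ n * ent (avgLaw p) := by
    have := rvEnt_letters_le hn hp id (avgLaw_mem hn hp) fun ω h l => avgLaw_ne_zero hn hp.1 h l
    rw [← rvEnt_self, ent_eq]; exact this
  -- The message is a function of x^n, so adjoining it does not change the entropy.
  have hX : rvEnt p (fun ω => (u ω, fun j => (ω j).2)) ≤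
      n * -∑ t, avgLaw p t * Real.log (margX P t.2) := by
    have := rvEnt_letters_le hn hp Prod.snd (margX_mem hP)
      fun ω h l => (marg_ne_zero hP.1 (hpP ω h l)).1
    refine le_trans (le_of_eq (rvEnt_congr fun ω ω' => ?_)) this
    simp only [Prod.mk.injEq, u]
    exact ⟨fun h => h.2, fun h => ⟨by rw [h], h⟩⟩
  have hU : rvEnt p u ≤ Real.log (Fintype.card U) := ent_le_log_card (push_mem hp u)
  -- the exponent
  let pU : U → ℝ := push (iidLaw (margX P) n) φ
  have hpU0 : ∀ v, 0 ≤ pU v := push_nonneg (fun x => iidLaw_nonneg (margX_mem hP).1 x) φ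
  -- Conditioning raises probabilities by a factor of at most 1/a.
  have hpU : ∀ v, a * push p u v ≤ pU v := by
    intro v
    have e : pU v = push (iidLaw P n) u v := by
      simp only [pU, ← push_iidLaw_snd]
      exact push_push (fun (ω : Fin n → Y × X) j => (ω j).2) φ v
    rw [e, push, Finset.mul_sum]
    refine Finset.sum_le_sum fun ω _ => ?_
    rw [mul_ite, mul_zero]
    split_ifs
    swap
    · exact le_rfl
    simp only [p]
    rw [mul_div_cancel₀ _ ha0.ne']
    exact Set.indicator_le_self' (fun ω _ => iidLaw_nonneg hP.1 ω) ω
  have hupos : ∀ ω, p ω ≠ 0 → 0 < push p u (u ω) := fun ω h =>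
    (lt_of_le_of_ne (hp.1 ω) (Ne.symm h)).trans_le (le_push hp.1 u ω)
  let b : (Fin n → Y) × U → ℝ := D.indicator fun t => iidLaw (margY P) n t.1 * pU t.2
  have hb0 : ∀ t, 0 ≤ b t := fun t => Set.indicator_nonneg
    (fun t _ => mul_nonneg (iidLaw_nonneg (margY_mem hP).1 _) (hpU0 _)) t
  have hbyu : ∀ ω, p ω ≠ 0 → b (yu ω) = iidLaw (margY P) n (fun j => (ω j).1) * pU (u ω) :=
    fun ω h => Set.indicator_of_mem (show yu ω ∈ D from (hpS ω h).1) _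
  have hY0 : ∀ ω, p ω ≠ 0 → ∀ l, margY P (ω l).1 ≠ 0 :=
    fun ω h l => (marg_ne_zero hP.1 (hpP ω h l)).2
  have hpUpos : ∀ ω, p ω ≠ 0 → 0 < pU (u ω) := fun ω h =>
    (mul_pos ha0 (hupos ω h)).trans_le (hpU _)
  have hab : AbsCont (push p yu) b := by
    intro t ht
    by_contra h
    obtain ⟨ω, hω, rfl⟩ := exists_of_push_ne_zero h
    rw [hbyu ω hω] at ht
    exact mul_ne_zero (iidLaw_ne_zero.2 (hY0 ω hω)) (hpUpos ω hω).ne' ht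
  have hsum_b : ∑ t, b t = mass (fun t : (Fin n → Y) × (Fin n → X) =>
      iidLaw (margY P) n t.1 * iidLaw (margX P) n t.2) {t | (t.1, φ t.2) ∈ D} := by
    rw [mass, Fintype.sum_prod_type, Fintype.sum_prod_type]
    refine Finset.sum_congr rfl fun y _ => ?_
    have := sum_push_mul (p := iidLaw (margX P) n) φ
      fun v => if (y, v) ∈ D then iidLaw (margY P) n y else 0
    simp only [b, Set.indicator_apply, Set.mem_ofPred_eq]
    calc _ = ∑ v, pU v * (if (y, v) ∈ D then iidLaw (margY P) n y else 0) :=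
          Finset.sum_congr rfl fun v _ => by split_ifs <;> ring
      _ = _ := this
      _ = _ := Finset.sum_congr rfl fun v _ => by split_ifs <;> ring
  have hQ := log_mass_ge (push_mem hp yu) hb0 hab
  rw [hsum_b, sum_push_mul yu fun t => Real.log (b t)] at hQ
  have hlogb : n * ∑ t, avgLaw p t * Real.log (margY P t.1) + Real.log a - rvEnt p u ≤
      ∑ ω, p ω * Real.log (b (yu ω)) := by
    rw [← sum_letters hn (fun t : Y × X => Real.log (margY P t.1)), rvEnt_eq, sub_neg_eq_add,
      ← one_mul (Real.log a), ← hp.2, Finset.sum_mul, ← Finset.sum_add_distrib,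
      ← Finset.sum_add_distrib]
    refine Finset.sum_le_sum fun ω _ => ?_
    by_cases h : p ω = 0
    · simp [h]
    · rw [hbyu ω h, Real.log_mul (iidLaw_ne_zero.2 (hY0 ω h)) (hpUpos ω h).ne',
        log_iidLaw (hY0 ω h), ← mul_add, ← mul_add]
      refine mul_le_mul_of_nonneg_left ?_ (hp.1 ω)
      have := Real.log_le_log (mul_pos ha0 (hupos ω h)) (hpU (u ω))
      rw [Real.log_mul ha0.ne' (hupos ω h).ne'] at this
      linarith
  have hYU : ent (push p yu) = rvEnt p (fun ω => (u ω, fun j => (ω j).1)) :=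
    rvEnt_congr fun ω ω' => by simp only [yu, Prod.mk.injEq]; exact And.comm
  -- the single-letter point
  let z : (Y × X → ℝ) × ℝ × ℝ × ℝ :=
    ∑ l : Fin n, (n : ℝ)⁻¹ • rvPoint p (sideInfo u l) fun ω => ω l
  have hz : z ∈ entRegion X Y := (convex_convexHull ℝ _).sum_mem (fun _ _ => by positivity)
    (by simp [hn'.ne']) fun l _ => rvPoint_mem hp _ _
  have hz1 : z.1 = avgLaw p := by
    funext t
    simp [z, Prod.fst_sum, rvPoint, avgLaw, Finset.mul_sum]
  have hzX : z.2.1 = (n : ℝ)⁻¹ * ∑ l : Fin n,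
      (rvEnt p (fun ω => (sideInfo u l ω, (ω l).2)) - rvEnt p (sideInfo u l)) := by
    simp only [z, Prod.fst_sum, Prod.snd_sum, Prod.smul_fst, Prod.smul_snd, rvPoint, smul_eq_mul,
      Finset.mul_sum]
  have hzY : z.2.2.1 = (n : ℝ)⁻¹ * ∑ l : Fin n,
      (rvEnt p (fun ω => (sideInfo u l ω, (ω l).1)) - rvEnt p (sideInfo u l)) := by
    simp only [z, Prod.fst_sum, Prod.snd_sum, Prod.smul_fst, Prod.smul_snd, rvPoint, smul_eq_mul,
      Finset.mul_sum]
  have hzXY : z.2.2.2 = (n : ℝ)⁻¹ * ∑ l : Fin n,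
      (rvEnt p (fun ω => (sideInfo u l ω, ω l)) - rvEnt p (sideInfo u l)) := by
    simp only [z, Prod.snd_sum, Prod.smul_snd, rvPoint, smul_eq_mul, Finset.mul_sum]
  have hzX' : n * z.2.1 ≤ rvEnt p (fun ω => (u ω, fun j => (ω j).2)) - rvEnt p u := by
    rw [hzX, mul_inv_cancel_left₀ hn'.ne']
    exact sum_condEnt_le hp.1 u Prod.snd
  have hzY' : n * z.2.2.1 ≤ rvEnt p (fun ω => (u ω, fun j => (ω j).1)) - rvEnt p u := by
    rw [hzY, mul_inv_cancel_left₀ hn'.ne']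
    exact sum_condEnt_le hp.1 u Prod.fst
  have hzXY' : n * z.2.2.2 = ent p - rvEnt p u := by
    rw [hzXY, mul_inv_cancel_left₀ hn'.ne']
    exact sum_condEnt_eq u
  refine ⟨z, hz, ?_, ?_, ?_, ?_, ?_⟩
  · rw [hz1]
    intro t ht
    have : ∀ l, push p (fun ω => ω l) t = 0 := by
      intro l
      by_contra h
      obtain ⟨ω, hω, rfl⟩ := exists_of_push_ne_zero h
      exact hpP ω hω l ht
    simp [avgLaw, this]
  all_goals rw [hz1]; refine le_of_mul_le_mul_left ?_ hn'
  · rw [mul_add, mul_div_cancel₀ _ hn'.ne']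
    linarith
  · rw [mul_add, mul_add, mul_sub, mul_div_cancel₀ _ hn'.ne']
    linarith
  · rw [mul_sub, mul_add, mul_div_cancel₀ _ hn'.ne', mul_div_cancel₀ _ hn'.ne']
    linarith
  · rw [mul_add, mul_add, mul_div_cancel₀ _ hn'.ne', mul_div_cancel₀ _ hn'.ne']
    linarith

end Change

/-! ### The converse -/

section Converse

variable {X Y : Type*} [Fintype X] [Fintype Y] {P : Y × X → ℝ}

lemma sum_mul_margX (P : Y × X → ℝ) (f : X → ℝ) : ∑ t, P t * f t.2 = ∑ x, margX P x * f x := by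
  simp only [margX, Finset.sum_mul]
  rw [Fintype.sum_prod_type, Finset.sum_comm]

lemma sum_mul_margY (P : Y × X → ℝ) (f : Y → ℝ) : ∑ t, P t * f t.1 = ∑ y, margY P y * f y := by
  simp only [margY, Finset.sum_mul]
  rw [Fintype.sum_prod_type]

/-- Points of the entropy region which nearly satisfy the constraints of the multi-letter converse
accumulate at a point that comes from a kernel. -/
lemma exists_channel_of_approx (hP : P ∈ stdSimplex ℝ (Y × X)) {R e : ℝ}
    (h : ∀ δ > 0, ∃ z ∈ entRegion X Y, AbsCont z.1 P ∧
      -∑ t, z.1 t * Real.log (P t) - δ ≤ ent z.1 ∧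
      -∑ t, z.1 t * Real.log (P t) + ∑ t, z.1 t * Real.log (margX P t.2) - δ ≤
        z.2.2.2 - z.2.1 ∧
      -∑ t, z.1 t * Real.log (P t) - R - δ ≤ z.2.2.2 ∧
      z.2.2.1 + ∑ t, z.1 t * Real.log (margY P t.1) - δ ≤ -e) :
    ∃ K : TestChannel X, Setup.infoXU (margX P) K ≤ R ∧ e ≤ chanYU P K := by
  -- The tolerance runs through 1/(l + 1), and compactness yields a limit point w along a
  -- subsequence.
  choose z hz hac h1 h2 h3 h4 using fun l : ℕ => h (1 / ((l : ℝ) + 1)) Nat.one_div_pos_of_nat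
  obtain ⟨w, hw, φ, hφ, hlim⟩ := isCompact_entRegion.tendsto_subseq hz
  have hδ : Tendsto (fun l : ℕ => 1 / ((φ l : ℝ) + 1)) atTop (𝓝 0) :=
    tendsto_one_div_add_atTop_nhds_zero_nat.comp hφ.tendsto_atTop
  have hp : Tendsto (fun l => (z (φ l)).1) atTop (𝓝 w.1) := (continuous_fst.tendsto w).comp hlim
  have hpt : ∀ t, Tendsto (fun l => (z (φ l)).1 t) atTop (𝓝 (w.1 t)) := tendsto_pi_nhds.1 hp
  have hc : ∀ f : Y × X → ℝ, Tendsto (fun l => ∑ t, (z (φ l)).1 t * f t) atTop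
      (𝓝 (∑ t, w.1 t * f t)) := fun f =>
    tendsto_finsetSum _ fun t _ => (hpt t).mul_const _
  have hsnd : Tendsto (fun l => (z (φ l)).2) atTop (𝓝 w.2) := (continuous_snd.tendsto w).comp hlim
  have hx : Tendsto (fun l => (z (φ l)).2.1) atTop (𝓝 w.2.1) :=
    (continuous_fst.tendsto w.2).comp hsnd
  have hy : Tendsto (fun l => (z (φ l)).2.2.1) atTop (𝓝 w.2.2.1) :=
    ((continuous_fst.comp continuous_snd).tendsto w.2).comp hsnd
  have hxy : Tendsto (fun l => (z (φ l)).2.2.2) atTop (𝓝 w.2.2.2) :=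
    ((continuous_snd.comp continuous_snd).tendsto w.2).comp hsnd
  have g1 := le_of_tendsto_of_tendsto' ((hc fun t => Real.log (P t)).neg.sub hδ)
    ((continuous_ent.tendsto w.1).comp hp) fun l => h1 (φ l)
  have g2 := le_of_tendsto_of_tendsto' (((hc fun t => Real.log (P t)).neg.add
    (hc fun t => Real.log (margX P t.2))).sub hδ) (hxy.sub hx) fun l => h2 (φ l)
  have g3 := le_of_tendsto_of_tendsto' (((hc fun t => Real.log (P t)).neg.sub_const R).sub hδ)
    hxy fun l => h3 (φ l)
  have g4 := le_of_tendsto' ((hy.add (hc fun t => Real.log (margY P t.1))).sub hδ)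
    fun l => h4 (φ l)
  have hwac : AbsCont w.1 P := fun t ht =>
    tendsto_nhds_unique (hpt t) (by simp [hac _ t ht])
  have hwmem := entRegion_fst_mem hw
  -- In the limit the cross entropy with respect to P is at most the entropy, which is the equality
  -- case of the Gibbs inequality.
  have hwP : w.1 = P := by
    refine eq_of_gibbs hwmem.1 hP.1 hwac (by rw [hP.2, hwmem.2]) ?_
    rw [ent_eq] at g1
    simp_rw [mul_sub, Finset.sum_sub_distrib]
    linarith
  rw [hwP] at g2 g3 g4
  rw [sum_mul_margX P fun x => Real.log (margX P x)] at g2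
  rw [sum_mul_margY P fun y => Real.log (margY P y)] at g4
  have e0 := ent_eq P
  have eX := ent_eq (margX P)
  have eY := ent_eq (margY P)
  -- `g2` is the reverse of this inequality and yields the Markov chain. The inequality itself gives
  -- I(X;V) ≤ I(Y,X;V), which `g3` bounds by R.
  have hle := entRegion_condEnt_le hw
  rw [hwP] at hle
  obtain ⟨K, hK1, hK2⟩ := exists_channel_of_markov hP hw hwP (by linarith)
  exact ⟨K, by linarith, by linarith⟩

lemma mass_pairLaw_fst (P : Y × X → ℝ) (n : ℕ) (s : Set (Fin n → Y)) :
    mass (pairLaw P n) {t | t.1 ∈ s} = mass (iidLaw (margY P) n) s := by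
  classical
  simp only [mass, Set.indicator_apply, Set.mem_ofPred_eq]
  rw [Fintype.sum_prod_type]
  refine Finset.sum_congr rfl fun y _ => ?_
  split_ifs
  · exact sum_pairLaw_right P n y
  · simp

lemma mass_pairLaw_snd (P : Y × X → ℝ) (n : ℕ) (s : Set (Fin n → X)) :
    mass (pairLaw P n) {t | t.2 ∈ s} = mass (iidLaw (margX P) n) s := by
  classical
  simp only [mass, Set.indicator_apply, Set.mem_ofPred_eq]
  rw [Fintype.sum_prod_type, Finset.sum_comm]
  refine Finset.sum_congr rfl fun x _ => ?_
  split_ifs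
  · exact sum_pairLaw_left P n x
  · simp

lemma pairLaw_mem (hP : P ∈ stdSimplex ℝ (Y × X)) (n : ℕ) :
    pairLaw P n ∈ stdSimplex ℝ ((Fin n → Y) × (Fin n → X)) :=
  ⟨fun _ => iidLaw_nonneg hP.1 _, by rw [sum_pair]; exact sum_iidLaw hP.2 n⟩

/-- Markov's inequality for a test with values in `[0, 1]`. -/
lemma half_le_mass {Ω : Type*} [Fintype Ω] {p : Ω → ℝ} (hp : p ∈ stdSimplex ℝ Ω) {a : Ω → ℝ}
    (ha : ∀ ω, a ω ≤ 1) {η : ℝ} (hη : 0 ≤ η) (h : η ≤ ∑ ω, p ω * a ω) :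
    η / 2 ≤ mass p {ω | η / 2 ≤ a ω} := by
  classical
  have : ∑ ω, p ω * a ω ≤ ∑ ω, (Set.indicator {ω | η / 2 ≤ a ω} p ω + p ω * (η / 2)) := by
    refine Finset.sum_le_sum fun ω _ => ?_
    have h0 := hp.1 ω
    rw [Set.indicator_apply]
    split_ifs with hω
    · have := mul_le_mul_of_nonneg_left (ha ω) h0
      have := mul_nonneg h0 hη
      linarith
    · have := mul_le_mul_of_nonneg_left (not_le.1 hω).le h0
      linarith
  rw [Finset.sum_add_distrib, ← Finset.sum_mul, hp.2] at this
  rw [mass]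
  linarith

/-- The joint law is absolutely continuous with respect to the product of its marginals; positivity
makes the logarithm of the mass usable. -/
lemma mass_prod_pos (hP : P ∈ stdSimplex ℝ (Y × X)) {n : ℕ}
    {s : Set ((Fin n → Y) × (Fin n → X))} (h : 0 < mass (pairLaw P n) s) :
    0 < mass (fun t : (Fin n → Y) × (Fin n → X) =>
      iidLaw (margY P) n t.1 * iidLaw (margX P) n t.2) s := by
  obtain ⟨t, _, ht⟩ := Finset.exists_ne_zero_of_sum_ne_zero h.ne'
  have hts : t ∈ s := Set.mem_of_indicator_ne_zero ht
  rw [Set.indicator_of_mem hts] at ht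
  have h0 : ∀ t : (Fin n → Y) × (Fin n → X),
      0 ≤ iidLaw (margY P) n t.1 * iidLaw (margX P) n t.2 := fun t =>
    mul_nonneg (iidLaw_nonneg (margY_mem hP).1 _) (iidLaw_nonneg (margX_mem hP).1 _)
  refine Finset.sum_pos' (fun t _ => Set.indicator_nonneg (fun t _ => h0 t) t)
    ⟨t, Finset.mem_univ _, ?_⟩
  rw [Set.indicator_of_mem hts]
  refine lt_of_le_of_ne (h0 t) (Ne.symm (mul_ne_zero ?_ ?_))
  · exact iidLaw_ne_zero.2 fun l => (marg_ne_zero hP.1 (iidLaw_ne_zero.1 ht l)).2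
  · exact iidLaw_ne_zero.2 fun l => (marg_ne_zero hP.1 (iidLaw_ne_zero.1 ht l)).1

end Converse

/-! ### From testing schemes to the single-letter converse. -/

namespace Setup

variable {X Y : Type*} [Fintype X] [Fintype Y] {m k r : ℕ} {S : Setup X Y m k r}

/-- The measure with all weights equal to Γ is admissible, since γ ≤ 1 ≤ Γ, and dominates every
single product. -/
lemma accProb_le_typeII (hS : S.Valid) (i : Fin m) {γ Γ : ℝ} (hγ1 : γ ≤ 1) (hΓ1 : 1 ≤ Γ) {n : ℕ}
    (T : Scheme X Y n) (j : Fin k) (t : Fin r) :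
    ENNReal.ofReal (S.accProb T j t) ≤ S.typeII γ Γ T := by
  refine le_trans (ENNReal.ofReal_le_ofReal ?_) (le_iSup₂_of_le
    (fun y x => ∑ j, ∑ t, Γ * (S.QY j n y * S.QX t n x))
    ⟨fun _ _ => Γ, ⟨fun _ _ => ⟨zero_le_one.trans hΓ1, le_rfl⟩,
      fun _ _ _ _ _ => hγ1.trans hΓ1⟩, rfl⟩ le_rfl)
  rw [sum_alternative fun _ _ => Γ]
  have h0 : ∀ j t, 0 ≤ Γ * S.accProb T j t := fun j t =>
    mul_nonneg (zero_le_one.trans hΓ1) (accProb_nonneg hS i T j t)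
  refine le_trans ?_ (Finset.single_le_sum
    (fun j _ => Finset.sum_nonneg fun t _ => h0 j t) (Finset.mem_univ j))
  refine le_trans ?_ (Finset.single_le_sum (fun t _ => h0 j t) (Finset.mem_univ t))
  exact le_mul_of_one_le_left (accProb_nonneg hS i T j t) hΓ1

lemma le_exp_of_le_log_inv_div {β : ℝ≥0∞} {b : ℝ} (hb : ENNReal.ofReal b ≤ β) {n : ℕ}
    (hn : 0 < n) {c : ℝ} (h : (c : EReal) ≤ ENNReal.log β⁻¹ / (n : EReal)) :
    b ≤ Real.exp (-(n * c)) := by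
  rcases le_or_gt b 0 with hb0 | hb0
  · exact hb0.trans (Real.exp_pos _).le
  rw [EReal.le_div_iff_mul_le (by exact_mod_cast hn) (EReal.natCast_ne_top n), ENNReal.log_inv]
    at h
  have h1 := ENNReal.log_le_log hb
  rw [ENNReal.log_ofReal_of_pos hb0] at h1
  have h2 := h.trans (EReal.neg_le_neg_iff.2 h1)
  have h3 : c * n ≤ -Real.log b := by exact_mod_cast h2
  rw [← Real.log_le_iff_le_exp hb0]
  linarith

/-- A scheme which accepts the source `i` with probability at least `η` provides an event to which
the multi-letter converse applies. -/
lemma exists_event (hS : S.Valid) {i : Fin m} {n : ℕ} (T : Scheme X Y n) {j : Fin k} {t : Fin r}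
    {η bY bX : ℝ} (hη : 0 < η) (hbY : 0 ≤ bY) (hbX : 0 ≤ bX)
    (ha : η ≤ ∑ ω : (Fin n → Y) × (Fin n → X),
      pairLaw (S.P i) n ω * T.accept ω.1 (T.enc ω.2))
    (hY : mass (iidLaw (S.PY i) n) {y | ¬ iidLaw (S.PY i) n y ≤ bY * S.QY j n y} ≤ η / 8)
    (hX : mass (iidLaw (S.PX i) n) {x | ¬ iidLaw (S.PX i) n x ≤ bX * S.QX t n x} ≤ η / 8) :
    ∃ (φ : (Fin n → X) → Fin T.size × Bool) (D : Set ((Fin n → Y) × Fin T.size × Bool)),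
      η / 4 ≤ mass (pairLaw (S.P i) n) {ω | (ω.1, φ ω.2) ∈ D} ∧
      mass (fun ω : (Fin n → Y) × (Fin n → X) =>
        iidLaw (margY (S.P i)) n ω.1 * iidLaw (margX (S.P i)) n ω.2) {ω | (ω.1, φ ω.2) ∈ D} ≤
        bY * bX * (2 / η) * S.accProb T j t := by
  classical
  set GY : Set (Fin n → Y) := {y | ¬ iidLaw (S.PY i) n y ≤ bY * S.QY j n y} with hGY
  set GX : Set (Fin n → X) := {x | ¬ iidLaw (S.PX i) n x ≤ bX * S.QX t n x} with hGX
  have h0 := pairLaw_mem (hS.mem i) n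
  -- One extra message bit reports whether x is atypical, so that the event still depends on x only
  -- through the message. Thresholding the randomised decision at η/2 leaves mass η/2, and the two
  -- atypical sets remove at most η/8 each.
  refine ⟨fun x => (T.enc x, decide (x ∉ GX)),
    {d | d.2.2 = true ∧ d.1 ∉ GY ∧ η / 2 ≤ T.accept d.1 d.2.1}, ?_, ?_⟩
  · have h1 := half_le_mass h0
      (a := fun ω : (Fin n → Y) × (Fin n → X) => T.accept ω.1 (T.enc ω.2))
      (fun ω => (T.mem _ _).2) hη.le ha
    have h2 : mass (pairLaw (S.P i) n) {ω | η / 2 ≤ T.accept ω.1 (T.enc ω.2)} ≤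
        mass (pairLaw (S.P i) n)
          ({ω | decide (ω.2 ∉ GX) = true ∧ ω.1 ∉ GY ∧ η / 2 ≤ T.accept ω.1 (T.enc ω.2)} ∪
            ({ω | ω.1 ∈ GY} ∪ {ω | ω.2 ∈ GX})) := by
      refine mass_mono h0.1 fun ω hω => ?_
      have hω' : η / 2 ≤ T.accept ω.1 (T.enc ω.2) := hω
      simp only [Set.mem_union, Set.mem_ofPred_eq, decide_eq_true_eq]
      tauto
    have h3 := h2.trans ((mass_union_le h0.1).trans
      (add_le_add_right (mass_union_le h0.1) _))
    rw [mass_pairLaw_fst, mass_pairLaw_snd] at h3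
    have hY' : mass (iidLaw (margY (S.P i)) n) GY ≤ η / 8 := hY
    have hX' : mass (iidLaw (margX (S.P i)) n) GX ≤ η / 8 := hX
    refine le_trans ?_ (sub_le_iff_le_add.2 h3)
    linarith
  · have hQY := fun y => ((hS.exists_minY i).1 j).nonneg n y
    have hQX := fun x => ((hS.exists_minX i).1 t).nonneg n x
    rw [accProb, ← Fintype.sum_prod_type', Finset.mul_sum]
    refine Finset.sum_le_sum fun ω _ => ?_
    have hr : 0 ≤ bY * S.QY j n ω.1 * (bX * S.QX t n ω.2) :=
      mul_nonneg (mul_nonneg hbY (hQY _)) (mul_nonneg hbX (hQX _))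
    rw [Set.indicator_apply]
    split_ifs with hω
    · obtain ⟨h1, h2, h3⟩ := hω
      simp only [decide_eq_true_eq] at h1
      simp only [hGX, hGY, Set.mem_ofPred_eq, not_not] at h1 h2
      have h4 : 1 ≤ 2 / η * T.accept ω.1 (T.enc ω.2) := by
        have := mul_le_mul_of_nonneg_left h3 (by positivity : 0 ≤ 2 / η)
        rwa [div_mul_div_cancel₀' two_ne_zero, div_self hη.ne'] at this
      calc _ ≤ bY * S.QY j n ω.1 * (bX * S.QX t n ω.2) :=
            mul_le_mul h2 h1 (iidLaw_nonneg (margX_mem (hS.mem i)).1 _)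
              (mul_nonneg hbY (hQY _))
        _ ≤ bY * S.QY j n ω.1 * (bX * S.QX t n ω.2) * (2 / η * T.accept ω.1 (T.enc ω.2)) :=
            le_mul_of_one_le_right hr h4
        _ = _ := by ring
    · calc 0 ≤ bY * S.QY j n ω.1 * (bX * S.QX t n ω.2) *
            (2 / η * T.accept ω.1 (T.enc ω.2)) :=
            mul_nonneg hr (mul_nonneg (by positivity) (T.mem _ _).1)
        _ = _ := by ring

/-- If a sequence of schemes of rate `R` and exponent `E` accepts a source with a probability that
does not vanish, then `E` is at most the optimal exponent of this source. -/
lemma le_xi_of_frequently (hS : S.Valid) {R E : ℝ} {T : (n : ℕ) → Scheme X Y n}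
    (hsize : ∀ δ > 0, ∀ᶠ n : ℕ in atTop, Real.log (T n).size / n ≤ R + δ)
    (hexp : ∀ j t, ∀ δ > 0, ∀ᶠ n : ℕ in atTop, S.accProb (T n) j t ≤ Real.exp (-(n * (E - δ))))
    {i : Fin m} {η : ℝ} (hη : 0 < η)
    (ha : ∃ᶠ n in atTop, η ≤ ∑ ω : (Fin n → Y) × (Fin n → X),
      pairLaw (S.P i) n ω * (T n).accept ω.1 ((T n).enc ω.2)) : E ≤ S.xi R i := by
  -- The processes attaining the minimal rates give the tightest bound.
  obtain ⟨hcY, -, j, hj⟩ := hS.exists_minY i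
  obtain ⟨hcX, -, t, ht⟩ := hS.exists_minX i
  suffices ∃ K : TestChannel X, infoXU (margX (S.P i)) K ≤ R ∧
      E - (S.dY i + S.dX (S.PX i)) ≤ chanYU (S.P i) K by
    obtain ⟨K, hK1, hK2⟩ := this
    have h1 : S.infoYU i K + (S.dY i + S.dX (S.PX i)) ≤ S.xi R i := infoYU_le_xi hS hK1
    have h2 : E - (S.dY i + S.dX (S.PX i)) ≤ S.infoYU i K := hK2
    linarith
  refine exists_channel_of_approx (hS.mem i) fun δ hδ => ?_
  have hδ4 : 0 < δ / 8 := by positivity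
  have hY := ((hcY j).lrUpper (margY_mem (hS.mem i)) (D := S.dY i + δ / 8)
    (by rw [hj]; exact EReal.coe_lt_coe_iff.2 (by linarith))).eventually_le_const
    (show 0 < η / 8 by positivity)
  have hX := ((hcX t).lrUpper (margX_mem (hS.mem i)) (D := S.dX (S.PX i) + δ / 8)
    (by rw [ht]; exact EReal.coe_lt_coe_iff.2 (by linarith))).eventually_le_const
    (show 0 < η / 8 by positivity)
  have hconst : ∀ c : ℝ, ∀ᶠ n : ℕ in atTop, |c / n| < δ / 8 := fun c => by
    have := (tendsto_const_div_atTop_nhds_zero_nat c).abs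
    rw [abs_zero] at this
    exact this.eventually_lt_const hδ4
  -- A single blocklength meeting all conditions suffices, so acceptance need only be frequent.
  -- Constants divided by n fall below δ/8, and at most five eighths of δ are spent in any
  -- constraint.
  obtain ⟨n, han, hn0, hYn, hXn, hsn, hen, hc1, hc2, hc3⟩ := (ha.and_eventually
    ((eventually_gt_atTop 0).and (hY.and (hX.and ((hsize _ hδ4).and ((hexp j t _ hδ4).and
      ((hconst (Real.log (η / 4))).and ((hconst (Real.log 2)).and
        (hconst (Real.log (2 / η))))))))))).exists
  have hn0' : (0 : ℝ) < n := by exact_mod_cast hn0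
  obtain ⟨φ, D, hA, hQ⟩ := exists_event hS (T n) (i := i) (j := j) (t := t) hη
    (Real.exp_pos (n * (S.dY i + δ / 8))).le (Real.exp_pos (n * (S.dX (S.PX i) + δ / 8))).le
    han hYn hXn
  have hη4 : 0 < η / 4 := by positivity
  obtain ⟨z, hz, hac, h1, h2, h3, h4⟩ := exists_converse_point (hS.mem i) hn0 φ D hη4 hA
  have hpos := mass_prod_pos (hS.mem i) (hη4.trans_le hA)
  set q := mass (fun ω : (Fin n → Y) × (Fin n → X) =>
    iidLaw (margY (S.P i)) n ω.1 * iidLaw (margX (S.P i)) n ω.2) {ω | (ω.1, φ ω.2) ∈ D}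
  have hcard : Real.log (Fintype.card (Fin (T n).size × Bool)) / n ≤ R + 2 * (δ / 8) := by
    have : Real.log (Fintype.card (Fin (T n).size × Bool)) ≤
        Real.log (T n).size + Real.log 2 := by
      rw [Fintype.card_prod, Fintype.card_fin, Fintype.card_bool, Nat.cast_mul]
      rcases Nat.eq_zero_or_pos (T n).size with hs | hs
      · rw [hs]; simp [Real.log_nonneg]
      · rw [Real.log_mul (by exact_mod_cast hs.ne') (by norm_num)]; norm_num
    have h5 := div_le_div_of_nonneg_right this hn0'.le
    rw [add_div] at h5
    have := (abs_lt.1 hc2).2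
    linarith
  have hlogq : Real.log q / n ≤ -(E - (S.dY i + S.dX (S.PX i))) + 4 * (δ / 8) := by
    have h5 : q ≤ Real.exp (n * (S.dY i + S.dX (S.PX i) + 2 * (δ / 8)) + Real.log (2 / η) -
        n * (E - δ / 8)) := by
      refine hQ.trans ((mul_le_mul_of_nonneg_left hen (by positivity)).trans (le_of_eq ?_))
      conv_lhs =>
        rw [← Real.exp_log (show 0 < 2 / η by positivity), ← Real.exp_add, ← Real.exp_add,
          ← Real.exp_add]
      congr 1
      ring
    have h6 := div_le_div_of_nonneg_right ((Real.log_le_iff_le_exp hpos).2 h5) hn0'.le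
    rw [sub_div, add_div, mul_div_cancel_left₀ _ hn0'.ne', mul_div_cancel_left₀ _ hn0'.ne'] at h6
    have := (abs_lt.1 hc3).2
    linarith
  have h7 := (abs_lt.1 hc1).1
  exact ⟨z, hz, hac, by linarith, by linarith, by linarith, by linarith⟩

/-- Among sources of total weight larger than the permitted error there is one whose optimal
exponent is at least a given achievable exponent. -/
lemma exists_le_xi_of_achievable (hS : S.Valid) {ν : Fin m → ℝ} (hν : ∀ i, 0 < ν i) {γ : ℝ}
    (hγ1 : γ ≤ 1) {Γ : ℕ → ℝ} (hΓ1 : ∀ n, 1 ≤ Γ n) {R ε E : ℝ} (h : S.Achievable ν γ Γ ε R E)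
    {F : Finset (Fin m)} (hF : ε < ∑ i ∈ F, ν i) : ∃ i ∈ F, E ≤ S.xi R i := by
  obtain ⟨T, hI, hII, hsize⟩ := h
  by_contra! hlt
  have hsize' : ∀ δ > 0, ∀ᶠ n : ℕ in atTop, Real.log (T n).size / n ≤ R + δ := by
    intro δ hδ
    have : limsup (fun n : ℕ => ((Real.log (T n).size / n : ℝ) : EReal)) atTop <
        ((R + δ : ℝ) : EReal) := hsize.trans_lt (EReal.coe_lt_coe_iff.2 (by linarith))
    filter_upwards [eventually_lt_of_limsup_lt this] with n hn
    exact (EReal.coe_lt_coe_iff.1 hn).le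
  have hexp : ∀ i : Fin m, ∀ j t, ∀ δ > 0, ∀ᶠ n : ℕ in atTop,
      S.accProb (T n) j t ≤ Real.exp (-(n * (E - δ))) := by
    intro i j t δ hδ
    have : ((E - δ : ℝ) : EReal) < liminf (fun n : ℕ =>
        ENNReal.log ((S.typeII γ (Γ n) (T n))⁻¹) / (n : EReal)) atTop :=
      lt_of_lt_of_le (EReal.coe_lt_coe_iff.2 (by linarith)) hII
    filter_upwards [eventually_lt_of_lt_liminf this, eventually_gt_atTop 0] with n hn hn0
    exact le_exp_of_le_log_inv_div (accProb_le_typeII hS i hγ1 (hΓ1 n) (T n) j t) hn0 hn.le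
  -- If every ξ on F were below E, each source in F would be accepted with vanishing probability,
  -- and the type I error would tend to at least the weight of F.
  have hac : ∀ i ∈ F, ∀ η > 0, ∀ᶠ n in atTop, ∑ ω : (Fin n → Y) × (Fin n → X),
      pairLaw (S.P i) n ω * (T n).accept ω.1 ((T n).enc ω.2) < η := by
    intro i hi η hη
    by_contra hcon
    rw [not_eventually] at hcon
    simp only [not_lt] at hcon
    exact (hlt i hi).not_ge (le_xi_of_frequently hS hsize' (hexp i) hη hcon)
  have hFpos : ∀ n, ∀ i, 0 ≤ ∑ ω : (Fin n → Y) × (Fin n → X),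
      pairLaw (S.P i) n ω * (1 - (T n).accept ω.1 ((T n).enc ω.2)) := fun n i =>
    Finset.sum_nonneg fun ω _ => mul_nonneg ((pairLaw_mem (hS.mem i) n).1 ω)
      (sub_nonneg.2 ((T n).mem _ _).2)
  set s := ∑ i ∈ F, ν i with hs
  have hs0 : 0 ≤ s := Finset.sum_nonneg fun i _ => (hν i).le
  obtain ⟨η, hη, hηs⟩ : ∃ η > 0, ε < s * (1 - η) := by
    -- This choice makes s η at most (s − ε)/2; the s + 1 avoids dividing by zero.
    refine ⟨(s - ε) / (2 * (s + 1)), div_pos (by linarith) (by linarith), ?_⟩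
    have h1 : s * ((s - ε) / (2 * (s + 1))) ≤ (s - ε) / 2 := by
      rw [← mul_div_assoc, div_le_div_iff₀ (by linarith) two_pos]
      nlinarith
    linarith
  have hev : ∀ᶠ n in atTop, s * (1 - η) ≤ S.typeI ν (T n) := by
    filter_upwards [(eventually_all_finset F).2 fun i hi => hac i hi η hη] with n hn
    rw [typeI_eq]
    refine le_trans ?_ (Finset.sum_le_univ_sum_of_nonneg (s := F) fun i =>
      mul_nonneg (hν i).le (hFpos n i))
    rw [hs, Finset.sum_mul]
    refine Finset.sum_le_sum fun i hi => mul_le_mul_of_nonneg_left ?_ (hν i).le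
    simp_rw [mul_sub, mul_one, Finset.sum_sub_distrib]
    rw [(pairLaw_mem (hS.mem i) n).2]
    linarith [hn i hi]
  have hle : ((s * (1 - η) : ℝ) : EReal) ≤ limsup (fun n => (S.typeI ν (T n) : EReal)) atTop := by
    refine le_limsup_of_frequently_le (Eventually.frequently ?_)
    filter_upwards [hev] with n hn
    exact EReal.coe_le_coe_iff.2 hn
  exact hηs.not_ge (EReal.coe_le_coe_iff.1 (hle.trans hI))

end Setup

end MixHT
end

/-! ### The optimal exponent. -/

theorem theorem4 {X Y : Type*} [Fintype X] [Fintype Y] {m k r : ℕ}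
    (S : MixHT.Setup X Y m k r) (hS : S.Valid)
    (ν : Fin m → ℝ) (hν : ∀ i, 0 < ν i) (hν1 : ∑ i, ν i = 1)
    (γ : ℝ) (hγ0 : 0 < γ) (hγ1 : γ < 1)
    (Γ : ℕ → ℝ) (hΓ1 : ∀ n, 1 ≤ Γ n)
    (hΓ : Tendsto (fun n : ℕ => Real.log (Γ n) / n) atTop (𝓝 0))
    (R : ℝ) (hR : 0 ≤ R) (hsep : S.Separable R)
    (π : Equiv.Perm (Fin m)) (hπ : Monotone fun i => S.xi R (π.symm i))
    (ε : ℝ) (i : Fin m)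
    (hε₁ : ∑ j ∈ Finset.Iio i, ν (π.symm j) ≤ ε)
    (hε₂ : ε < ∑ j ∈ Finset.Iic i, ν (π.symm j)) :
    S.maxExponent ν γ Γ ε R = (S.xi R (π.symm i) : EReal) := by
  classical
  refine le_antisymm (iSup₂_le fun E hE => ?_) (le_iSup₂_of_le (S.xi R (π.symm i)) ?_ le_rfl)
  -- The i smallest sources together with the i-th outweigh ε, so one of them bounds E, and all of
  -- them lie below the i-th value.
  · obtain ⟨i', hi', hle⟩ := MixHT.Setup.exists_le_xi_of_achievable hS hν hγ1.le hΓ1 hE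
      (F := (Finset.Iic i).map π.symm.toEmbedding) (by simpa using hε₂)
    obtain ⟨j, hj, rfl⟩ := Finset.mem_map.1 hi'
    exact EReal.coe_le_coe_iff.2 (hle.trans (hπ (Finset.mem_Iic.1 hj)))
  -- Sources strictly below the level of index i precede i in the monotone arrangement; ties only
  -- shrink the set to be given up.
  · refine MixHT.Setup.achievable_of_sum_le hS hν hν1 hΓ1 hΓ hR hsep (le_trans ?_ hε₁)
    refine le_trans ?_ (Finset.sum_map (Finset.Iio i) π.symm.toEmbedding ν).le
    refine Finset.sum_le_sum_of_subset_of_nonneg (fun i' hi' => ?_) fun i' _ _ => (hν i').le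
    refine Finset.mem_map.2 ⟨π i', Finset.mem_Iio.2 ?_, π.symm_apply_apply i'⟩
    have h := (Finset.mem_filter.1 hi').2
    by_contra hcon
    have h2 := hπ (not_lt.1 hcon)
    simp only [π.symm_apply_apply] at h2
    exact h.not_ge h2
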